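/- **Setting.** Let $G=SL(2,\mathbb R)$, let $P\subset G$ be the subgroup of lower triangular matrices, and $w=\begin{pmatrix}0&-1\\1&0\end{pmatrix}$. For $\lambda\in\mathbb C$ let $C^\infty(G/P,\mathcal L_\lambda)$ be the Fréchet space of smooth sections of the homogeneous line bundle over $G/P$ attached to the character $\begin{pmatrix}a&0\\c&a^{-1}\end{pmatrix}\mapsto|a|^{-\lambda}$. Equivalently, it is the space of smooth functions $F$ on $\mathbb R^2\setminus\{0\}$ with $F(tv)=|t|^{-\lambda}F(v)$ for $t\in\mathbb R^\times$, with $G$-action $(\varpi_\lambda(g)F)(v)=F(g^{-1}v)$. Write $h(\zeta)=F(\zeta,1)$ for $\zeta\in\mathbb R\subset G/P=\mathbb R\cup\{\infty\}$. The map $\varphi\mapsto|v|^{-\lambda}\varphi$ identifies $C^\infty(G/P)$ with $C^\infty(G/P,\mathcal L_\lambda)$; holomorphy and meromorphy in $\lambda$ below are understood through this identification. Let $\mathrm{dS}^2=\{(x,y,z)\in\mathbb R^3:x^2+y^2-z^2=1\}$, identified with the matrices $A=\begin{pmatrix}x&y+z\\y-z&-x\end{pmatrix}$ of determinant $-1$,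 on which $G$ acts by $A\mapsto gAg^{-1}$. Thus $\mathrm{dS}^2=G/H$ with base point $E_{1,1}=\mathrm{diag}(1,-1)$ and $H$ the group of diagonal matrices in $G$. Let $\Delta$ be its Laplacian for the Lorentzian metric induced by $dx^2+dy^2-dz^2$, and give $C^\infty(\mathrm{dS}^2)$ its Fréchet topology. Put $t_+^\mu=t^\mu$ for $t>0$, $t_+^\mu=0$ for $t\le0$, and $t_-^\mu=(-t)_+^\mu$. For points $\zeta_1\ne\zeta_2$ of $G/P$ (in homogeneous coordinates when one of them is $\infty$) and $\operatorname{Re}\mu>-1$, $h\in C^\infty(G/P,\mathcal L_{2\mu+2})$, let $$(H_\mu^{\pm}h)(\zeta_1,\zeta_2)=\frac1{\zeta_1-\zeta_2}\int_{\mathbb R}h(\zeta)\Big(\frac{(\zeta_1-\zeta)(\zeta_2-\zeta)}{\zeta_1-\zeta_2}\Big)_{\mp}^{\mu}d\zeta ,$$ and let $\iota_1^*$ be the pull-back $f\mapsto(\zeta_1-\zeta_2)f(\zeta_1,\zeta_2)$ along $G/H\hookrightarrow G/P\times G/P$, $gH\mapsto(gP,gwP)$. **Proposition (Poisson transform).**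 For each of the two signs there are continuous linear operators $$\mathcal P_\lambda^{\pm}\colon C^\infty(G/P,\mathcal L_\lambda)\to C^\infty(\mathrm{dS}^2),\qquad\lambda\in\mathbb C\setminus\{0,-2,-4,\dots\},$$ with the following properties. 1. For $\operatorname{Re}\lambda>0$ one has $\mathcal P_\lambda^{\pm}=\iota_1^*\circ H_{\lambda/2-1}^{\pm}$, and, with an absolutely convergent integral, $$(\mathcal P_\lambda^\pm h)(x,y,z)=\int_{\mathbb R}q(x,y,z;\zeta)_{\mp}^{\lambda/2-1}\,h(\zeta)\,d\zeta,\qquad q=\tfrac12\big(2x\zeta-(y-z)\zeta^2+(y+z)\big),$$ where $q=\dfrac{((1+x)\zeta+(y+z))((1+x)-(y-z)\zeta)}{2(1+x)}$ if $x\ne-1$. 2. The operators depend meromorphically on $\lambda\in\mathbb C$, and holomorphically off $\{0,-2,-4,\dots\}$: for every $\varphi\in C^\infty(G/P)$ the map $\lambda\mapsto\mathcal P^\pm_\lambda(|v|^{-\lambda}\varphi)\in C^\infty(\mathrm{dS}^2)$ is holomorphic off these points, and at each point $\lambda_0\in\mathbb C$ there is $n\in\mathbb N$, independent of $\varphi$,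 such that $(\lambda-\lambda_0)^n\mathcal P_\lambda^\pm(|v|^{-\lambda}\,\cdot\,)$ extends near $\lambda_0$ to a holomorphic family of continuous linear operators $C^\infty(G/P)\to C^\infty(\mathrm{dS}^2)$. 3. For every $\lambda\notin\{0,-2,-4,\dots\}$, the image of $\mathcal P_\lambda^\pm$ is contained in $\{f\in C^\infty(\mathrm{dS}^2):\Delta f=-\tfrac14\lambda(\lambda-2)f\}$, and $\mathcal P_\lambda^\pm$ is $G$-intertwining: $(\mathcal P_\lambda^\pm\varpi_\lambda(g)h)(A)=(\mathcal P_\lambda^\pm h)(g^{-1}Ag)$ for all $g\in G$, $A\in\mathrm{dS}^2$. -/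

import Mathlib

open Set Filter Topology MeasureTheory
open scoped ContDiff Matrix

noncomputable section

namespace DeSitterPoisson

/-- The group `G = SL(2, ℝ)`. -/
abbrev SL2 : Type := Matrix.SpecialLinearGroup (Fin 2) ℝ

/-- The plane `ℝ²` on which `G` acts linearly. The parabolic subgroup `P` of lower triangular
matrices is the stabilizer of the line through `(0, 1)`, so `G/P` is the projective line, and
`ζ ∈ ℝ ⊂ G/P` is the line through `(ζ, 1)`. -/
abbrev Vec : Type := Fin 2 → ℝ

/-- `det (u | v)`; for `u = (ζ₁, 1)`, `v = (ζ₂, 1)` this is `ζ₁ - ζ₂`. -/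
def det2 (u v : Vec) : ℝ := u 0 * v 1 - u 1 * v 0

/-- The vector `(ζ, 1)` that represents the point `ζ` of the Bruhat cell `ℝ ⊂ G/P`. -/
def bruhat (ζ : ℝ) : Vec := ![ζ, 1]

/-! ### The `C^∞` topology -/

/-- The topology of uniform convergence of all derivatives on the compact subsets of `U`. -/
@[reducible]
def smoothTopology {X E : Type*} [NormedAddCommGroup E] [NormedSpace ℝ E] (U : Set E)
    (j : X → E → ℂ) : TopologicalSpace X :=
  ⨅ n : ℕ, TopologicalSpace.induced
    (fun f => UniformOnFun.ofFun {K : Set E | IsCompact K ∧ K ⊆ U} (iteratedFDeriv ℝ n (j f)))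
    inferInstance

/-! ### The principal series `C^∞(G/P, L_λ)` -/

/-- Smooth sections of `L_λ = L_λ^+` over `G/P`, as smooth functions on `ℝ² ∖ {0}` with
`F (t v) = |t|^{-λ} F v`. The section, as a function on `G` with
`φ (g p) = χ_λ^+(p)⁻¹ φ g`, is `φ g = F (g (0, 1))`; in the Bruhat coordinate it is
`f ζ = F (ζ, 1)`. The value at the origin carries no information and is set to `0`. -/
def sectionSpace (lam : ℂ) : Submodule ℂ (Vec → ℂ) where
  carrier := {F | F 0 = 0 ∧ ContDiffOn ℝ ∞ F {0}ᶜ ∧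
    ∀ t : ℝ, t ≠ 0 → ∀ v : Vec, v ≠ 0 → F (t • v) = ((|t| : ℝ) : ℂ) ^ (-lam) * F v}
  zero_mem' := ⟨rfl, contDiffOn_const, by simp⟩
  add_mem' := by
    rintro F₁ F₂ ⟨h₁, s₁, e₁⟩ ⟨h₂, s₂, e₂⟩
    refine ⟨by simp [h₁, h₂], s₁.add s₂, fun t ht v hv => ?_⟩
    simp only [Pi.add_apply, e₁ t ht v hv, e₂ t ht v hv]
    ring
  smul_mem' := by
    rintro c F ⟨h, s, e⟩
    refine ⟨by simp [h], s.const_smul c, fun t ht v hv => ?_⟩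
    simp only [Pi.smul_apply, smul_eq_mul, e t ht v hv]
    ring

/-- The Fréchet space `C^∞(G/P, L_λ)`. -/
def PrincipalSeries (lam : ℂ) : Type := ↥(sectionSpace lam)

instance (lam : ℂ) : AddCommGroup (PrincipalSeries lam) :=
  inferInstanceAs (AddCommGroup ↥(sectionSpace lam))

instance (lam : ℂ) : Module ℂ (PrincipalSeries lam) :=
  inferInstanceAs (Module ℂ ↥(sectionSpace lam))

/-- The underlying homogeneous function on `ℝ²`. -/
def PrincipalSeries.toFun {lam : ℂ} (h : PrincipalSeries lam) : Vec → ℂ := h.1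

instance (lam : ℂ) : TopologicalSpace (PrincipalSeries lam) :=
  smoothTopology ({0}ᶜ : Set Vec) PrincipalSeries.toFun

theorem mulVec_ne_zero (g : SL2) {v : Vec} (hv : v ≠ 0) : g.1 *ᵥ v ≠ 0 := by
  intro h
  apply hv
  have h2 : (g⁻¹).1 *ᵥ (g.1 *ᵥ v) = v := by
    rw [Matrix.mulVec_mulVec, ← Matrix.SpecialLinearGroup.coe_mul, inv_mul_cancel]
    simp
  rw [← h2, h, Matrix.mulVec_zero]

theorem contDiff_mulVec (g : SL2) : ContDiff ℝ ∞ (fun v : Vec => g.1 *ᵥ v) :=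
  (LinearMap.toContinuousLinearMap (Matrix.mulVecLin g.1)).contDiff

/-- The action `ϖ_λ(g)` of `G` on `C^∞(G/P, L_λ)`: `(ϖ_λ(g) F) v = F (g⁻¹ v)`, that is
`(ϖ_λ(g) f) ζ = |cζ+d|^{-λ} f ((aζ+b)/(cζ+d))` for `g⁻¹ = (a b; c d)`. -/
def rho (lam : ℂ) (g : SL2) (h : PrincipalSeries lam) : PrincipalSeries lam :=
  ⟨fun v => h.toFun ((g⁻¹).1 *ᵥ v), by
    obtain ⟨F, h0, hs, he⟩ := h
    refine ⟨by simpa [PrincipalSeries.toFun] using h0, ?_, fun t ht v hv => ?_⟩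
    · exact hs.comp (contDiff_mulVec g⁻¹).contDiffOn fun v hv => mulVec_ne_zero g⁻¹ hv
    · simp only [PrincipalSeries.toFun, Matrix.mulVec_smul]
      exact he t ht _ (mulVec_ne_zero g⁻¹ hv)⟩

theorem normSq_pos {v : Vec} (hv : v ≠ 0) : 0 < v 0 ^ 2 + v 1 ^ 2 := by
  by_contra hle
  have h0 : v 0 = 0 := by nlinarith [sq_nonneg (v 0), sq_nonneg (v 1)]
  have h1 : v 1 = 0 := by nlinarith [sq_nonneg (v 0), sq_nonneg (v 1)]
  exact hv (by ext i; fin_cases i <;> simp [h0, h1])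

/-- The identification `C^∞(G/P) = C^∞(G/P, L_0) ≃ C^∞(G/P, L_λ)`, `φ ↦ |v|^{-λ} φ`, which makes
the representation spaces independent of `λ` (the compact picture: it is the identity on
restrictions to the unit circle). -/
def compactPicture (lam : ℂ) (φ : PrincipalSeries 0) : PrincipalSeries lam :=
  ⟨fun v => ((v 0 ^ 2 + v 1 ^ 2 : ℝ) : ℂ) ^ (-lam / 2) * φ.toFun v, by
    obtain ⟨F, h0, hs, he⟩ := φ
    refine ⟨by simp [PrincipalSeries.toFun, h0], ?_, fun t ht v hv => ?_⟩
    · refine ContDiffOn.mul ?_ hs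
      have hexp : ContDiffOn ℝ ∞
          (fun v : Vec => Complex.exp ((Real.log (v 0 ^ 2 + v 1 ^ 2) : ℂ) * (-lam / 2)))
          {0}ᶜ := by
        refine ContDiffOn.cexp (ContDiffOn.mul ?_ contDiffOn_const)
        refine Complex.ofRealCLM.contDiff.comp_contDiffOn (ContDiffOn.log ?_ ?_)
        · exact ContDiff.contDiffOn (by fun_prop)
        · exact fun v hv => (normSq_pos hv).ne'
      refine hexp.congr fun v hv => ?_
      have hp := normSq_pos hv
      rw [Complex.cpow_def_of_ne_zero (by exact_mod_cast hp.ne'), Complex.ofReal_log hp.le]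
    · have hp := (normSq_pos hv).le
      have h1 : (((t • v) 0 ^ 2 + (t • v) 1 ^ 2 : ℝ) : ℂ) =
          ((|t| ^ 2 : ℝ) : ℂ) * ((v 0 ^ 2 + v 1 ^ 2 : ℝ) : ℂ) := by
        rw [← Complex.ofReal_mul, sq_abs]
        congr 1
        simp only [Pi.smul_apply, smul_eq_mul]
        ring
      have h2 : ((|t| ^ 2 : ℝ) : ℂ) ^ (-lam / 2) = ((|t| : ℝ) : ℂ) ^ (-lam) := by
        have ht' : 0 < |t| := abs_pos.mpr ht
        rw [Complex.cpow_def_of_ne_zero (by exact_mod_cast (pow_pos ht' 2).ne'),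
          Complex.cpow_def_of_ne_zero (by exact_mod_cast ht'.ne'),
          ← Complex.ofReal_log (by positivity), ← Complex.ofReal_log (by positivity),
          Real.log_pow]
        congr 1
        push_cast
        ring
      have h3 : F (t • v) = F v := by simpa using he t ht v hv
      simp only [PrincipalSeries.toFun]
      rw [h3, h1, Complex.mul_cpow_ofReal_nonneg (by positivity) hp, h2, mul_assoc]⟩

/-! ### The de Sitter space -/

/-- `dS² = {(x, y, z) : x² + y² - z² = 1}`. -/
def deSitter : Set (Fin 3 → ℝ) := {A | A 0 ^ 2 + A 1 ^ 2 - A 2 ^ 2 = 1}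

/-- The matrix form `(x, y+z; y-z, -x)` of a point `(x, y, z)`. -/
def toMat (A : Fin 3 → ℝ) : Matrix (Fin 2) (Fin 2) ℝ :=
  !![A 0, A 1 + A 2; A 1 - A 2, -A 0]

/-- The inverse of `toMat` on trace-free matrices. -/
def ofMat (M : Matrix (Fin 2) (Fin 2) ℝ) : Fin 3 → ℝ :=
  ![M 0 0, (M 0 1 + M 1 0) / 2, (M 0 1 - M 1 0) / 2]

/-- The adjoint action `A ↦ g A g⁻¹` of `G` on `dS²`. -/
def act (g : SL2) (A : deSitter) : deSitter :=
  ⟨ofMat (g.1 * toMat A.1 * (g⁻¹).1), by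
    obtain ⟨A, hA⟩ := A
    have hg : g.1 0 0 * g.1 1 1 - g.1 0 1 * g.1 1 0 = 1 := by
      rw [← Matrix.det_fin_two]
      exact g.2
    simp only [deSitter, mem_ofPred_eq] at hA ⊢
    simp only [ofMat, toMat, Matrix.SpecialLinearGroup.coe_inv, Matrix.adjugate_fin_two,
      Matrix.mul_apply, Fin.sum_univ_two, Matrix.of_apply, Matrix.cons_val', Matrix.cons_val_zero,
      Matrix.cons_val_one, Matrix.cons_val]
    generalize g.1 0 0 = a at *
    generalize g.1 0 1 = b at *
    generalize g.1 1 0 = c at *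
    generalize g.1 1 1 = d at *
    linear_combination (A 0 ^ 2 + A 1 ^ 2 - A 2 ^ 2) * (a * d - b * c + 1) * hg + hA⟩

/-- The base point `E_{1,1} = diag(1, -1)`, with stabilizer `H`, so that `dS² = G/H`. -/
def basePoint : deSitter := ⟨![1, 0, 0], by simp [deSitter]⟩

/-- The global parametrization `(t, θ) ↦ (cosh t cos θ, cosh t sin θ, sinh t)` of `dS²`,
which is a smooth covering map. -/
def chart (p : Fin 2 → ℝ) : Fin 3 → ℝ :=
  ![Real.cosh (p 0) * Real.cos (p 1), Real.cosh (p 0) * Real.sin (p 1), Real.sinh (p 0)]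

theorem chart_mem (p : Fin 2 → ℝ) : chart p ∈ deSitter := by
  simp only [deSitter, chart, mem_ofPred_eq, Matrix.cons_val_zero, Matrix.cons_val_one,
    Matrix.cons_val]
  linear_combination Real.cosh (p 0) ^ 2 * Real.sin_sq_add_cos_sq (p 1) + Real.cosh_sq (p 0)

/-- A function on `dS²` in the coordinates `(t, θ)`. -/
def inChart (f : deSitter → ℂ) (p : Fin 2 → ℝ) : ℂ := f ⟨chart p, chart_mem p⟩

/-- The smooth functions on `dS²`. -/
def smoothSpace : Submodule ℂ (deSitter → ℂ) where
  carrier := {f | ContDiff ℝ ∞ (inChart f)}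
  zero_mem' := by
    rw [mem_ofPred_eq]
    exact contDiff_const
  add_mem' := by
    intro f₁ f₂ h₁ h₂
    rw [mem_ofPred_eq] at h₁ h₂ ⊢
    exact h₁.add h₂
  smul_mem' := by
    intro c f h
    rw [mem_ofPred_eq] at h ⊢
    exact h.const_smul c

/-- The Fréchet space `C^∞(dS²) = C^∞(G/H)`. -/
def SmoothDeSitter : Type := ↥smoothSpace

instance : AddCommGroup SmoothDeSitter := inferInstanceAs (AddCommGroup ↥smoothSpace)

instance : Module ℂ SmoothDeSitter := inferInstanceAs (Module ℂ ↥smoothSpace)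

/-- The underlying function on `dS²`. -/
def SmoothDeSitter.toFun (f : SmoothDeSitter) : deSitter → ℂ := f.1

instance : TopologicalSpace SmoothDeSitter :=
  smoothTopology (univ : Set (Fin 2 → ℝ)) (fun f => inChart f.toFun)

/-- The form `dx² + dy² - dz²` of Minkowski space `ℝ^{2,1}`. -/
def minkowski (u v : Fin 3 → ℝ) : ℝ := u 0 * v 0 + u 1 * v 1 - u 2 * v 2

/-- The Gram matrix of the Lorentzian metric on `dS²` induced from `ℝ^{2,1}`, in the coordinates
`(t, θ)`. -/
def inducedMetric (p : Fin 2 → ℝ) : Matrix (Fin 2) (Fin 2) ℝ := fun i j =>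
  minkowski (fderiv ℝ chart p (Pi.single i 1)) (fderiv ℝ chart p (Pi.single j 1))

/-- The Laplacian `|det g|^{-1/2} ∑_{i,j} ∂_i (|det g|^{1/2} g^{ij} ∂_j u)` of a
pseudo-Riemannian metric `g` in coordinates. -/
def laplaceBeltrami (g : (Fin 2 → ℝ) → Matrix (Fin 2) (Fin 2) ℝ) (u : (Fin 2 → ℝ) → ℂ)
    (p : Fin 2 → ℝ) : ℂ :=
  ((√|(g p).det| : ℝ) : ℂ)⁻¹ * ∑ i, ∑ j, fderiv ℝ
    (fun q => ((√|(g q).det| * (g q)⁻¹ i j : ℝ) : ℂ) * fderiv ℝ u q (Pi.single j 1))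
    p (Pi.single i 1)

/-- The space `C^∞(G/H, M_λ)`: `Δ f = -(1/4) λ (λ - 2) f` on `dS²`. -/
def eigenspace (lam : ℂ) : Set SmoothDeSitter :=
  {f | ∀ p, laplaceBeltrami inducedMetric (inChart f.toFun) p =
    -(1 / 4) * lam * (lam - 2) * inChart f.toFun p}

/-! ### Kernels and integral operators -/

/-- `t_ε^μ` for a sign `ε`: `t_+^μ = t^μ` for `t > 0` and `0` for `t ≤ 0`, and
`t_-^μ = (-t)_+^μ`. -/
def signPow (ε : ℤˣ) (t : ℝ) (μ : ℂ) : ℂ :=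
  if 0 < ((ε : ℤ) : ℝ) * t then ((((ε : ℤ) : ℝ) * t : ℝ) : ℂ) ^ μ else 0

/-- The kernel `K_ε^μ(ζ₁, ζ₂; ζ) = ((ζ₁-ζ)(ζ₂-ζ)/(ζ₁-ζ₂))_ε^μ`, with the points `ζ₁`, `ζ₂`
of `G/P` represented by vectors (the value depends only on the lines through them, and for
`v_j = (ζ_j, 1)` it is the displayed expression). -/
def kernelK (ε : ℤˣ) (μ : ℂ) (v₁ v₂ : Vec) (ζ : ℝ) : ℂ :=
  signPow ε (det2 v₁ (bruhat ζ) * det2 v₂ (bruhat ζ) / det2 v₁ v₂) μ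

/-- The holographic operator
`(H_μ^± h)(ζ₁, ζ₂) = (ζ₁-ζ₂)⁻¹ ∫ h(ζ) K_∓^μ(ζ₁, ζ₂; ζ) dζ` off the diagonal, in its domain of
convergence `Re μ > -1`. In homogeneous coordinates it is homogeneous of degree `-1` in each
of `v₁`, `v₂`, that is, a section of `L_1^- ⊠ L_1^-`. -/
def holographic (ε : ℤˣ) (μ : ℂ) (h : Vec → ℂ) (v₁ v₂ : Vec) : ℂ :=
  ((det2 v₁ v₂ : ℝ) : ℂ)⁻¹ * ∫ ζ : ℝ, h (bruhat ζ) * kernelK (-ε) μ v₁ v₂ ζ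

/-- A representative of `w = (0 -1; 1 0)` in `G`. -/
def weyl : SL2 := ⟨!![0, -1; 1, 0], by simp [Matrix.det_fin_two]⟩

/-- The pull-back `ι_1^*` of sections of `L_1^- ⊠ L_1^-` along the open embedding
`G/H → G/P × G/P`, `g H ↦ (g P, g w P)`: `f ↦ (ζ₁-ζ₂) f(ζ₁, ζ₂)`, as a function of `g`. -/
def iota1 (f : Vec → Vec → ℂ) (g : SL2) : ℂ :=
  ((det2 (g.1 *ᵥ bruhat 0) ((g * weyl).1 *ᵥ bruhat 0) : ℝ) : ℂ) *
    f (g.1 *ᵥ bruhat 0) ((g * weyl).1 *ᵥ bruhat 0)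

/-- The real function on `dS² × ℝ` whose powers give the Poisson kernels. It is the polynomial
form of `((1+x)ζ+(y+z))((1+x)-(y-z)ζ) / (2(1+x))`, which makes sense also at `x = -1`. -/
def poissonBase (A : deSitter) (ζ : ℝ) : ℝ :=
  (2 * A.1 0 * ζ - (A.1 1 - A.1 2) * ζ ^ 2 + (A.1 1 + A.1 2)) / 2

/-! ### Meromorphic families -/

/-- `u : ℂ → E` is holomorphic at `s`, for families of vectors depending on a parameter `φ`:
complex differentiable on one neighbourhood of `s` for all `φ`. -/
def HolomorphicFamilyAt {X E : Type*} [AddCommGroup E] [Module ℂ E] [TopologicalSpace E]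
    (T : ℂ → X → E) (s₀ : ℂ) : Prop :=
  ∀ᶠ s in 𝓝 s₀, ∀ φ, ∃ d : E,
    Tendsto (fun r => (r - s)⁻¹ • (T r φ - T s φ)) (𝓝[≠] s) (𝓝 d)

/-- A family of operators `T s : X → E` is meromorphic at `s₀` if, for some `n`, the family
`(s - s₀)^n T s` extends to a holomorphic family of continuous linear operators near `s₀`. -/
def MeromorphicFamilyAt {X E : Type*} [AddCommGroup X] [Module ℂ X] [TopologicalSpace X]
    [AddCommGroup E] [Module ℂ E] [TopologicalSpace E] (T : ℂ → X → E) (s₀ : ℂ) : Prop :=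
  ∃ (n : ℕ) (S : ℂ → X →L[ℂ] E), HolomorphicFamilyAt (fun s φ => S s φ) s₀ ∧
    ∀ᶠ s in 𝓝[≠] s₀, ∀ φ, (s - s₀) ^ n • T s φ = S s φ

/-- The set `{0, -2, -4, …}`, where `μ = λ/2 - 1` is a pole of `t_±^μ`. -/
def poles : Set ℂ := {lam | ∃ k : ℕ, lam = -2 * (k : ℂ)}

end DeSitterPoisson

end

open DeSitterPoisson

/-! The kernel base is the quadratic form `v ↦ det (A v, v) / 2` evaluated at `(ζ, 1)`. For `A = g
E₁₁ g⁻¹` this form, pulled back by `g`, is `v 0 * v 1` (`quadForm_act_basePoint`). With `μ = λ/2 -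
1`, the power of the form times a section of `L_λ` is homogeneous of degree `-2`, the degree for
which `∫ f (ζ, 1) dζ` is `SL(2, ℝ)`-invariant (`integral_homogeneous_comp`). For `Re λ > 0` the
Poisson integral at `g E₁₁` therefore equals the integral over a half line of `s ^ μ` against `h (g
(σ s, 1))`. Splitting at `s = 1` and inverting the outer part gives `∫₀¹ s ^ μ (slice σ g h) s ds`
(`integral_poisson`).

The slice is smooth up to and across `s = 0`, so repeated integration by parts continues this Mellin
transform to all `μ`, with denominators `(μ + 1) ⋯ (μ + k)`, that is, with at most simple poles at
`λ = 0, -2, -4, …`. The regularized transform is jointly smooth in `λ` and `g`, satisfies the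
Cauchy-Riemann equations in `λ`, and has each derivative bounded by finitely many derivatives of
`h`. This yields continuity of the operators and holomorphy in the `C^∞` topology. A smooth lift of
the coordinates `(t, θ)` to `SL(2, ℝ)`, unique up to sign over each point of `dS²`, turns functions
of `g` into functions on `dS²`.

Statements about the continuation that are hard to see directly are proved for large `Re λ` and
extended by the identity theorem on the connected complement of the poles (`eq_of_eq_of_lt_re`). One
is that the value depends only on `g E₁₁`; with this, equivariance is a formal identity of slices.
The other is the Laplace equation: on the circle model `q` satisfies `|∇q|² = -q²` and `Δq = -2q`,
whence `Δ q^μ = -μ (μ + 1) q^μ` (`laplaceBeltrami_powIntegral`), and `μ (μ + 1) = λ (λ - 2) / 4`. -/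

noncomputable section

namespace DeSitterPoisson

/-! ### Smooth dependence of truncated Mellin transforms on parameters -/

section ParametricIntegral

variable {V F : Type} [NormedAddCommGroup V] [NormedSpace ℝ V] [NormedAddCommGroup F]
  [NormedSpace ℂ F]

/-- `s ^ ν (log s) ^ j`, the `j`-th derivative in `ν` of the power `s ^ ν`. -/
def logPow (j : ℕ) (ν : ℂ) (s : ℝ) : ℂ := (s : ℂ) ^ ν * ((Real.log s : ℝ) : ℂ) ^ j

/-- The truncated Mellin transform `∫₀¹ s ^ ν (log s) ^ j H s ds`. -/
def mellinLog (j : ℕ) (ν : ℂ) (H : ℝ → F) : F := ∫ s in (0 : ℝ)..1, logPow j ν s • H s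

/-- Half of the margin `δ` pays for the logarithms, since `|log s| ^ j` is bounded by a multiple of
`s ^ (-δ/2)`. The constant is uniform over a half plane in `ν`, as domination in a varying exponent
requires. -/
theorem norm_logPow_le (j : ℕ) {δ : ℝ} (hδ : 0 < δ) :
    ∃ C : ℝ, 0 ≤ C ∧ ∀ ν : ℂ, δ - 1 ≤ ν.re → ∀ s ∈ Ioc (0 : ℝ) 1,
      ‖logPow j ν s‖ ≤ C * s ^ (δ / 2 - 1) := by
  -- This choice gives `t * j ≤ δ / 2`; the denominator `j + 1` keeps `t` positive and finite also
  -- for `j = 0`.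
  set t : ℝ := δ / (2 * (j + 1)) with ht
  have ht0 : 0 < t := by positivity
  refine ⟨(1 / t) ^ j, by positivity, fun ν hν s hs => ?_⟩
  have hs0 := hs.1
  have h1 : ‖logPow j ν s‖ = s ^ ν.re * |Real.log s| ^ j := by
    rw [logPow, norm_mul, norm_pow, Complex.norm_cpow_eq_rpow_re_of_pos hs0, Complex.norm_real,
      Real.norm_eq_abs]
  have h2 : |Real.log s| ^ j ≤ (1 / t) ^ j * s ^ (-(t * j)) := by
    have h3 := (Real.abs_log_mul_self_rpow_lt s t hs0 hs.2 ht0).le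
    rw [abs_mul, abs_of_pos (Real.rpow_pos_of_pos hs0 t)] at h3
    have h4 : |Real.log s| ≤ (1 / t) * s ^ (-t) := by
      rw [Real.rpow_neg hs0.le, ← div_eq_mul_inv, le_div_iff₀ (Real.rpow_pos_of_pos hs0 t)]
      exact h3
    calc |Real.log s| ^ j ≤ ((1 / t) * s ^ (-t)) ^ j := by gcongr
      _ = _ := by rw [mul_pow, ← Real.rpow_natCast (s ^ (-t)) j, ← Real.rpow_mul hs0.le, neg_mul]
  have h5 : t * j ≤ δ / 2 := by
    rw [ht, div_mul_eq_mul_div, div_le_div_iff₀ (by positivity) (by positivity)]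
    nlinarith
  rw [h1]
  calc s ^ ν.re * |Real.log s| ^ j
      ≤ s ^ (δ - 1) * ((1 / t) ^ j * s ^ (-(t * j))) := by
        refine mul_le_mul (Real.rpow_le_rpow_of_exponent_ge hs0 hs.2 hν) h2 (by positivity)
          (Real.rpow_nonneg hs0.le _)
    _ = (1 / t) ^ j * s ^ (δ - 1 + -(t * j)) := by rw [Real.rpow_add hs0]; ring
    _ ≤ _ := by
        gcongr ?_ * ?_
        exact Real.rpow_le_rpow_of_exponent_ge hs0 hs.2 (by linarith)

theorem continuousOn_logPow (j : ℕ) (ν : ℂ) : ContinuousOn (logPow j ν) (Ioc 0 1) := by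
  refine ContinuousOn.mul (fun s hs => ?_) (ContinuousOn.pow ?_ j)
  · exact (Complex.continuousAt_ofReal_cpow_const s ν (Or.inr hs.1.ne')).continuousWithinAt
  · exact Complex.continuous_ofReal.comp_continuousOn
      (Real.continuousOn_log.mono fun s hs => hs.1.ne')

theorem aestronglyMeasurable_logPow_smul (j : ℕ) (ν : ℂ) {H : ℝ → F} (hH : Continuous H) :
    AEStronglyMeasurable (fun s => logPow j ν s • H s) (volume.restrict (uIoc (0 : ℝ) 1)) := by
  rw [uIoc_of_le zero_le_one]
  exact ((continuousOn_logPow j ν).smul hH.continuousOn).aestronglyMeasurable measurableSet_Ioc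

theorem intervalIntegrable_logPow_smul (j : ℕ) {ν : ℂ} (hν : -1 < ν.re) {H : ℝ → F}
    (hH : Continuous H) :
    IntervalIntegrable (fun s => logPow j ν s • H s) volume 0 1 := by
  obtain ⟨C, hC0, hC⟩ := norm_logPow_le j (δ := ν.re + 1) (by linarith)
  obtain ⟨B, hB⟩ := (isCompact_Icc (a := (0 : ℝ)) (b := 1)).exists_bound_of_continuousOn
    hH.continuousOn
  have hint : IntervalIntegrable (fun s : ℝ => C * s ^ ((ν.re + 1) / 2 - 1) * B) volume 0 1 :=
    ((intervalIntegral.intervalIntegrable_rpow' (by linarith)).const_mul C).mul_const B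
  refine hint.mono_fun' (aestronglyMeasurable_logPow_smul j ν hH) ?_
  refine (ae_restrict_mem measurableSet_uIoc).mono fun s hs => ?_
  rw [uIoc_of_le zero_le_one] at hs
  refine (norm_smul_le _ _).trans ?_
  have h1 := hC ν (by linarith) s hs
  have h2 := hB s ⟨hs.1.le, hs.2⟩
  exact mul_le_mul h1 h2 (norm_nonneg _)
    (mul_nonneg hC0 (Real.rpow_nonneg hs.1.le _))

/-- Each derivative in the exponent brings down one logarithm; this is the reason for carrying the
index `j`. -/
theorem hasFDerivAt_logPow (j : ℕ) {s : ℝ} (hs : 0 < s) {ν : V → ℂ} {ν' : V →L[ℝ] ℂ} {x : V}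
    (hν : HasFDerivAt ν ν' x) :
    HasFDerivAt (fun y => logPow j (ν y) s) (logPow (j + 1) (ν x) s • ν') x := by
  have h1 : HasDerivAt (fun z : ℂ => logPow j z s) (logPow (j + 1) (ν x) s) (ν x) := by
    have h2 := ((hasDerivAt_id (ν x)).const_cpow (c := (s : ℂ))
      (Or.inl (by exact_mod_cast hs.ne'))).mul_const (((Real.log s : ℝ) : ℂ) ^ j)
    refine h2.congr_deriv ?_
    simp only [logPow, id, mul_one, ← Complex.ofReal_log hs.le]
    ring
  exact (h1.comp_hasFDerivAt_of_eq x hν rfl)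

omit [NormedSpace ℝ V] [NormedSpace ℂ F] in
theorem exists_bound_near [ProperSpace V] {G : V × ℝ → F} (hG : Continuous G) (x₀ : V) :
    ∃ B : ℝ, 0 ≤ B ∧ ∀ x ∈ Metric.ball x₀ 1, ∀ s ∈ Icc (0 : ℝ) 1, ‖G (x, s)‖ ≤ B := by
  obtain ⟨B, hB⟩ := ((isCompact_closedBall x₀ 1).prod
    (isCompact_Icc (a := (0 : ℝ)) (b := 1))).exists_bound_of_continuousOn hG.continuousOn
  refine ⟨max B 0, le_max_right _ _, fun x hx s hs => (hB (x, s) ⟨?_, hs⟩).trans (le_max_left _ _)⟩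
  exact Metric.ball_subset_closedBall hx

/-- The derivative of `H` in the parameter. -/
def paramDeriv (H : V × ℝ → F) (y : V × ℝ) : V →L[ℝ] F :=
  (fderiv ℝ H y).comp (ContinuousLinearMap.inl ℝ V ℝ)

theorem contDiff_paramDeriv {H : V × ℝ → F} {n : WithTop ℕ∞} {m : WithTop ℕ∞} (hH : ContDiff ℝ n H)
    (hm : m + 1 ≤ n) : ContDiff ℝ m (paramDeriv H) :=
  (hH.fderiv_right hm).clm_comp contDiff_const

theorem hasFDerivAt_paramDeriv {H : V × ℝ → F} {y : V × ℝ} (hH : DifferentiableAt ℝ H y) :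
    HasFDerivAt (fun x => H (x, y.2)) (paramDeriv H y) y.1 := by
  have h1 : HasFDerivAt (fun x : V => (x, y.2)) (ContinuousLinearMap.inl ℝ V ℝ) y.1 :=
    hasFDerivAt_prodMk_left y.1 y.2
  exact HasFDerivAt.comp (g := H) y.1 hH.hasFDerivAt h1

/-- The map `v ↦ (ν' v) H` into which the derivative of `s ^ ν` enters. -/
def smulDeriv (ν : V → ℂ) (H : V × ℝ → F) (y : V × ℝ) : V →L[ℝ] F :=
  ((ContinuousLinearMap.lsmul ℝ ℂ (E := F)).flip (H y)).comp (fderiv ℝ ν y.1)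

theorem smulDeriv_apply (ν : V → ℂ) (H : V × ℝ → F) (y : V × ℝ) (v : V) :
    smulDeriv ν H y v = fderiv ℝ ν y.1 v • H y := rfl

theorem contDiff_smulDeriv {ν : V → ℂ} {H : V × ℝ → F} {n m : WithTop ℕ∞} (hH : ContDiff ℝ n H)
    (hν : ContDiff ℝ n ν) (hm : m + 1 ≤ n) : ContDiff ℝ m (smulDeriv ν H) := by
  have h1 : ContDiff ℝ m H := hH.of_le (le_self_add.trans hm)
  exact (((ContinuousLinearMap.lsmul ℝ ℂ (E := F)).flip.contDiff).comp h1).clm_comp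
    ((hν.fderiv_right hm).comp contDiff_fst)

/-- Both terms of the derivative are again truncated Mellin transforms of smooth integrands, with
values in `V →L[ℝ] F`, so the formula can be iterated. -/
theorem hasFDerivAt_mellinLog [ProperSpace V] (j : ℕ) {H : V × ℝ → F} (hH : ContDiff ℝ 1 H)
    {ν : V → ℂ} (hν : ContDiff ℝ 1 ν) {x₀ : V} (hx : -1 < (ν x₀).re) :
    HasFDerivAt (fun x => mellinLog j (ν x) fun s => H (x, s))
      (mellinLog (j + 1) (ν x₀) (fun s => smulDeriv ν H (x₀, s)) +
        mellinLog j (ν x₀) fun s => paramDeriv H (x₀, s)) x₀ := by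
  -- Half the distance of `ν x₀` from the line `Re = -1`: the exponents at all nearby parameters
  -- stay in `Re > δ - 1`, where one dominating function serves.
  set δ : ℝ := ((ν x₀).re + 1) / 2 with hδ
  have hδ0 : 0 < δ := by rw [hδ]; linarith
  have hDH : Continuous (paramDeriv H) := (contDiff_paramDeriv (m := 0) hH (by simp)).continuous
  have hN : Continuous (smulDeriv ν H) :=
    (contDiff_smulDeriv (m := 0) hH hν (by simp)).continuous
  obtain ⟨C₁, hC₁0, hC₁⟩ := norm_logPow_le (j + 1) hδ0
  obtain ⟨C₂, hC₂0, hC₂⟩ := norm_logPow_le j hδ0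
  obtain ⟨B₁, hB₁0, hB₁⟩ := exists_bound_near hN x₀
  obtain ⟨B₂, hB₂0, hB₂⟩ := exists_bound_near hDH x₀
  have hnear : ∀ᶠ x in 𝓝 x₀, δ - 1 < (ν x).re := by
    have h1 : Continuous fun x => (ν x).re := Complex.continuous_re.comp hν.continuous
    exact h1.continuousAt.eventually (lt_mem_nhds (by rw [hδ]; linarith))
  have hnb : {x | δ - 1 < (ν x).re} ∩ Metric.ball x₀ 1 ∈ 𝓝 x₀ :=
    inter_mem hnear (Metric.ball_mem_nhds x₀ one_pos)
  have hslice : ∀ x : V, Continuous fun s : ℝ => (x, s) := fun x => by fun_prop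
  have hkey := intervalIntegral.hasFDerivAt_integral_of_dominated_of_fderiv_le (𝕜 := ℝ)
    (μ := volume) (a := 0) (b := 1)
    (F := fun x s => logPow j (ν x) s • H (x, s))
    (F' := fun x s => logPow (j + 1) (ν x) s • smulDeriv ν H (x, s) +
      logPow j (ν x) s • paramDeriv H (x, s))
    (bound := fun s => C₁ * s ^ (δ / 2 - 1) * B₁ + C₂ * s ^ (δ / 2 - 1) * B₂)
    (x₀ := x₀) hnb ?_ ?_ ?_ ?_ ?_ ?_
  · refine hkey.congr_fderiv ?_
    rw [mellinLog, mellinLog, ← intervalIntegral.integral_add]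
    · exact intervalIntegrable_logPow_smul _ hx (hN.comp (hslice x₀))
    · exact intervalIntegrable_logPow_smul _ hx (hDH.comp (hslice x₀))
  · exact Eventually.of_forall fun x =>
      aestronglyMeasurable_logPow_smul j (ν x) (hH.continuous.comp (hslice x))
  · exact intervalIntegrable_logPow_smul j hx (hH.continuous.comp (hslice x₀))
  · exact (aestronglyMeasurable_logPow_smul (j + 1) (ν x₀) (hN.comp (hslice x₀))).add
      (aestronglyMeasurable_logPow_smul j (ν x₀) (hDH.comp (hslice x₀)))
  · refine Eventually.of_forall fun s hs x hx' => ?_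
    rw [uIoc_of_le zero_le_one] at hs
    have hs' : s ∈ Icc (0 : ℝ) 1 := ⟨hs.1.le, hs.2⟩
    have hp : 0 ≤ s ^ (δ / 2 - 1) := Real.rpow_nonneg hs.1.le _
    refine (norm_add_le _ _).trans ?_
    rw [norm_smul, norm_smul]
    exact add_le_add
      (mul_le_mul (hC₁ _ hx'.1.le s hs) (hB₁ x hx'.2 s hs') (norm_nonneg _) (mul_nonneg hC₁0 hp))
      (mul_le_mul (hC₂ _ hx'.1.le s hs) (hB₂ x hx'.2 s hs') (norm_nonneg _) (mul_nonneg hC₂0 hp))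
  · have h1 : IntervalIntegrable (fun s : ℝ => s ^ (δ / 2 - 1)) volume 0 1 :=
      intervalIntegral.intervalIntegrable_rpow' (by linarith)
    exact ((h1.const_mul C₁).mul_const B₁).add ((h1.const_mul C₂).mul_const B₂)
  · refine Eventually.of_forall fun s hs x _ => ?_
    rw [uIoc_of_le zero_le_one] at hs
    have h1 := hasFDerivAt_logPow j hs.1 (hν.differentiable one_ne_zero x).hasFDerivAt
    have h2 := hasFDerivAt_paramDeriv (y := (x, s)) (hH.differentiable one_ne_zero (x, s))
    refine (h1.smul h2).congr_fderiv ?_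
    ext v
    simp [mul_smul, add_comm, smulDeriv_apply]

/-- The target space and the number of logarithms are quantified inside the induction, because
differentiation changes both. -/
theorem contDiffAt_mellinLog [ProperSpace V] (n : ℕ) : ∀ {F : Type} [NormedAddCommGroup F]
    [NormedSpace ℂ F] (j : ℕ) {H : V × ℝ → F} (_ : ContDiff ℝ ∞ H)
    {ν : V → ℂ} (_ : ContDiff ℝ ∞ ν) {x₀ : V} (_ : -1 < (ν x₀).re),
    ContDiffAt ℝ n (fun x => mellinLog j (ν x) fun s => H (x, s)) x₀ := by
  induction n with
  | zero =>
    intro F _ _ j H hH ν hν x₀ hx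
    have hev : ∀ᶠ x in 𝓝 x₀, -1 < (ν x).re :=
      (Complex.continuous_re.comp hν.continuous).continuousAt.eventually (lt_mem_nhds hx)
    refine contDiffAt_zero.2 ⟨_, hev, fun x hx => ?_⟩
    exact (hasFDerivAt_mellinLog j (hH.of_le (by simp)) (hν.of_le (by simp))
      hx).continuousAt.continuousWithinAt
  | succ n ih =>
    intro F _ _ j H hH ν hν x₀ hx
    have hev : ∀ᶠ x in 𝓝 x₀, -1 < (ν x).re :=
      (Complex.continuous_re.comp hν.continuous).continuousAt.eventually (lt_mem_nhds hx)
    push_cast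
    refine contDiffAt_succ_iff_hasFDerivAt.2 ⟨_, ⟨_, hev, fun x hx =>
      hasFDerivAt_mellinLog j (hH.of_le (by simp)) (hν.of_le (by simp)) hx⟩, ?_⟩
    refine ContDiffAt.add ?_ ?_
    · refine ih (j + 1) (H := smulDeriv ν H) ?_ hν hx
      exact contDiff_smulDeriv hH hν (by simp)
    · exact ih j (contDiff_paramDeriv hH (by simp)) hν hx

end ParametricIntegral

theorem two_le_infty : (2 : WithTop ℕ∞) ≤ ∞ := WithTop.coe_le_coe.2 le_top

/-! ### Meromorphic continuation of the Mellin transform by integration by parts -/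

section MellinContinuation

/-- `(ν + 1) (ν + 2) ⋯ (ν + k)`. -/
def shiftedFactorial (k : ℕ) (ν : ℂ) : ℂ := ∏ j ∈ Finset.range k, (ν + 1 + j)

theorem shiftedFactorial_succ (k : ℕ) (ν : ℂ) :
    shiftedFactorial (k + 1) ν = shiftedFactorial k ν * (ν + 1 + k) :=
  Finset.prod_range_succ _ _

theorem differentiable_shiftedFactorial (k : ℕ) : Differentiable ℂ (shiftedFactorial k) := by
  unfold shiftedFactorial
  fun_prop

theorem shiftedFactorial_ne_zero {ν : ℂ} (hν : ∀ j : ℕ, ν ≠ -1 - j) (k : ℕ) :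
    shiftedFactorial k ν ≠ 0 := by
  refine Finset.prod_ne_zero_iff.2 fun j _ h => hν j ?_
  linear_combination h

/-- The Mellin transform `∫₀¹ s ^ ν K s ds`, multiplied by `(ν + 1) ⋯ (ν + k)` and continued by
integration by parts to the half plane `Re ν > -1 - k`. -/
def mellinReg : ℕ → ℂ → (ℝ → ℂ) → ℂ
  | 0, ν, K => mellinLog 0 ν K
  | k + 1, ν, K => shiftedFactorial k (ν + 1) * K 1 - mellinReg k (ν + 1) (deriv K)

/-- The boundary term at `0` vanishes because `Re (ν + 1) > 0`. The primitive `s ^ (ν + 1) * K s`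
need only be continuous at `0`, so the fundamental theorem is used with derivatives in the open
interval. -/
theorem mellinLog_zero_by_parts {ν : ℂ} (hν : -1 < ν.re) {K : ℝ → ℂ} (hK : ContDiff ℝ 1 K) :
    K 1 - mellinLog 0 (ν + 1) (deriv K) = (ν + 1) * mellinLog 0 ν K := by
  have hre : 0 < (ν + 1).re := by simp; linarith
  have hν1 : ν + 1 ≠ 0 := fun h => by simp [h] at hre
  have hdK : Continuous (deriv K) := hK.continuous_deriv le_rfl
  have i1 : IntervalIntegrable (fun s => logPow 0 (ν + 1) s • deriv K s) volume 0 1 :=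
    intervalIntegrable_logPow_smul 0 (by linarith) hdK
  have i2 : IntervalIntegrable (fun s => logPow 0 ν s • K s) volume 0 1 :=
    intervalIntegrable_logPow_smul 0 hν hK.continuous
  have hftc := intervalIntegral.integral_eq_sub_of_hasDeriv_right_of_le (a := 0) (b := 1)
    zero_le_one (f := fun s : ℝ => (s : ℂ) ^ (ν + 1) * K s)
    (f' := fun s => (ν + 1) * (logPow 0 ν s • K s) + logPow 0 (ν + 1) s • deriv K s) ?_ ?_
    ((i2.const_mul _).add i1)
  · rw [intervalIntegral.integral_add (i2.const_mul _) i1,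
      intervalIntegral.integral_const_mul] at hftc
    rw [mellinLog, mellinLog]
    simp only [Complex.ofReal_one, Complex.one_cpow, one_mul, Complex.ofReal_zero,
      Complex.zero_cpow hν1, zero_mul, sub_zero] at hftc
    rw [← hftc]
    ring
  · refine ContinuousOn.mul (fun s hs => ?_) hK.continuous.continuousOn
    exact (Complex.continuousAt_ofReal_cpow_const s (ν + 1) (Or.inl hre)).continuousWithinAt
  · intro s hs
    have h1 : HasDerivAt (fun s : ℝ => (s : ℂ) ^ (ν + 1)) ((ν + 1) * (s : ℂ) ^ ν) s := by
      have h2 := hasDerivAt_ofReal_cpow_const' (x := s) hs.1.ne' (r := ν)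
        (fun h => hν1 (by rw [h]; ring))
      refine ((h2.const_mul (ν + 1)).congr_of_eventuallyEq
        (Eventually.of_forall fun y => ?_)).congr_deriv rfl
      simp only
      field_simp
    have h3 := (hK.differentiable one_ne_zero s).hasDerivAt
    refine ((h1.mul h3).congr_deriv ?_).hasDerivWithinAt
    simp [logPow]
    ring

/-- Where `k` steps already converge, one more integration by parts only multiplies by the next
linear factor. Hence the quotient by `shiftedFactorial` will not depend on the number of steps. -/
theorem mellinReg_succ (k : ℕ) : ∀ {ν : ℂ} (_ : -1 - k < ν.re) {K : ℝ → ℂ} (_ : ContDiff ℝ ∞ K),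
    mellinReg (k + 1) ν K = (ν + 1 + k) * mellinReg k ν K := by
  induction k with
  | zero =>
    intro ν hν K hK
    simpa [mellinReg, shiftedFactorial] using
      mellinLog_zero_by_parts (by simpa using hν) (hK.of_le (by simp))
  | succ k ih =>
    intro ν hν K hK
    have hK' : ContDiff ℝ ∞ (deriv K) := (contDiff_infty_iff_deriv.1 hK).2
    rw [mellinReg, ih (by push_cast at hν; simp; linarith) hK', shiftedFactorial_succ, mellinReg]
    push_cast
    ring

/-- The cross-multiplied form holds also at zeros of `shiftedFactorial`; division is postponed until
the poles are excluded. -/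
theorem mellinReg_add (k m : ℕ) {ν : ℂ} (hν : -1 - k < ν.re) {K : ℝ → ℂ} (hK : ContDiff ℝ ∞ K) :
    mellinReg (k + m) ν K * shiftedFactorial k ν =
      mellinReg k ν K * shiftedFactorial (k + m) ν := by
  induction m with
  | zero => rfl
  | succ m ih =>
    rw [← add_assoc, mellinReg_succ (k + m) (by push_cast; linarith [Nat.cast_nonneg (α := ℝ) m])
      hK, shiftedFactorial_succ]
    push_cast at ih ⊢
    linear_combination (ν + 1 + (k + m)) * ih

/-- The meromorphic continuation in `ν` of the Mellin transform `∫₀¹ s ^ ν K s ds`. -/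
def mellinCont (ν : ℂ) (K : ℝ → ℂ) : ℂ :=
  (shiftedFactorial ⌈-ν.re⌉₊ ν)⁻¹ * mellinReg ⌈-ν.re⌉₊ ν K

theorem neg_one_sub_ceil_lt (ν : ℂ) : -1 - (⌈-ν.re⌉₊ : ℝ) < ν.re := by
  linarith [Nat.le_ceil (-ν.re)]

/-- The number of steps in `mellinCont` jumps with `Re ν`. Locally it can be replaced by any fixed
sufficient `k`, for which regularity in `ν` is visible. -/
theorem mellinCont_eq {ν : ℂ} (hν : ∀ j : ℕ, ν ≠ -1 - j) {k : ℕ} (hk : -1 - k < ν.re)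
    {K : ℝ → ℂ} (hK : ContDiff ℝ ∞ K) :
    mellinCont ν K = (shiftedFactorial k ν)⁻¹ * mellinReg k ν K := by
  have hne := shiftedFactorial_ne_zero hν
  have key : ∀ {a b : ℕ}, a ≤ b → -1 - (a : ℝ) < ν.re →
      (shiftedFactorial a ν)⁻¹ * mellinReg a ν K = (shiftedFactorial b ν)⁻¹ * mellinReg b ν K := by
    intro a b hab ha
    obtain ⟨m, rfl⟩ := Nat.exists_eq_add_of_le hab
    have h := mellinReg_add a m ha hK
    have h1 := hne a
    have h2 := hne (a + m)
    field_simp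
    linear_combination -h
  rcases le_total ⌈-ν.re⌉₊ k with h | h
  · exact key h (neg_one_sub_ceil_lt ν)
  · exact (key h hk).symm

theorem mellinCont_of_neg_one_lt_re {ν : ℂ} (hν : -1 < ν.re) {K : ℝ → ℂ} (hK : ContDiff ℝ ∞ K) :
    mellinCont ν K = ∫ s in (0 : ℝ)..1, (s : ℂ) ^ ν * K s := by
  rw [mellinCont_eq (k := 0) (fun j h => ?_) (by simpa using hν) hK]
  · simp [shiftedFactorial, mellinReg, mellinLog, logPow]
  · rw [h] at hν
    simp at hν
    linarith [Nat.cast_nonneg (α := ℝ) j]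

variable {V : Type} [NormedAddCommGroup V] [NormedSpace ℝ V]

theorem deriv_slice {F : Type} [NormedAddCommGroup F] [NormedSpace ℝ F] {H : V × ℝ → F}
    (hH : Differentiable ℝ H) (x : V) :
    deriv (fun s => H (x, s)) = fun s => fderiv ℝ H (x, s) (0, 1) := by
  ext s
  have h1 : HasDerivAt (fun s : ℝ => (x, s)) ((0, 1) : V × ℝ) s :=
    (hasDerivAt_const s x).prodMk (hasDerivAt_id s)
  exact ((hH (x, s)).hasFDerivAt.comp_hasDerivAt s h1).deriv

theorem contDiff_fderiv_apply_const {W F : Type} [NormedAddCommGroup W] [NormedSpace ℝ W]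
    [NormedAddCommGroup F] [NormedSpace ℝ F] {H : W → F}
    (hH : ContDiff ℝ ∞ H) (v : W) : ContDiff ℝ ∞ fun y => fderiv ℝ H y v :=
  (hH.fderiv_right (by simp)).clm_apply contDiff_const

theorem contDiffAt_mellinReg [ProperSpace V] (k : ℕ) : ∀ {H : V × ℝ → ℂ} (_ : ContDiff ℝ ∞ H)
    {ν : V → ℂ} (_ : ContDiff ℝ ∞ ν) {x₀ : V} (_ : -1 - k < (ν x₀).re),
    ContDiffAt ℝ ∞ (fun x => mellinReg k (ν x) fun s => H (x, s)) x₀ := by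
  induction k with
  | zero =>
    intro H hH ν hν x₀ hx
    exact contDiffAt_infty.2 fun n => contDiffAt_mellinLog n 0 hH hν (by simpa using hx)
  | succ k ih =>
    intro H hH ν hν x₀ hx
    simp only [mellinReg, deriv_slice (hH.differentiable (by simp))]
    have hν1 : ContDiff ℝ ∞ fun x => ν x + 1 := hν.add contDiff_const
    refine ContDiffAt.sub (ContDiffAt.mul ?_ ?_) (ih (H := fun y => fderiv ℝ H y (0, 1)) ?_ hν1 ?_)
    · exact (((differentiable_shiftedFactorial k).contDiff (n := ∞)).restrict_scalars ℝ
        |>.comp hν1).contDiffAt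
    · exact (hH.comp (contDiff_id.prodMk contDiff_const)).contDiffAt
    · exact contDiff_fderiv_apply_const hH _
    · push_cast at hx
      simp
      linarith

end MellinContinuation

/-! ### Cauchy-Riemann equations and holomorphy in the `C^∞` topology -/

section HolomorphicFamilies

variable {W F : Type} [NormedAddCommGroup W] [NormedSpace ℝ W] [NormedAddCommGroup F]
  [NormedSpace ℂ F]

/-- The Cauchy-Riemann equations for `f` at `x` in the complex direction `L`. -/
def IsCR (L : ℂ →L[ℝ] W) (f : W → F) (x : W) : Prop :=
  ∀ c : ℂ, fderiv ℝ f x (L c) = c • fderiv ℝ f x (L 1)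

variable {L : ℂ →L[ℝ] W} {f g : W → F} {x : W}

theorem IsCR.congr (hf : IsCR L f x) (h : g =ᶠ[𝓝 x] f) : IsCR L g x := by
  intro c
  rw [h.fderiv_eq]
  exact hf c

theorem IsCR.add (hf : IsCR L f x) (hg : IsCR L g x) (df : DifferentiableAt ℝ f x)
    (dg : DifferentiableAt ℝ g x) : IsCR L (fun y => f y + g y) x := by
  intro c
  rw [fderiv_fun_add df dg]
  simp [hf c, hg c]

theorem IsCR.sub (hf : IsCR L f x) (hg : IsCR L g x) (df : DifferentiableAt ℝ f x)
    (dg : DifferentiableAt ℝ g x) : IsCR L (fun y => f y - g y) x := by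
  intro c
  rw [fderiv_fun_sub df dg]
  simp [hf c, hg c, smul_sub]

theorem IsCR.mul {f g : W → ℂ} (hf : IsCR L f x) (hg : IsCR L g x) (df : DifferentiableAt ℝ f x)
    (dg : DifferentiableAt ℝ g x) : IsCR L (fun y => f y * g y) x := by
  intro c
  rw [fderiv_fun_mul df dg]
  have h1 := hf c
  have h2 := hg c
  simp only [smul_eq_mul] at h1 h2
  simp only [_root_.add_apply, _root_.smul_apply, smul_eq_mul, h1, h2]
  ring

theorem IsCR.comp_holomorphic {f : W → ℂ} {u : ℂ → ℂ} (hu : DifferentiableAt ℂ u (f x))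
    (hf : IsCR L f x) (df : DifferentiableAt ℝ f x) : IsCR L (fun y => u (f y)) x := by
  intro c
  have h1 : fderiv ℝ (fun y => u (f y)) x =
      ((fderiv ℂ u (f x)).restrictScalars ℝ).comp (fderiv ℝ f x) :=
    ((hu.hasFDerivAt.restrictScalars ℝ).comp x df.hasFDerivAt).fderiv
  rw [h1]
  have h2 := hf c
  simp only [smul_eq_mul] at h2
  simp [h2, mul_assoc]

theorem isCR_const (a : F) : IsCR L (fun _ : W => a) x := by
  intro c
  simp

/-- By symmetry of the second derivative, `D²f (L c, v) = D²f (v, L c)`, which is the derivative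
along `v` of the Cauchy-Riemann identity near `x`. -/
theorem IsCR.fderiv (hf : ContDiffAt ℝ 2 f x) (h : ∀ᶠ y in 𝓝 x, IsCR L f y) :
    IsCR L (fderiv ℝ f) x := by
  intro c
  have hd : DifferentiableAt ℝ (_root_.fderiv ℝ f) x :=
    (hf.fderiv_right (m := 1) (by norm_num)).differentiableAt one_ne_zero
  have hsymm : IsSymmSndFDerivAt ℝ f x := hf.isSymmSndFDerivAt (by simp)
  have happ : ∀ w : W, HasFDerivAt (fun y => _root_.fderiv ℝ f y w)
      ((ContinuousLinearMap.apply ℝ F w).comp (_root_.fderiv ℝ (_root_.fderiv ℝ f) x)) x :=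
    fun w => (ContinuousLinearMap.apply ℝ F w).hasFDerivAt.comp x hd.hasFDerivAt
  ext v
  rw [_root_.smul_apply, hsymm (L c) v, hsymm (L 1) v]
  have h1 := happ (L c)
  have h2 := ((happ (L 1)).const_smul c).congr_of_eventuallyEq
    (h.mono fun y hy => hy c)
  have h3 := DFunLike.congr_fun (h1.unique h2) v
  simpa using h3

theorem IsCR.fderiv_apply (hf : ContDiffAt ℝ 2 f x) (h : ∀ᶠ y in 𝓝 x, IsCR L f y) (v : W) :
    IsCR L (fun y => _root_.fderiv ℝ f y v) x := by
  have hd : DifferentiableAt ℝ (_root_.fderiv ℝ f) x :=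
    (hf.fderiv_right (m := 1) (by norm_num)).differentiableAt one_ne_zero
  intro c
  have happ : _root_.fderiv ℝ (fun y => _root_.fderiv ℝ f y v) x =
      (ContinuousLinearMap.apply ℝ F v).comp (_root_.fderiv ℝ (_root_.fderiv ℝ f) x) :=
    ((ContinuousLinearMap.apply ℝ F v).hasFDerivAt.comp x hd.hasFDerivAt).fderiv
  rw [happ]
  have := DFunLike.congr_fun (IsCR.fderiv hf h c) v
  simpa using this

/-- Evaluated at `L c`, both terms of the derivative formula are complex linear in `c`: one through
`ν`, the other through `H`. -/
theorem IsCR.mellinLog [ProperSpace W] [CompleteSpace F] {H : W × ℝ → F} (hH : ContDiff ℝ 1 H)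
    {ν : W → ℂ} (hν : ContDiff ℝ 1 ν) (hx : -1 < (ν x).re) (cν : IsCR L ν x)
    (cH : ∀ s, IsCR ((ContinuousLinearMap.inl ℝ W ℝ).comp L) H (x, s)) :
    IsCR L (fun y => mellinLog 0 (ν y) fun s => H (y, s)) x := by
  intro c
  have hsl : Continuous fun s : ℝ => (x, s) := by fun_prop
  have i1 := intervalIntegrable_logPow_smul 1 hx
    ((contDiff_smulDeriv (m := 0) hH hν (by simp)).continuous.comp hsl)
  have i2 := intervalIntegrable_logPow_smul 0 hx
    ((contDiff_paramDeriv (m := 0) hH (by simp)).continuous.comp hsl)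
  have hform : ∀ c : ℂ, _root_.fderiv ℝ (fun y => DeSitterPoisson.mellinLog 0 (ν y)
      fun s => H (y, s)) x (L c) =
      (∫ s in (0 : ℝ)..1, logPow 1 (ν x) s • (_root_.fderiv ℝ ν x (L c) • H (x, s))) +
      ∫ s in (0 : ℝ)..1, logPow 0 (ν x) s • _root_.fderiv ℝ H (x, s) (L c, 0) := by
    intro c
    rw [(hasFDerivAt_mellinLog 0 hH hν hx).fderiv, _root_.add_apply,
      DeSitterPoisson.mellinLog, DeSitterPoisson.mellinLog]
    erw [ContinuousLinearMap.intervalIntegral_apply i1,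
      ContinuousLinearMap.intervalIntegral_apply i2]
    rfl
  rw [hform c, hform 1, smul_add, ← intervalIntegral.integral_smul,
    ← intervalIntegral.integral_smul]
  congr 2
  · ext s
    rw [cν c, smul_eq_mul, mul_smul]
    simp only [smul_smul]
    congr 1
    ring
  · ext s
    have := cH s c
    simp only [ContinuousLinearMap.comp_apply, ContinuousLinearMap.inl_apply] at this
    rw [this, smul_comm]

theorem IsCR.mellinReg [ProperSpace W] (k : ℕ) : ∀ {H : W × ℝ → ℂ} (_ : ContDiff ℝ ∞ H)
    {ν : W → ℂ} (_ : ContDiff ℝ ∞ ν) (_ : -1 - k < (ν x).re) (_ : IsCR L ν x)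
    (_ : ∀ y, IsCR ((ContinuousLinearMap.inl ℝ W ℝ).comp L) H y),
    IsCR L (fun y => mellinReg k (ν y) fun s => H (y, s)) x := by
  induction k with
  | zero =>
    intro H hH ν hν hx cν cH
    exact IsCR.mellinLog (hH.of_le (by simp)) (hν.of_le (by simp)) (by simpa using hx) cν
      fun s => cH _
  | succ k ih =>
    intro H hH ν hν hx cν cH
    simp only [DeSitterPoisson.mellinReg, deriv_slice (hH.differentiable (by simp))]
    have hν1 : ContDiff ℝ ∞ fun x => ν x + 1 := hν.add contDiff_const
    have cν1 : IsCR L (fun x => ν x + 1) x :=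
      cν.add (isCR_const 1) (hν.differentiable (by simp) x) (by fun_prop)
    have hx1 : -1 - (k : ℝ) < (ν x + 1).re := by
      push_cast at hx
      simp
      linarith
    have hH1 : ContDiff ℝ ∞ fun y => H (y, (1 : ℝ)) := hH.comp (contDiff_id.prodMk contDiff_const)
    have cH1 : IsCR L (fun y => H (y, (1 : ℝ))) x := by
      intro c
      have h1 : _root_.fderiv ℝ (fun y => H (y, (1 : ℝ))) x = paramDeriv H (x, 1) :=
        (hasFDerivAt_paramDeriv (y := (x, (1 : ℝ))) (hH.differentiable (by simp) _)).fderiv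
      rw [h1]
      exact cH (x, 1) c
    have hpc : ContDiff ℝ ∞ fun y => shiftedFactorial k (ν y + 1) :=
      ((differentiable_shiftedFactorial k).contDiff (n := ∞)).restrict_scalars ℝ |>.comp hν1
    have hd : ContDiff ℝ ∞ fun y => _root_.fderiv ℝ H y (0, 1) := contDiff_fderiv_apply_const hH _
    refine IsCR.sub (IsCR.mul ?_ cH1 (hpc.differentiable (by simp) x)
      (hH1.differentiable (by simp) x)) (ih (H := fun y => _root_.fderiv ℝ H y (0, 1)) hd hν1 hx1
        cν1 ?_) ((hpc.mul hH1).differentiable (by simp) x)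
      ((contDiffAt_mellinReg k hd hν1 hx1).differentiableAt (by simp))
    · exact cν1.comp_holomorphic (differentiable_shiftedFactorial k _)
        (hν1.differentiable (by simp) x)
    · intro y
      exact IsCR.fderiv_apply (hH.contDiffAt.of_le two_le_infty) (Eventually.of_forall cH) _

/-- A real derivative along `ℂ` that is complex linear is a complex derivative. -/
theorem IsCR.hasDerivAt {E : Type} [NormedAddCommGroup E] [NormedSpace ℝ E] {U : ℂ × E → F}
    {r : ℂ} {p : E} (dU : DifferentiableAt ℝ U (r, p))
    (cU : IsCR (ContinuousLinearMap.inl ℝ ℂ E) U (r, p)) :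
    HasDerivAt (fun z => U (z, p)) (_root_.fderiv ℝ U (r, p) (1, 0)) r := by
  have h1 : HasFDerivAt (fun z : ℂ => (z, p)) (ContinuousLinearMap.inl ℝ ℂ E) r :=
    hasFDerivAt_prodMk_left r p
  have h2 := HasFDerivAt.comp (g := U) r dU.hasFDerivAt h1
  have h3 : HasFDerivAt (𝕜 := ℂ) (fun z => U (z, p))
      ((1 : ℂ →L[ℂ] ℂ).smulRight (_root_.fderiv ℝ U (r, p) (1, 0))) r := by
    refine hasFDerivAt_of_restrictScalars ℝ h2 (ContinuousLinearMap.ext fun c => ?_)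
    simpa using (cU c).symm
  simpa using h3.hasDerivAt

/-- Uniformly on compact sets, all derivatives in `p` of the difference quotients in `r` of a
smooth family `U (r, p)` that is holomorphic in `r` converge to those of the complex derivative. -/
theorem tendstoUniformlyOn_iteratedFDeriv_diffQuot {E : Type} [NormedAddCommGroup E]
    [NormedSpace ℝ E] {Ω : Set ℂ} (hΩ : IsOpen Ω) {s : ℂ} (hs : s ∈ Ω) {K : Set E}
    (hK : IsCompact K) (n : ℕ) : ∀ {F : Type} [NormedAddCommGroup F] [NormedSpace ℂ F]
    {U : ℂ × E → F} (_ : ∀ r ∈ Ω, ∀ p, ContDiffAt ℝ ∞ U (r, p))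
    (_ : ∀ r ∈ Ω, ∀ p, IsCR (ContinuousLinearMap.inl ℝ ℂ E) U (r, p)),
    TendstoUniformlyOn (fun r => iteratedFDeriv ℝ n fun p => (r - s)⁻¹ • (U (r, p) - U (s, p)))
      (iteratedFDeriv ℝ n fun p => _root_.fderiv ℝ U (s, p) (1, 0)) (𝓝[≠] s) K := by
  induction n with
  | zero =>
    intro F _ _ U hU cU
    have hbase : TendstoUniformlyOn (fun r p => (r - s)⁻¹ • (U (r, p) - U (s, p)))
        (fun p => _root_.fderiv ℝ U (s, p) (1, 0)) (𝓝[≠] s) K := by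
      rw [← tendstoLocallyUniformlyOn_iff_tendstoUniformlyOn_of_compact hK,
        Metric.tendstoLocallyUniformlyOn_iff]
      intro ε hε p hp
      -- Strict differentiability at `(s, p)` compares `U (r, q)` with `U (s, q)` for all `q` near
      -- `p` at once, so the difference quotients converge locally uniformly.
      have hstrict := (hU s hs p).hasStrictFDerivAt (by simp)
      have hcont : ContinuousAt (fun q : E => _root_.fderiv ℝ U (s, q) (1, 0)) p := by
        have h1 : ContinuousAt (_root_.fderiv ℝ U) (s, p) :=
          ((hU s hs p).fderiv_right (m := 0) (by simp)).continuousAt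
        have h2 : ContinuousAt (fun q : E => _root_.fderiv ℝ U (s, q)) p :=
          ContinuousAt.comp (g := _root_.fderiv ℝ U) (f := fun q : E => (s, q)) h1 (by fun_prop)
        exact h2.clm_apply continuousAt_const
      have hc := Metric.continuousAt_iff'.1 hcont (ε / 2) (half_pos hε)
      have ho := hstrict.isLittleO.def (half_pos hε)
      rw [nhds_prod_eq, nhds_prod_eq] at ho
      have hmap : Tendsto (fun y : ℂ × E => ((y.1, y.2), (s, y.2))) (𝓝 s ×ˢ 𝓝 p)
          ((𝓝 s ×ˢ 𝓝 p) ×ˢ (𝓝 s ×ˢ 𝓝 p)) :=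
        (tendsto_fst.prodMk tendsto_snd).prodMk (tendsto_const_nhds.prodMk tendsto_snd)
      obtain ⟨A, hA, B, hB, hAB⟩ := eventually_prod_iff.1 (hmap.eventually ho)
      refine ⟨{q | B q} ∩ {q | dist (_root_.fderiv ℝ U (s, q) (1, 0))
        (_root_.fderiv ℝ U (s, p) (1, 0)) < ε / 2}, mem_nhdsWithin_of_mem_nhds
          (inter_mem hB hc), ?_⟩
      filter_upwards [mem_nhdsWithin_of_mem_nhds hA, self_mem_nhdsWithin] with r hr hrs q hq
      have hrs' : r - s ≠ 0 := sub_ne_zero.2 hrs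
      have h1 := hAB hr hq.1
      simp only [Prod.mk_sub_mk, sub_self] at h1
      have h2 := cU s hs p (r - s)
      simp only [ContinuousLinearMap.inl_apply] at h2
      rw [h2] at h1
      have h3 : ‖(r - s, (0 : E))‖ = ‖r - s‖ := by simp [Prod.norm_def]
      rw [h3] at h1
      have h4 : dist (_root_.fderiv ℝ U (s, p) (1, 0)) ((r - s)⁻¹ • (U (r, q) - U (s, q))) ≤
          ε / 2 := by
        rw [dist_eq_norm, ← norm_neg]
        have h5 : -(_root_.fderiv ℝ U (s, p) (1, 0) - (r - s)⁻¹ • (U (r, q) - U (s, q))) =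
            (r - s)⁻¹ • (U (r, q) - U (s, q) - (r - s) • _root_.fderiv ℝ U (s, p) (1, 0)) := by
          rw [smul_sub (r - s)⁻¹ (U (r, q) - U (s, q)), inv_smul_smul₀ hrs']
          abel
        rw [h5, norm_smul, norm_inv, inv_mul_le_iff₀ (norm_pos_iff.2 hrs')]
        linarith
      calc _ ≤ _ := dist_triangle _ (_root_.fderiv ℝ U (s, p) (1, 0)) _
        _ < ε / 2 + ε / 2 := add_lt_add_of_lt_of_le hq.2 h4
        _ = ε := add_halves ε
    have hiso := (continuousMultilinearCurryFin0 ℝ E F).symm.isometry.uniformContinuous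
    simpa only [iteratedFDeriv_zero_eq_comp] using hiso.comp_tendstoUniformlyOn hbase
  | succ n ih =>
    intro F _ _ U hU cU
    -- The induction passes to the derivative in `p`, which is again a smooth holomorphic family,
    -- now with values in `E →L[ℝ] F`.
    set D : ℂ × E → E →L[ℝ] F := fun y =>
      (_root_.fderiv ℝ U y).comp (ContinuousLinearMap.inr ℝ ℂ E) with hD
    have hDU : ∀ r ∈ Ω, ∀ p, ContDiffAt ℝ ∞ D (r, p) := fun r hr p =>
      ((hU r hr p).fderiv_right (by simp)).clm_comp contDiffAt_const
    have hev : ∀ r ∈ Ω, ∀ p, ∀ᶠ y in 𝓝 ((r, p) : ℂ × E), y.1 ∈ Ω := fun r hr p =>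
      continuous_fst.continuousAt.eventually (hΩ.mem_nhds hr)
    have hsnd : ∀ r ∈ Ω, ∀ p, IsCR (ContinuousLinearMap.inl ℝ ℂ E) (_root_.fderiv ℝ U) (r, p) :=
      fun r hr p => IsCR.fderiv ((hU r hr p).of_le two_le_infty)
        ((hev r hr p).mono fun y hy => cU y.1 hy y.2)
    have hdd : ∀ r ∈ Ω, ∀ p, DifferentiableAt ℝ (_root_.fderiv ℝ U) (r, p) := fun r hr p =>
      ((hU r hr p).fderiv_right (m := 1) two_le_infty).differentiableAt one_ne_zero
    have hDfd : ∀ r ∈ Ω, ∀ p, ∀ w v, _root_.fderiv ℝ D (r, p) w v =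
        _root_.fderiv ℝ (_root_.fderiv ℝ U) (r, p) w (0, v) := by
      intro r hr p w v
      have h1 : HasFDerivAt D _ (r, p) :=
        (hdd r hr p).hasFDerivAt.clm_comp (hasFDerivAt_const (ContinuousLinearMap.inr ℝ ℂ E) _)
      rw [h1.fderiv]
      simp
    have cDU : ∀ r ∈ Ω, ∀ p, IsCR (ContinuousLinearMap.inl ℝ ℂ E) D (r, p) := by
      intro r hr p c
      ext v
      rw [hDfd r hr p, hsnd r hr p c, _root_.smul_apply,
        _root_.smul_apply, hDfd r hr p]
    have hp : ∀ r ∈ Ω, ∀ p, HasFDerivAt (fun p => U (r, p)) (D (r, p)) p := by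
      intro r hr p
      have h1 : HasFDerivAt (fun p : E => (r, p)) (ContinuousLinearMap.inr ℝ ℂ E) p :=
        hasFDerivAt_prodMk_right r p
      exact HasFDerivAt.comp (g := U) p
        ((hU r hr p).differentiableAt (by simp)).hasFDerivAt h1
    have hstep := ih (F := E →L[ℝ] F) hDU cDU
    -- The derivatives in `p` and in the complex parameter commute, again by symmetry of the second
    -- derivative.
    have hlim : _root_.fderiv ℝ (fun p => _root_.fderiv ℝ U (s, p) (1, 0)) =
        fun p => _root_.fderiv ℝ D (s, p) (1, 0) := by
      ext p v
      have h1 : HasFDerivAt (fun p : E => (s, p)) (ContinuousLinearMap.inr ℝ ℂ E) p :=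
        hasFDerivAt_prodMk_right s p
      have h2 := HasFDerivAt.comp (g := _root_.fderiv ℝ U) p (hdd s hs p).hasFDerivAt h1
      have h3 := ((ContinuousLinearMap.apply ℝ F ((1 : ℂ), (0 : E))).hasFDerivAt).comp p h2
      have h4 : _root_.fderiv ℝ (fun p => _root_.fderiv ℝ U (s, p) (1, 0)) p = _ := h3.fderiv
      rw [h4, hDfd s hs p]
      have hsymm : IsSymmSndFDerivAt ℝ U (s, p) := (hU s hs p).isSymmSndFDerivAt (by simp [two_le_infty])
      simpa using hsymm (0, v) (1, 0)
    have hfin := (continuousMultilinearCurryRightEquiv' ℝ n E F).symm.isometry.uniformContinuous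
      |>.comp_tendstoUniformlyOn hstep
    rw [← hlim] at hfin
    have hsucc : ∀ f : E → F, iteratedFDeriv ℝ (n + 1) f =
        (continuousMultilinearCurryRightEquiv' ℝ n E F).symm ∘ iteratedFDeriv ℝ n
          (_root_.fderiv ℝ f) := fun f => funext fun x => iteratedFDeriv_succ_eq_comp_right
    simp only [hsucc]
    refine hfin.congr ?_
    filter_upwards [mem_nhdsWithin_of_mem_nhds (hΩ.mem_nhds hs)] with r hr p _
    simp only [Function.comp_apply]
    congr 2
    ext1 q
    exact (((hp r hr q).sub (hp s hs q)).const_smul _).fderiv.symm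

end HolomorphicFamilies

/-! ### Derivative bounds and continuity between spaces of smooth functions -/

section DerivBounds

/-- All derivatives of `f` of order at most `m` are bounded by `B` on `K`. -/
def DerivBound {E F : Type} [NormedAddCommGroup E] [NormedSpace ℝ E] [NormedAddCommGroup F]
    [NormedSpace ℝ F] (m : ℕ) (K : Set E) (f : E → F) (B : ℝ) : Prop :=
  ∀ i ≤ m, ∀ v ∈ K, ‖iteratedFDeriv ℝ i f v‖ ≤ B

theorem tendsto_smoothTopology_iff {X E ι : Type} [NormedAddCommGroup E] [NormedSpace ℝ E]
    (U : Set E) (j : X → E → ℂ) (u : ι → X) (l : Filter ι) (x : X) :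
    Tendsto u l (@nhds X (smoothTopology U j) x) ↔ ∀ (n : ℕ) (K : Set E), IsCompact K → K ⊆ U →
      TendstoUniformlyOn (fun i => iteratedFDeriv ℝ n (j (u i))) (iteratedFDeriv ℝ n (j x)) l K := by
  simp only [nhds_iInf, nhds_induced, tendsto_iInf, tendsto_comap_iff,
    UniformOnFun.tendsto_iff_tendstoUniformlyOn, mem_ofPred_eq, and_imp]
  rfl

/-- The usual seminorm criterion: each seminorm of the image is controlled by finitely many
seminorms of the source. Compatibility with differences reduces continuity at `f` to a bound on `f -
g`. -/
theorem continuous_of_derivBound {X Y E E' : Type} [NormedAddCommGroup E] [NormedSpace ℝ E]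
    [NormedAddCommGroup E'] [NormedSpace ℝ E'] [AddCommGroup X] [AddCommGroup Y]
    {U : Set E} {U' : Set E'} (hU : IsOpen U) (hU' : IsOpen U')
    {j : X → E → ℂ} {j' : Y → E' → ℂ} {T : X → Y}
    (hj : ∀ f g, j (f - g) = j f - j g) (hj' : ∀ f g, j' (f - g) = j' f - j' g)
    (hT : ∀ f g, T (f - g) = T f - T g) (sj : ∀ f, ContDiffOn ℝ ∞ (j f) U)
    (sj' : ∀ f, ContDiffOn ℝ ∞ (j' f) U')
    (hb : ∀ (n : ℕ) (K : Set E'), IsCompact K → K ⊆ U' → ∃ (m : ℕ) (Q : Set E) (C : ℝ),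
      IsCompact Q ∧ Q ⊆ U ∧ 0 ≤ C ∧ ∀ f B, 0 ≤ B → DerivBound m Q (j f) B →
        ∀ p ∈ K, ‖iteratedFDeriv ℝ n (j' (T f)) p‖ ≤ C * B) :
    @Continuous X Y (smoothTopology U j) (smoothTopology U' j') T := by
  let _ := smoothTopology U j
  let _ := smoothTopology U' j'
  rw [continuous_iff_continuousAt]
  intro f
  refine (tendsto_smoothTopology_iff U' j' T (𝓝 f) (T f)).2 fun n K hK hKU => ?_
  obtain ⟨m, Q, C, hQ, hQU, hC, hbd⟩ := hb n K hK hKU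
  have hid := (tendsto_smoothTopology_iff U j id (𝓝 f) f).1 tendsto_id
  rw [Metric.tendstoUniformlyOn_iff]
  intro ε hε
  -- With `C + 1` in the denominator, `C` times this number is below `ε` even when `C = 0`.
  have hδ : 0 < ε / (2 * (C + 1)) := by positivity
  have hall : ∀ᶠ g in 𝓝 f, ∀ i ∈ Finset.range (m + 1), ∀ v ∈ Q,
      dist (iteratedFDeriv ℝ i (j f) v) (iteratedFDeriv ℝ i (j g) v) < ε / (2 * (C + 1)) :=
    (Filter.eventually_all_finset _).2 fun i _ =>
      Metric.tendstoUniformlyOn_iff.1 (hid i Q hQ hQU) _ hδ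
  filter_upwards [hall] with g hg p hp
  have hdb : DerivBound m Q (j (f - g)) (ε / (2 * (C + 1))) := by
    intro i hi v hv
    have h1 := hg i (Finset.mem_range.2 (by omega)) v hv
    have hat : ∀ h, ContDiffAt ℝ i (j h) v := fun h =>
      ((sj h).contDiffAt (hU.mem_nhds (hQU hv))).of_le (by exact_mod_cast le_top)
    rw [hj, iteratedFDeriv_sub_apply (hat f) (hat g), ← dist_eq_norm]
    exact h1.le
  have h2 := hbd (f - g) _ hδ.le hdb p hp
  have hat : ∀ h, ContDiffAt ℝ n (j' h) p := fun h =>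
    ((sj' h).contDiffAt (hU'.mem_nhds (hKU hp))).of_le (by exact_mod_cast le_top)
  rw [hT, hj', iteratedFDeriv_sub_apply (hat _) (hat _), ← dist_eq_norm] at h2
  refine h2.trans_lt ?_
  rw [mul_div_assoc', div_lt_iff₀ (by positivity)]
  nlinarith

/-- Bounds on the derivatives are inherited by the composition with a fixed smooth map. -/
theorem exists_derivBound_comp {W E : Type} [NormedAddCommGroup W] [NormedSpace ℝ W]
    [NormedAddCommGroup E] [NormedSpace ℝ E] {U : Set E} (hU : IsOpen U) {u : W → E}
    (hu : ContDiff ℝ ∞ u) (huU : ∀ w, u w ∈ U) {Q : Set W} (hQ : IsCompact Q) (m : ℕ) :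
    ∃ C : ℝ, 0 ≤ C ∧ ∀ (h : E → ℂ) (B : ℝ), ContDiffOn ℝ ∞ h U → 0 ≤ B →
      DerivBound m (u '' Q) h B → DerivBound m Q (fun w => h (u w)) (C * B) := by
  have hbd : ∀ i : ℕ, ∃ D : ℝ, ∀ w ∈ Q, ‖iteratedFDeriv ℝ i u w‖ ≤ D := fun i =>
    hQ.exists_bound_of_continuousOn
      (hu.continuous_iteratedFDeriv (m := i) (by exact_mod_cast le_top)).continuousOn
  choose D hD using hbd
  -- The estimate for compositions asks for `‖D^k u‖ ≤ M ^ k`. Since `M ≥ 1`, a common bound for all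
  -- orders is enough.
  set M : ℝ := 1 + ∑ i ∈ Finset.range (m + 1), |D i| with hM
  have hM1 : 1 ≤ M := by
    rw [hM]
    have : 0 ≤ ∑ i ∈ Finset.range (m + 1), |D i| := Finset.sum_nonneg fun i _ => abs_nonneg _
    linarith
  refine ⟨(m.factorial : ℝ) * M ^ m, by positivity, fun h B hh hB hb i hi w hw => ?_⟩
  have key := norm_iteratedFDerivWithin_comp_le (n := i) (N := ∞) (g := h) (f := u) (s := univ)
    (t := U) (x := w) (C := B) (D := M) hh hu.contDiffOn (by exact_mod_cast le_top)
    hU.uniqueDiffOn uniqueDiffOn_univ (fun w _ => huU w) (mem_univ w) ?_ ?_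
  · rw [iteratedFDerivWithin_univ] at key
    refine key.trans ?_
    have h1 : (i.factorial : ℝ) ≤ m.factorial := by exact_mod_cast Nat.factorial_le hi
    have h2 : M ^ i ≤ M ^ m := pow_le_pow_right₀ hM1 hi
    calc (i.factorial : ℝ) * B * M ^ i ≤ m.factorial * B * M ^ m := by gcongr
      _ = _ := by ring
  · intro k hk
    rw [iteratedFDerivWithin_of_isOpen k hU (huU w)]
    exact hb k (hk.trans hi) _ (mem_image_of_mem u hw)
  · intro k hk1 hk
    rw [iteratedFDerivWithin_univ]
    have h1 : |D k| ≤ ∑ i ∈ Finset.range (m + 1), |D i| :=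
      Finset.single_le_sum (f := fun i => |D i|) (fun i _ => abs_nonneg _)
        (Finset.mem_range.2 (by omega))
    calc ‖iteratedFDeriv ℝ k u w‖ ≤ D k := hD k w hw
      _ ≤ M := by linarith [le_abs_self (D k)]
      _ ≤ M ^ k := le_self_pow₀ hM1 (by omega)

/-- Bounds on the derivatives are inherited by the product with a fixed smooth function. -/
theorem exists_derivBound_mul {E : Type} [NormedAddCommGroup E] [NormedSpace ℝ E] {U : Set E}
    (hU : IsOpen U) {a : E → ℂ} (ha : ContDiffOn ℝ ∞ a U) {Q : Set E} (hQ : IsCompact Q)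
    (hQU : Q ⊆ U) (m : ℕ) :
    ∃ C : ℝ, 0 ≤ C ∧ ∀ (h : E → ℂ) (B : ℝ), ContDiffOn ℝ ∞ h U → 0 ≤ B →
      DerivBound m Q h B → DerivBound m Q (fun w => a w * h w) (C * B) := by
  have hbd : ∀ i : ℕ, ∃ D : ℝ, ∀ w ∈ Q, ‖iteratedFDerivWithin ℝ i a U w‖ ≤ D := fun i =>
    hQ.exists_bound_of_continuousOn
      ((ha.continuousOn_iteratedFDerivWithin (m := i) (by exact_mod_cast le_top)
        hU.uniqueDiffOn).mono hQU)
  choose D hD using hbd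
  refine ⟨∑ n ∈ Finset.range (m + 1), ∑ i ∈ Finset.range (n + 1), (n.choose i : ℝ) * |D i|,
    Finset.sum_nonneg fun n _ => Finset.sum_nonneg fun i _ => by positivity,
    fun h B hh hB hb n hn w hw => ?_⟩
  have key := norm_iteratedFDerivWithin_mul_le (n := n) (N := ∞) ha hh hU.uniqueDiffOn (hQU hw)
    (by exact_mod_cast le_top)
  rw [iteratedFDerivWithin_of_isOpen n hU (hQU hw)] at key
  refine key.trans ?_
  have h1 : ∑ i ∈ Finset.range (n + 1), (n.choose i : ℝ) * ‖iteratedFDerivWithin ℝ i a U w‖ *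
      ‖iteratedFDerivWithin ℝ (n - i) h U w‖ ≤
      (∑ i ∈ Finset.range (n + 1), (n.choose i : ℝ) * |D i|) * B := by
    rw [Finset.sum_mul]
    refine Finset.sum_le_sum fun i hi => ?_
    rw [iteratedFDerivWithin_of_isOpen (n - i) hU (hQU hw)]
    have h2 := (hD i w hw).trans (le_abs_self _)
    have h3 := hb (n - i) (by omega) w hw
    gcongr
  refine h1.trans ?_
  gcongr
  exact Finset.single_le_sum
    (f := fun n => ∑ i ∈ Finset.range (n + 1), (n.choose i : ℝ) * |D i|)
    (fun n _ => Finset.sum_nonneg fun i _ => by positivity) (Finset.mem_range.2 (by omega))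

variable {V : Type} [NormedAddCommGroup V] [NormedSpace ℝ V]

theorem norm_iteratedFDeriv_paramDeriv_le {F : Type} [NormedAddCommGroup F] [NormedSpace ℂ F]
    {H : V × ℝ → F} (hH : ContDiff ℝ ∞ H) (n : ℕ) (y : V × ℝ) :
    ‖iteratedFDeriv ℝ n (paramDeriv H) y‖ ≤ ‖iteratedFDeriv ℝ (n + 1) H y‖ := by
  set T : (V × ℝ →L[ℝ] F) →L[ℝ] (V →L[ℝ] F) :=
    (ContinuousLinearMap.compL ℝ V (V × ℝ) F).flip (ContinuousLinearMap.inl ℝ V ℝ) with hT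
  have hT1 : ‖T‖ ≤ 1 := by
    refine ContinuousLinearMap.opNorm_le_bound _ zero_le_one fun A => ?_
    rw [one_mul]
    refine (ContinuousLinearMap.opNorm_comp_le _ _).trans ?_
    exact mul_le_of_le_one_right (norm_nonneg _) (ContinuousLinearMap.norm_inl_le_one ℝ V ℝ)
  have h1 := T.norm_iteratedFDeriv_comp_left (f := fderiv ℝ H) (x := y) (n := n) (N := ∞)
    (hH.fderiv_right (by simp)).contDiffAt (by exact_mod_cast le_top)
  rw [norm_iteratedFDeriv_fderiv] at h1
  exact h1.trans (mul_le_of_le_one_left (norm_nonneg _) hT1)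

theorem norm_iteratedFDeriv_fderiv_apply_le {W : Type} [NormedAddCommGroup W] [NormedSpace ℝ W]
    {H : W → ℂ} (hH : ContDiff ℝ ∞ H) (n : ℕ) {v : W} (hv : ‖v‖ ≤ 1) (y : W) :
    ‖iteratedFDeriv ℝ n (fun y => fderiv ℝ H y v) y‖ ≤ ‖iteratedFDeriv ℝ (n + 1) H y‖ := by
  have h1 := (ContinuousLinearMap.apply ℝ ℂ v).norm_iteratedFDeriv_comp_left (f := fderiv ℝ H)
    (x := y) (n := n) (N := ∞) (hH.fderiv_right (by simp)).contDiffAt (by exact_mod_cast le_top)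
  rw [norm_iteratedFDeriv_fderiv] at h1
  refine h1.trans (mul_le_of_le_one_left (norm_nonneg _) ?_)
  refine ContinuousLinearMap.opNorm_le_bound _ zero_le_one fun A => ?_
  rw [one_mul]
  exact (A.le_opNorm v).trans (mul_le_of_le_one_right (norm_nonneg _) hv)

theorem norm_iteratedFDeriv_slice_le (t : ℝ) (n : ℕ) : ∀ {F : Type} [NormedAddCommGroup F]
    [NormedSpace ℂ F] {H : V × ℝ → F} (_ : ContDiff ℝ ∞ H) (x : V),
    ‖iteratedFDeriv ℝ n (fun x => H (x, t)) x‖ ≤ ‖iteratedFDeriv ℝ n H (x, t)‖ := by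
  induction n with
  | zero => intro F _ _ H hH x; simp
  | succ n ih =>
    intro F _ _ H hH x
    have h1 : fderiv ℝ (fun x => H (x, t)) = fun x => paramDeriv H (x, t) := funext fun x =>
      (hasFDerivAt_paramDeriv (y := (x, t)) (hH.differentiable (by simp) _)).fderiv
    rw [← norm_iteratedFDeriv_fderiv, h1]
    exact (ih (contDiff_paramDeriv hH (by simp)) x).trans
      (norm_iteratedFDeriv_paramDeriv_le hH n _)

theorem norm_mellinLog_le {F : Type} [NormedAddCommGroup F] [NormedSpace ℂ F] {ν : ℂ}
    (hν : -1 < ν.re) {H : ℝ → F} {B : ℝ} (hB : ∀ s ∈ Icc (0 : ℝ) 1, ‖H s‖ ≤ B) :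
    ‖mellinLog 0 ν H‖ ≤ (∫ s in (0 : ℝ)..1, ‖logPow 0 ν s‖) * B := by
  have hint : IntervalIntegrable (fun s => ‖logPow 0 ν s‖ * B) volume 0 1 := by
    have := intervalIntegrable_logPow_smul 0 hν (H := fun _ => (1 : ℂ)) continuous_const
    simp only [smul_eq_mul, mul_one] at this
    exact this.norm.mul_const B
  rw [← intervalIntegral.integral_mul_const]
  refine intervalIntegral.norm_integral_le_of_norm_le zero_le_one ?_ hint
  refine Eventually.of_forall fun s hs => ?_
  rw [norm_smul]
  have := hB s ⟨hs.1.le, hs.2⟩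
  gcongr

theorem hasFDerivAt_mellinLog_const [ProperSpace V] {F : Type} [NormedAddCommGroup F]
    [NormedSpace ℂ F] {ν : ℂ} (hν : -1 < ν.re) {H : V × ℝ → F} (hH : ContDiff ℝ 1 H) (x : V) :
    HasFDerivAt (fun x => mellinLog 0 ν fun s => H (x, s))
      (mellinLog 0 ν fun s => paramDeriv H (x, s)) x := by
  refine (hasFDerivAt_mellinLog 0 hH (ν := fun _ : V => ν) contDiff_const hν).congr_fderiv ?_
  have h3 : ∀ s, smulDeriv (fun _ : V => ν) H (x, s) = 0 := fun s => by
    ext v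
    simp [smulDeriv_apply]
  simp [h3, mellinLog]

theorem norm_iteratedFDeriv_mellinLog_le [ProperSpace V] {ν : ℂ} (hν : -1 < ν.re) (n : ℕ) :
    ∀ {F : Type} [NormedAddCommGroup F] [NormedSpace ℂ F] {H : V × ℝ → F} (_ : ContDiff ℝ ∞ H)
    (x : V) (B : ℝ) (_ : ∀ s ∈ Icc (0 : ℝ) 1, ‖iteratedFDeriv ℝ n H (x, s)‖ ≤ B),
    ‖iteratedFDeriv ℝ n (fun x => mellinLog 0 ν fun s => H (x, s)) x‖ ≤
      (∫ s in (0 : ℝ)..1, ‖logPow 0 ν s‖) * B := by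
  induction n with
  | zero =>
    intro F _ _ H hH x B hB
    simp only [norm_iteratedFDeriv_zero] at hB ⊢
    exact norm_mellinLog_le hν hB
  | succ n ih =>
    intro F _ _ H hH x B hB
    have h1 : fderiv ℝ (fun x => mellinLog 0 ν fun s => H (x, s)) =
        fun x => mellinLog 0 ν fun s => paramDeriv H (x, s) := funext fun x =>
      (hasFDerivAt_mellinLog_const hν (hH.of_le (by simp)) x).fderiv
    rw [← norm_iteratedFDeriv_fderiv, h1]
    exact ih (contDiff_paramDeriv hH (by simp)) x B fun s hs =>
      (norm_iteratedFDeriv_paramDeriv_le hH n _).trans (hB s hs)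

/-- Every integration by parts costs one derivative in `s`, so `k` steps turn bounds of order `n +
k` on the integrand into a bound of order `n`. -/
theorem exists_norm_iteratedFDeriv_mellinReg_le [ProperSpace V] (k : ℕ) : ∀ {ν : ℂ}
    (_ : -1 - k < ν.re), ∃ C : ℝ, 0 ≤ C ∧ ∀ {H : V × ℝ → ℂ} (_ : ContDiff ℝ ∞ H) (n : ℕ)
    (x : V) (B : ℝ), DerivBound (n + k) ({x} ×ˢ Icc (0 : ℝ) 1) H B →
    ‖iteratedFDeriv ℝ n (fun x => mellinReg k ν fun s => H (x, s)) x‖ ≤ C * B := by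
  induction k with
  | zero =>
    intro ν hν
    refine ⟨∫ s in (0 : ℝ)..1, ‖logPow 0 ν s‖,
      intervalIntegral.integral_nonneg zero_le_one fun s _ => norm_nonneg _,
      fun {H} hH n x B hB => ?_⟩
    exact norm_iteratedFDeriv_mellinLog_le (by simpa using hν) n hH x B
      fun s hs => hB n (by omega) (x, s) ⟨rfl, hs⟩
  | succ k ih =>
    intro ν hν
    have hν1 : -1 - (k : ℝ) < (ν + 1).re := by
      push_cast at hν
      simp
      linarith
    obtain ⟨C, hC0, hC⟩ := ih hν1
    refine ⟨‖shiftedFactorial k (ν + 1)‖ + C, by positivity, fun {H} hH n x B hB => ?_⟩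
    simp only [mellinReg, deriv_slice (hH.differentiable (by simp))]
    have hd : ContDiff ℝ ∞ fun y => fderiv ℝ H y (0, 1) := contDiff_fderiv_apply_const hH _
    have hH1 : ContDiff ℝ ∞ fun x : V => H (x, 1) := hH.comp (contDiff_id.prodMk contDiff_const)
    have hn : (n : WithTop ℕ∞) ≤ ∞ := by exact_mod_cast le_top
    have hA : ContDiffAt ℝ n (fun x : V => shiftedFactorial k (ν + 1) • H (x, 1)) x :=
      ((hH1.of_le hn).const_smul _).contDiffAt
    have hR : ContDiffAt ℝ n (fun x => mellinReg k (ν + 1) fun s => fderiv ℝ H (x, s) (0, 1)) x :=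
      (contDiffAt_mellinReg k hd (ν := fun _ : V => ν + 1) contDiff_const hν1).of_le hn
    have hsub := iteratedFDeriv_sub_apply hA hR
    have heq : (fun x : V => shiftedFactorial k (ν + 1) * H (x, 1) -
        mellinReg k (ν + 1) fun s => fderiv ℝ H (x, s) (0, 1)) =
        (fun x : V => shiftedFactorial k (ν + 1) • H (x, 1)) -
          fun x => mellinReg k (ν + 1) fun s => fderiv ℝ H (x, s) (0, 1) := rfl
    rw [heq, hsub, iteratedFDeriv_const_smul_apply' (hH1.of_le hn).contDiffAt, add_mul]
    refine (norm_sub_le _ _).trans (add_le_add ?_ ?_)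
    · rw [norm_smul]
      have h1 := hB n (by omega) (x, 1) ⟨rfl, by simp⟩
      have h2 := norm_iteratedFDeriv_slice_le 1 n hH x
      gcongr
      exact h2.trans h1
    · refine hC hd n x B fun i hi y hy => ?_
      refine (norm_iteratedFDeriv_fderiv_apply_le hH i ?_ y).trans (hB (i + 1) (by omega) y hy)
      simp [Prod.norm_def]

end DerivBounds

/-! ### Slices of sections and their continued Mellin transforms -/

section Slices

/-- The sign `σ` as a real number. -/
def signReal (σ : ℤˣ) : ℝ := ((σ : ℤ) : ℝ)

theorem signReal_mul_self (σ : ℤˣ) : signReal σ * signReal σ = 1 := by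
  rcases Int.units_eq_one_or σ with rfl | rfl <;> simp [signReal]

theorem signReal_ne_zero (σ : ℤˣ) : signReal σ ≠ 0 := fun h => by
  simpa [h] using signReal_mul_self σ

/-- The sum `h (g (σ s, 1)) + h (g (1, σ s))`; the Poisson transform is the Mellin transform over
`(0, 1)` of this function. -/
def slice (σ : ℤˣ) (g : SL2) (h : Vec → ℂ) (s : ℝ) : ℂ :=
  h (g.1 *ᵥ ![signReal σ * s, 1]) + h (g.1 *ᵥ ![1, signReal σ * s])

theorem vec_ne_zero₁ (a : ℝ) : (![a, 1] : Vec) ≠ 0 := fun h => by simpa using congrFun h 1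

theorem vec_ne_zero₂ (a : ℝ) : (![1, a] : Vec) ≠ 0 := fun h => by simpa using congrFun h 0

variable {lam : ℂ}

theorem PrincipalSeries.contDiffOn (h : PrincipalSeries lam) :
    ContDiffOn ℝ ∞ h.toFun {0}ᶜ := h.2.2.1

theorem PrincipalSeries.homogeneous (h : PrincipalSeries lam) {t : ℝ} (ht : t ≠ 0) {v : Vec}
    (hv : v ≠ 0) : h.toFun (t • v) = ((|t| : ℝ) : ℂ) ^ (-lam) * h.toFun v := h.2.2.2 t ht v hv

/-- The homogeneity factor `|-1| ^ (-λ)` is `1`. Evenness makes the choice of sign of a lift to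
`SL(2, ℝ)` immaterial. -/
theorem PrincipalSeries.toFun_neg (h : PrincipalSeries lam) {v : Vec} (hv : v ≠ 0) :
    h.toFun (-v) = h.toFun v := by
  have := h.homogeneous (t := -1) (by norm_num) hv
  simpa using this

variable {W : Type} [NormedAddCommGroup W] [NormedSpace ℝ W]

theorem contDiff_mulVec_family {γ : W → SL2} (hγ : ∀ i j, ContDiff ℝ ∞ fun w => (γ w).1 i j)
    {u : W → Vec} (hu : ContDiff ℝ ∞ u) : ContDiff ℝ ∞ fun w => (γ w).1 *ᵥ u w := by
  rw [contDiff_pi]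
  intro i
  simp only [Matrix.mulVec, dotProduct]
  exact ContDiff.sum fun j _ => (hγ i j).mul (contDiff_pi.1 hu j)

theorem contDiff_slice_arg₁ {γ : W → SL2} (hγ : ∀ i j, ContDiff ℝ ∞ fun w => (γ w).1 i j)
    (σ : ℤˣ) : ContDiff ℝ ∞ fun y : W × ℝ => (γ y.1).1 *ᵥ (![signReal σ * y.2, 1] : Vec) := by
  refine contDiff_mulVec_family (γ := fun y : W × ℝ => γ y.1)
    (fun i j => (hγ i j).comp contDiff_fst) (contDiff_pi.2 fun i => ?_)
  fin_cases i
  · exact contDiff_const.mul contDiff_snd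
  · exact contDiff_const

theorem contDiff_slice_arg₂ {γ : W → SL2} (hγ : ∀ i j, ContDiff ℝ ∞ fun w => (γ w).1 i j)
    (σ : ℤˣ) : ContDiff ℝ ∞ fun y : W × ℝ => (γ y.1).1 *ᵥ (![1, signReal σ * y.2] : Vec) := by
  refine contDiff_mulVec_family (γ := fun y : W × ℝ => γ y.1)
    (fun i j => (hγ i j).comp contDiff_fst) (contDiff_pi.2 fun i => ?_)
  fin_cases i
  · exact contDiff_const
  · exact contDiff_const.mul contDiff_snd

/-- Neither argument of the section ever reaches the origin, so the slice is smooth on the whole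
line and in particular at `s = 0`. Integration by parts on `(0, 1)` depends on this. -/
theorem contDiff_slice_family {γ : W → SL2} (hγ : ∀ i j, ContDiff ℝ ∞ fun w => (γ w).1 i j)
    (σ : ℤˣ) {h : Vec → ℂ} (hh : ContDiffOn ℝ ∞ h {0}ᶜ) :
    ContDiff ℝ ∞ fun y : W × ℝ => slice σ (γ y.1) h y.2 :=
  (hh.comp_contDiff (contDiff_slice_arg₁ hγ σ) fun _ => mulVec_ne_zero _ (vec_ne_zero₁ _)).add
    (hh.comp_contDiff (contDiff_slice_arg₂ hγ σ) fun _ => mulVec_ne_zero _ (vec_ne_zero₂ _))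

theorem contDiff_slice (σ : ℤˣ) (g : SL2) {h : Vec → ℂ} (hh : ContDiffOn ℝ ∞ h {0}ᶜ) :
    ContDiff ℝ ∞ (slice σ g h) :=
  (contDiff_slice_family (W := ℝ) (γ := fun _ => g) (fun _ _ => contDiff_const) σ hh).comp
    (contDiff_const (c := (0 : ℝ)).prodMk contDiff_id)

theorem compactPicture_apply (φ : PrincipalSeries 0) {v : Vec} (hv : v ≠ 0) :
    (compactPicture lam φ).toFun v =
      Complex.exp ((Real.log (v 0 ^ 2 + v 1 ^ 2) : ℂ) * (-lam / 2)) * φ.toFun v := by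
  have hp := normSq_pos hv
  change ((v 0 ^ 2 + v 1 ^ 2 : ℝ) : ℂ) ^ (-lam / 2) * φ.toFun v = _
  rw [Complex.cpow_def_of_ne_zero (by exact_mod_cast hp.ne'), Complex.ofReal_log hp.le]

theorem contDiff_log_normSq : ContDiffOn ℝ ∞ (fun v : Vec => Real.log (v 0 ^ 2 + v 1 ^ 2)) {0}ᶜ :=
  ContDiffOn.log (ContDiff.contDiffOn (by fun_prop)) fun _ hv => (normSq_pos hv).ne'

/-- Multiplication by `|v| ^ λ` inverts `compactPicture`. A section at one value of `λ` thus belongs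
to a family over all `λ`, to which the identity theorem applies. -/
theorem exists_compactPicture_eq (h : PrincipalSeries lam) :
    ∃ φ : PrincipalSeries 0, compactPicture lam φ = h := by
  have hmem : (fun v : Vec => Complex.exp ((Real.log (v 0 ^ 2 + v 1 ^ 2) : ℂ) * (lam / 2)) *
      h.toFun v) ∈ sectionSpace 0 := by
    refine ⟨?_, ?_, fun t ht v hv => ?_⟩
    · have : h.toFun 0 = 0 := h.2.1
      simp [this]
    · refine ContDiffOn.mul (ContDiffOn.cexp (ContDiffOn.mul ?_ contDiffOn_const)) h.contDiffOn
      exact Complex.ofRealCLM.contDiff.comp_contDiffOn contDiff_log_normSq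
    · have hp := normSq_pos hv
      have ht' : 0 < |t| := abs_pos.2 ht
      have h1 : (t • v) 0 ^ 2 + (t • v) 1 ^ 2 = |t| ^ 2 * (v 0 ^ 2 + v 1 ^ 2) := by
        rw [sq_abs]
        simp only [Pi.smul_apply, smul_eq_mul]
        ring
      beta_reduce
      rw [h.homogeneous ht hv, h1, Real.log_mul (by positivity) hp.ne', Real.log_pow,
        Complex.cpow_def_of_ne_zero (by exact_mod_cast ht'.ne'), ← Complex.ofReal_log ht'.le,
        ← mul_assoc, ← Complex.exp_add]
      simp only [neg_zero, Complex.cpow_zero, one_mul]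
      congr 2
      push_cast
      ring
  refine ⟨⟨_, hmem⟩, Subtype.ext (funext fun v => ?_)⟩
  by_cases hv : v = 0
  · rw [hv]
    exact (compactPicture lam _).2.1.trans h.2.1.symm
  · refine (compactPicture_apply _ hv).trans ?_
    change _ * (Complex.exp _ * h.toFun v) = h.toFun v
    rw [← mul_assoc, ← Complex.exp_add, ← mul_add]
    simp [neg_div]

/-- A family that is smooth in all variables and holomorphic in the direction `L` satisfies the
Cauchy-Riemann equations. -/
theorem isCR_of_differentiableAt {F : Type} [NormedAddCommGroup F] [NormedSpace ℂ F]
    {L : ℂ →L[ℝ] W} {f : W → F} {x : W} (hf : DifferentiableAt ℝ f x)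
    (h : DifferentiableAt ℂ (fun c : ℂ => f (x + L c)) 0) : IsCR L f x := by
  have h1 : HasFDerivAt (fun c : ℂ => f (x + L c)) ((fderiv ℝ f x).comp L) 0 := by
    have h2 : HasFDerivAt (fun c : ℂ => x + L c) L 0 := L.hasFDerivAt.const_add x
    exact HasFDerivAt.comp (g := f) (0 : ℂ) (by simpa using hf.hasFDerivAt) h2
  have h3 := h1.unique (h.hasFDerivAt.restrictScalars ℝ)
  intro c
  have h4 := DFunLike.congr_fun h3 c
  have h5 := DFunLike.congr_fun h3 1
  simp only [ContinuousLinearMap.comp_apply, ContinuousLinearMap.coe_restrictScalars'] at h4 h5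
  rw [h4, h5, ← ContinuousLinearMap.map_smul, smul_eq_mul, mul_one]

variable {E : Type} [NormedAddCommGroup E] [NormedSpace ℝ E]

theorem contDiff_compactPicture_comp {Y : Type} [NormedAddCommGroup Y] [NormedSpace ℝ Y]
    (φ : PrincipalSeries 0) {u : Y → Vec} (hu : ContDiff ℝ ∞ u) (hu0 : ∀ y, u y ≠ 0)
    {l : Y → ℂ} (hl : ContDiff ℝ ∞ l) :
    ContDiff ℝ ∞ fun y => (compactPicture (l y) φ).toFun (u y) := by
  simp only [compactPicture_apply φ (hu0 _)]
  refine ContDiff.mul (ContDiff.cexp (ContDiff.mul ?_ ?_))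
    (φ.contDiffOn.comp_contDiff hu hu0)
  · exact Complex.ofRealCLM.contDiff.comp (contDiff_log_normSq.comp_contDiff hu hu0)
  · exact hl.neg.div_const _

theorem contDiff_slice_compactPicture {γ : E → SL2}
    (hγ : ∀ i j, ContDiff ℝ ∞ fun p => (γ p).1 i j) (σ : ℤˣ) (φ : PrincipalSeries 0) :
    ContDiff ℝ ∞ fun y : (ℂ × E) × ℝ =>
      slice σ (γ y.1.2) (compactPicture y.1.1 φ).toFun y.2 := by
  have hγ' : ∀ i j, ContDiff ℝ ∞ fun x : ℂ × E => (γ x.2).1 i j := fun i j =>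
    (hγ i j).comp contDiff_snd
  exact (contDiff_compactPicture_comp φ (contDiff_slice_arg₁ hγ' σ)
    (fun _ => mulVec_ne_zero _ (vec_ne_zero₁ _)) (contDiff_fst.comp contDiff_fst)).add
    (contDiff_compactPicture_comp φ (contDiff_slice_arg₂ hγ' σ)
    (fun _ => mulVec_ne_zero _ (vec_ne_zero₂ _)) (contDiff_fst.comp contDiff_fst))

/-- The parameter `λ` enters only through exponentials of `-λ / 2` times a real logarithm. -/
theorem isCR_slice_compactPicture {γ : E → SL2}
    (hγ : ∀ i j, ContDiff ℝ ∞ fun p => (γ p).1 i j) (σ : ℤˣ) (φ : PrincipalSeries 0)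
    (y : (ℂ × E) × ℝ) :
    IsCR ((ContinuousLinearMap.inl ℝ (ℂ × E) ℝ).comp (ContinuousLinearMap.inl ℝ ℂ E))
      (fun y : (ℂ × E) × ℝ => slice σ (γ y.1.2) (compactPicture y.1.1 φ).toFun y.2) y := by
  refine isCR_of_differentiableAt
    ((contDiff_slice_compactPicture hγ σ φ).differentiable (by simp) y) ?_
  simp only [slice, compactPicture_apply φ (mulVec_ne_zero _ (vec_ne_zero₁ _)),
    compactPicture_apply φ (mulVec_ne_zero _ (vec_ne_zero₂ _)), ContinuousLinearMap.comp_apply,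
    ContinuousLinearMap.inl_apply, Prod.fst_add, Prod.snd_add, add_zero]
  fun_prop

theorem contDiffAt_mellinReg_slice [ProperSpace E] {γ : E → SL2}
    (hγ : ∀ i j, ContDiff ℝ ∞ fun p => (γ p).1 i j) (σ : ℤˣ) (φ : PrincipalSeries 0) (k : ℕ)
    {x : ℂ × E} (hx : -(2 * k : ℝ) < x.1.re) :
    ContDiffAt ℝ ∞ (fun x : ℂ × E =>
      mellinReg k (x.1 / 2 - 1) (slice σ (γ x.2) (compactPicture x.1 φ).toFun)) x := by
  refine contDiffAt_mellinReg k (contDiff_slice_compactPicture hγ σ φ)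
    (ν := fun x : ℂ × E => x.1 / 2 - 1) (by fun_prop) ?_
  have : (x.1 / 2).re = x.1.re / 2 := by simp
  rw [Complex.sub_re, this, Complex.one_re]
  linarith

theorem isCR_mellinReg_slice [ProperSpace E] {γ : E → SL2}
    (hγ : ∀ i j, ContDiff ℝ ∞ fun p => (γ p).1 i j) (σ : ℤˣ) (φ : PrincipalSeries 0) (k : ℕ)
    {x : ℂ × E} (hx : -(2 * k : ℝ) < x.1.re) :
    IsCR (ContinuousLinearMap.inl ℝ ℂ E) (fun x : ℂ × E =>
      mellinReg k (x.1 / 2 - 1) (slice σ (γ x.2) (compactPicture x.1 φ).toFun)) x := by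
  refine IsCR.mellinReg k (contDiff_slice_compactPicture hγ σ φ)
    (ν := fun x : ℂ × E => x.1 / 2 - 1) (by fun_prop) ?_ ?_
    (isCR_slice_compactPicture hγ σ φ)
  · have : (x.1 / 2).re = x.1.re / 2 := by simp
    rw [Complex.sub_re, this, Complex.one_re]
    linarith
  · refine isCR_of_differentiableAt (by fun_prop) ?_
    simp only [ContinuousLinearMap.inl_apply, Prod.fst_add]
    fun_prop

theorem ne_of_notMem_poles (h : lam ∉ poles) (j : ℕ) : lam / 2 - 1 ≠ -1 - j := fun hj =>
  h ⟨j, by linear_combination 2 * hj⟩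

/-- In `Re λ > -2 k` the poles are exactly the zeros of the polynomial `shiftedFactorial k (λ / 2 -
1)`, and these half planes exhaust the plane. -/
theorem isOpen_compl_poles : IsOpen polesᶜ := by
  have h : polesᶜ = ⋃ k : ℕ, {lam : ℂ | -(2 * k : ℝ) < lam.re ∧
      shiftedFactorial k (lam / 2 - 1) ≠ 0} := by
    ext lam
    simp only [mem_compl_iff, mem_iUnion, mem_ofPred_eq]
    refine ⟨fun h => ⟨⌈-lam.re⌉₊ + 1, ?_, shiftedFactorial_ne_zero (ne_of_notMem_poles h) _⟩,
      fun ⟨k, hk, hne⟩ ⟨j, hj⟩ => ?_⟩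
    · push_cast
      linarith [Nat.le_ceil (-lam.re), Nat.cast_nonneg (α := ℝ) ⌈-lam.re⌉₊]
    · refine hne (Finset.prod_eq_zero (i := j) ?_ ?_)
      · rw [hj] at hk
        simp only [Complex.mul_re, Complex.neg_re, Complex.re_ofNat, Complex.natCast_re,
          Complex.neg_im, Complex.im_ofNat, Complex.natCast_im] at hk
        have : (j : ℝ) < k := by linarith
        exact Finset.mem_range.2 (by exact_mod_cast this)
      · rw [hj]
        ring
  rw [h]
  refine isOpen_iUnion fun k => IsOpen.inter ?_ ?_
  · exact isOpen_lt continuous_const Complex.continuous_re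
  · exact isOpen_ne_fun ((differentiable_shiftedFactorial k).continuous.comp (by fun_prop))
      continuous_const

/-- Removing a countable set from a real vector space of dimension greater than one leaves it path
connected. -/
theorem isPreconnected_compl_poles : IsPreconnected polesᶜ := by
  have h : poles.Countable := by
    have : poles = range fun k : ℕ => -2 * (k : ℂ) := by
      ext z
      simp [poles, eq_comm]
    rw [this]
    exact countable_range _
  exact (h.isPathConnected_compl_of_one_lt_rank (by simp)).isConnected.isPreconnected

/-- Locally in `λ`, away from the poles, the continuation is given by a fixed regularization. -/
theorem mellinCont_slice_eq {k : ℕ} (hk : -(2 * k : ℝ) < lam.re) (hlam : lam ∉ poles) (σ : ℤˣ)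
    (g : SL2) (h : PrincipalSeries lam) :
    mellinCont (lam / 2 - 1) (slice σ g h.toFun) =
      (shiftedFactorial k (lam / 2 - 1))⁻¹ * mellinReg k (lam / 2 - 1) (slice σ g h.toFun) := by
  refine mellinCont_eq (ne_of_notMem_poles hlam) ?_ (contDiff_slice σ g h.contDiffOn)
  have : (lam / 2).re = lam.re / 2 := by simp
  rw [Complex.sub_re, this, Complex.one_re]
  linarith

theorem exists_nat_neg_two_mul_lt (lam : ℂ) : ∃ k : ℕ, -(2 * k : ℝ) < lam.re := by
  -- The summand `1` makes the inequality strict on `Re λ = 0`, where the ceiling is `0`.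
  refine ⟨⌈-lam.re⌉₊ + 1, ?_⟩
  push_cast
  linarith [Nat.le_ceil (-lam.re), Nat.cast_nonneg (α := ℝ) ⌈-lam.re⌉₊]

theorem differentiableAt_inv_shiftedFactorial (k : ℕ) (hlam : lam ∉ poles) :
    DifferentiableAt ℂ (fun z => (shiftedFactorial k (z / 2 - 1))⁻¹) lam := by
  refine DifferentiableAt.inv ?_ (shiftedFactorial_ne_zero (ne_of_notMem_poles hlam) k)
  exact (differentiable_shiftedFactorial k _).comp (f := fun z : ℂ => z / 2 - 1) lam (by fun_prop)

/-- The continued Mellin transform of the slices, as a function of `λ` and of a parameter. -/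
theorem contDiffAt_mellinCont_slice [ProperSpace E] {γ : E → SL2}
    (hγ : ∀ i j, ContDiff ℝ ∞ fun p => (γ p).1 i j) (σ : ℤˣ) (φ : PrincipalSeries 0)
    {x : ℂ × E} (hx : x.1 ∉ poles) :
    ContDiffAt ℝ ∞ (fun x : ℂ × E =>
      mellinCont (x.1 / 2 - 1) (slice σ (γ x.2) (compactPicture x.1 φ).toFun)) x ∧
    IsCR (ContinuousLinearMap.inl ℝ ℂ E) (fun x : ℂ × E =>
      mellinCont (x.1 / 2 - 1) (slice σ (γ x.2) (compactPicture x.1 φ).toFun)) x := by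
  obtain ⟨k, hk⟩ := exists_nat_neg_two_mul_lt x.1
  have hev : (fun x : ℂ × E =>
      mellinCont (x.1 / 2 - 1) (slice σ (γ x.2) (compactPicture x.1 φ).toFun)) =ᶠ[𝓝 x]
      fun x => (shiftedFactorial k (x.1 / 2 - 1))⁻¹ *
        mellinReg k (x.1 / 2 - 1) (slice σ (γ x.2) (compactPicture x.1 φ).toFun) := by
    have h1 : ∀ᶠ y : ℂ × E in 𝓝 x, y.1 ∈ polesᶜ :=
      continuous_fst.continuousAt.eventually (isOpen_compl_poles.mem_nhds hx)
    have h2 : ∀ᶠ y : ℂ × E in 𝓝 x, -(2 * k : ℝ) < y.1.re :=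
      (Complex.continuous_re.comp continuous_fst).continuousAt.eventually (lt_mem_nhds hk)
    filter_upwards [h1, h2] with y hy1 hy2
    exact mellinCont_slice_eq hy2 hy1 σ _ _
  have hc := contDiffAt_mellinReg_slice hγ σ φ k hk
  have hf : ContDiffAt ℝ ∞ (fun x : ℂ × E => (shiftedFactorial k (x.1 / 2 - 1))⁻¹) x := by
    refine ContDiffAt.inv ?_ (shiftedFactorial_ne_zero (ne_of_notMem_poles hx) k)
    exact (((differentiable_shiftedFactorial k).contDiff (n := ∞)).restrict_scalars ℝ
      |>.comp (by fun_prop : ContDiff ℝ ∞ fun x : ℂ × E => x.1 / 2 - 1)).contDiffAt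
  have cf : IsCR (ContinuousLinearMap.inl ℝ ℂ E)
      (fun x : ℂ × E => (shiftedFactorial k (x.1 / 2 - 1))⁻¹) x := by
    refine isCR_of_differentiableAt (hf.differentiableAt (by simp)) ?_
    simp only [ContinuousLinearMap.inl_apply, Prod.fst_add]
    have h1 := differentiableAt_inv_shiftedFactorial k hx
    refine DifferentiableAt.comp (g := fun z : ℂ => (shiftedFactorial k (z / 2 - 1))⁻¹)
      (f := fun c : ℂ => x.1 + c) 0 (by simpa using h1) (by fun_prop)
  refine ⟨(hf.mul hc).congr_of_eventuallyEq hev, ?_⟩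
  exact (cf.mul (isCR_mellinReg_slice hγ σ φ k hk) (hf.differentiableAt (by simp))
    (hc.differentiableAt (by simp))).congr hev

theorem analyticOnNhd_compl_poles {f : ℂ → ℂ} (hf : DifferentiableOn ℂ f polesᶜ) :
    AnalyticOnNhd ℂ f polesᶜ := hf.analyticOnNhd isOpen_compl_poles

/-- Functions holomorphic off the poles agree if they agree for large `Re λ`. -/
theorem eq_of_eq_of_lt_re {f g : ℂ → ℂ} (hf : DifferentiableOn ℂ f polesᶜ)
    (hg : DifferentiableOn ℂ g polesᶜ) {a : ℝ} (h : ∀ lam : ℂ, a < lam.re → f lam = g lam)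
    (hlam : lam ∉ poles) : f lam = g lam := by
  -- A positive real number to the right of `a`: it is no pole, and both functions agree near it.
  set z₀ : ℂ := ((max a 0 + 1 : ℝ) : ℂ) with hz₀
  have hre : z₀.re = max a 0 + 1 := by rw [hz₀, Complex.ofReal_re]
  have hz : z₀ ∈ polesᶜ := by
    rintro ⟨k, hk⟩
    have h1 := congrArg Complex.re hk
    rw [hre] at h1
    simp at h1
    linarith [le_max_right a 0, Nat.cast_nonneg (α := ℝ) k]
  have hev : f =ᶠ[𝓝 z₀] g := by
    have h1 : ∀ᶠ z in 𝓝 z₀, a < z.re :=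
      Complex.continuous_re.continuousAt.eventually
        (lt_mem_nhds (by rw [hre]; linarith [le_max_left a 0]))
    exact h1.mono fun z hz => h z hz
  exact (analyticOnNhd_compl_poles hf).eqOn_of_preconnected_of_eventuallyEq
    (analyticOnNhd_compl_poles hg) isPreconnected_compl_poles hz hev hlam

end Slices

/-! ### Reduction of the Poisson integral to a Mellin transform -/

section ChangeOfVariables

theorem mulVec_bruhat (g : SL2) (ζ : ℝ) :
    g.1 *ᵥ bruhat ζ = ![g.1 0 0 * ζ + g.1 0 1, g.1 1 0 * ζ + g.1 1 1] := by
  ext i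
  fin_cases i <;> simp [Matrix.mulVec, dotProduct, bruhat, Fin.sum_univ_two]

theorem det_eq_one (g : SL2) : g.1 0 0 * g.1 1 1 - g.1 0 1 * g.1 1 0 = 1 := by
  rw [← Matrix.det_fin_two]
  exact g.2

theorem bruhat_ne_zero (ζ : ℝ) : bruhat ζ ≠ 0 := vec_ne_zero₁ ζ

theorem affine_ne_zero_ae (c d : ℝ) (h : c ≠ 0 ∨ d ≠ 0) :
    ({ζ : ℝ | c * ζ + d ≠ 0} : Set ℝ) =ᵐ[volume] univ := by
  have hfin : {ζ : ℝ | c * ζ + d = 0}.Subsingleton := by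
    intro x hx y hy
    simp only [mem_ofPred_eq] at hx hy
    by_cases hc : c = 0
    · simp [hc] at hx h
      exact absurd hx h
    · exact mul_left_cancel₀ hc (by linarith)
  rw [ae_eq_univ]
  have : ({ζ : ℝ | c * ζ + d ≠ 0} : Set ℝ)ᶜ = {ζ : ℝ | c * ζ + d = 0} := by
    ext
    simp
  rw [this]
  exact hfin.measure_zero _

/-- Invariance of `∫ f (ζ, 1) dζ` under `SL(2, ℝ)`, for `f` homogeneous of degree `-2`. -/
theorem integral_homogeneous_comp (g : SL2) {f : Vec → ℂ}
    (hf : ∀ t : ℝ, t ≠ 0 → ∀ v : Vec, v ≠ 0 → f (t • v) = (((t ^ 2)⁻¹ : ℝ) : ℂ) * f v) :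
    (Integrable (fun ζ : ℝ => f (bruhat ζ)) ↔ Integrable fun ζ : ℝ => f (g.1 *ᵥ bruhat ζ)) ∧
      ∫ ζ : ℝ, f (bruhat ζ) = ∫ ζ : ℝ, f (g.1 *ᵥ bruhat ζ) := by
  have hdet := det_eq_one g
  have hmv := mulVec_bruhat g
  generalize g.1 0 0 = a at *
  generalize g.1 0 1 = b at *
  generalize g.1 1 0 = c at *
  generalize g.1 1 1 = d at *
  set S : Set ℝ := {ζ | c * ζ + d ≠ 0} with hS
  set m : ℝ → ℝ := fun ζ => (a * ζ + b) / (c * ζ + d) with hm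
  have hSm : MeasurableSet S := (isOpen_ne_fun (by fun_prop) continuous_const).measurableSet
  have hSae : S =ᵐ[volume] univ := by
    refine affine_ne_zero_ae c d ?_
    by_contra! h
    simp [h.1, h.2] at hdet
  -- The Möbius map `m` misses only the image of `∞`; preimages come from the inverse map `η ↦ (d η
  -- - b) / (-c η + a)`.
  have himg : m '' S = {ζ | -c * ζ + a ≠ 0} := by
    ext η
    simp only [mem_image, hS, hm, mem_ofPred_eq]
    constructor
    · rintro ⟨ζ, hζ, rfl⟩ h
      field_simp at h
      apply one_ne_zero (α := ℝ)
      linear_combination h - hdet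
    · intro h
      have h1 : c * ((d * η - b) / (-c * η + a)) + d = 1 / (-c * η + a) := by
        rw [eq_div_iff h, add_mul, ← mul_div_assoc, div_mul_cancel₀ _ h]
        linear_combination hdet
      refine ⟨(d * η - b) / (-c * η + a), ?_, ?_⟩
      · rw [h1]
        positivity
      · rw [h1, div_div_eq_mul_div, div_one, add_mul, ← mul_div_assoc, div_mul_cancel₀ _ h]
        linear_combination η * hdet
  have hTae : m '' S =ᵐ[volume] univ := by
    rw [himg]
    refine affine_ne_zero_ae (-c) a ?_
    by_contra! h
    have : c = 0 := by linarith [h.1]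
    simp [this, h.2] at hdet
  have hder : ∀ ζ ∈ S, HasDerivWithinAt m (((c * ζ + d) ^ 2)⁻¹) S ζ := by
    intro ζ hζ
    have h1 : HasDerivAt (fun ζ => a * ζ + b) a ζ := by
      simpa using ((hasDerivAt_id ζ).const_mul a).add_const b
    have h2 : HasDerivAt (fun ζ => c * ζ + d) c ζ := by
      simpa using ((hasDerivAt_id ζ).const_mul c).add_const d
    refine ((h1.div h2 hζ).congr_deriv ?_).hasDerivWithinAt
    rw [div_eq_iff (pow_ne_zero 2 hζ), inv_mul_cancel₀ (pow_ne_zero 2 hζ)]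
    linear_combination hdet
  have hinj : InjOn m S := by
    intro x hx y hy hxy
    simp only [hm] at hxy
    rw [div_eq_div_iff hx hy] at hxy
    linear_combination hxy - (x - y) * hdet
  -- The Jacobian `(c ζ + d) ^ (-2)` is exactly the homogeneity factor between `g (ζ, 1)` and `(m ζ,
  -- 1)`.
  have hpt : ∀ ζ ∈ S, |((c * ζ + d) ^ 2)⁻¹| • f (bruhat (m ζ)) = f (g.1 *ᵥ bruhat ζ) := by
    intro ζ hζ
    have h1 : g.1 *ᵥ bruhat ζ = (c * ζ + d) • bruhat (m ζ) := by
      rw [hmv]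
      ext i
      fin_cases i
      · simp [bruhat, hm, mul_div_cancel₀ _ hζ]
      · simp [bruhat]
    rw [h1, hf _ hζ _ (bruhat_ne_zero _), abs_of_nonneg (by positivity), Complex.real_smul]
  constructor
  · rw [← integrableOn_univ, ← integrableOn_univ,
      ← integrableOn_congr_set_ae hTae, ← integrableOn_congr_set_ae hSae,
      integrableOn_image_iff_integrableOn_abs_deriv_smul hSm hder hinj]
    exact integrableOn_congr_fun hpt hSm
  · rw [← setIntegral_univ, ← setIntegral_univ (f := fun ζ => f (g.1 *ᵥ bruhat ζ)),
      ← setIntegral_congr_set hTae, ← setIntegral_congr_set hSae,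
      integral_image_eq_integral_abs_deriv_smul hSm hder hinj]
    exact setIntegral_congr_fun hSm hpt

/-- The quadratic form `v ↦ det (A v, v) / 2` on the plane, whose value at `(ζ, 1)` is
`poissonBase A ζ`. -/
def quadForm (A : deSitter) (v : Vec) : ℝ :=
  (2 * A.1 0 * v 0 * v 1 - (A.1 1 - A.1 2) * v 0 ^ 2 + (A.1 1 + A.1 2) * v 1 ^ 2) / 2

theorem quadForm_bruhat (A : deSitter) (ζ : ℝ) : quadForm A (bruhat ζ) = poissonBase A ζ := by
  simp [quadForm, poissonBase, bruhat]

theorem act_basePoint_coords (g : SL2) :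
    (act g basePoint).1 0 = g.1 0 0 * g.1 1 1 + g.1 0 1 * g.1 1 0 ∧
    (act g basePoint).1 1 = g.1 1 0 * g.1 1 1 - g.1 0 0 * g.1 0 1 ∧
    (act g basePoint).1 2 = -(g.1 0 0 * g.1 0 1 + g.1 1 0 * g.1 1 1) := by
  simp only [act, ofMat, toMat, basePoint, Matrix.SpecialLinearGroup.coe_inv,
    Matrix.adjugate_fin_two, Matrix.mul_apply, Fin.sum_univ_two, Matrix.of_apply,
    Matrix.cons_val', Matrix.cons_val_zero, Matrix.cons_val_one, Matrix.cons_val]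
  refine ⟨by ring, by ring, by ring⟩

/-- Since `g` preserves `det`, `det (g E g⁻¹ (g v), g v) = det (E v, v)`, which is `2 v₀ v₁` for `E
= diag(1, -1)`. -/
theorem quadForm_act_basePoint (g : SL2) (v : Vec) :
    quadForm (act g basePoint) (g.1 *ᵥ v) = v 0 * v 1 := by
  obtain ⟨h0, h1, h2⟩ := act_basePoint_coords g
  have hdet := det_eq_one g
  simp only [quadForm, h0, h1, h2, Matrix.mulVec, dotProduct, Fin.sum_univ_two]
  generalize g.1 0 0 = a at *
  generalize g.1 0 1 = b at *
  generalize g.1 1 0 = c at *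
  generalize g.1 1 1 = d at *
  linear_combination (v 0 * v 1) * (a * d - b * c + 1) * hdet

theorem quadForm_smul (A : deSitter) (t : ℝ) (v : Vec) :
    quadForm A (t • v) = t ^ 2 * quadForm A v := by
  simp only [quadForm, Pi.smul_apply, smul_eq_mul]
  ring

theorem ofReal_cpow_eq_exp {u : ℝ} (hu : 0 < u) (z : ℂ) :
    (u : ℂ) ^ z = Complex.exp ((Real.log u : ℂ) * z) := by
  rw [Complex.cpow_def_of_ne_zero (by exact_mod_cast hu.ne'), Complex.ofReal_log hu.le]

theorem signPow_sq_mul (σ : ℤˣ) {t : ℝ} (ht : t ≠ 0) (q : ℝ) (μ : ℂ) :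
    signPow σ (t ^ 2 * q) μ = ((|t| : ℝ) : ℂ) ^ (2 * μ) * signPow σ q μ := by
  have ht2 : 0 < t ^ 2 := by positivity
  have h1 : ((σ : ℤ) : ℝ) * (t ^ 2 * q) = t ^ 2 * (((σ : ℤ) : ℝ) * q) := by ring
  simp only [signPow, h1, mul_pos_iff_of_pos_left ht2]
  split_ifs with h
  · have hl : Real.log (t ^ 2) = 2 * Real.log |t| := by rw [Real.log_pow, Real.log_abs]; norm_num
    rw [Complex.ofReal_mul, Complex.mul_cpow_ofReal_nonneg ht2.le h.le,
      ofReal_cpow_eq_exp ht2, ofReal_cpow_eq_exp (abs_pos.2 ht), hl]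
    congr 2
    push_cast
    ring
  · simp

variable {lam : ℂ}

/-- The kernel contributes `|t| ^ (λ - 2)` and the section `|t| ^ (-λ)`: together this is degree
`-2`, as the invariant integral requires. -/
theorem signPow_quadForm_homogeneous (σ : ℤˣ) (A : deSitter) (h : PrincipalSeries lam) (t : ℝ)
    (ht : t ≠ 0) (v : Vec) (hv : v ≠ 0) :
    signPow σ (quadForm A (t • v)) (lam / 2 - 1) * h.toFun (t • v) =
      (((t ^ 2)⁻¹ : ℝ) : ℂ) * (signPow σ (quadForm A v) (lam / 2 - 1) * h.toFun v) := by
  have ht' := abs_pos.2 ht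
  rw [quadForm_smul, signPow_sq_mul σ ht, h.homogeneous ht hv]
  have h1 : ((|t| : ℝ) : ℂ) ^ (2 * (lam / 2 - 1)) * ((|t| : ℝ) : ℂ) ^ (-lam) =
      (((t ^ 2)⁻¹ : ℝ) : ℂ) := by
    rw [← Complex.cpow_add _ _ (by exact_mod_cast ht'.ne')]
    have : 2 * (lam / 2 - 1) + -lam = -(2 : ℕ) := by push_cast; ring
    rw [this, Complex.cpow_neg, Complex.cpow_natCast, ← sq_abs t]
    push_cast
    rfl
  rw [← h1]
  ring

theorem integrableOn_cpow_mul {μ : ℂ} (hμ : -1 < μ.re) {K : ℝ → ℂ} (hK : Continuous K) :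
    IntegrableOn (fun s : ℝ => (s : ℂ) ^ μ * K s) (Ioc 0 1) := by
  have h1 := intervalIntegrable_logPow_smul 0 hμ hK
  rw [intervalIntegrable_iff_integrableOn_Ioc_of_le zero_le_one] at h1
  simpa [logPow] using h1

theorem image_inv_Ioo : (fun u : ℝ => u⁻¹) '' Ioo 0 1 = Ioi 1 := by
  ext x
  constructor
  · rintro ⟨u, hu, rfl⟩
    exact (one_lt_inv₀ hu.1).2 hu.2
  · intro hx
    have h0 : 0 < x := zero_lt_one.trans hx
    exact ⟨x⁻¹, ⟨inv_pos.2 h0, inv_lt_one_of_one_lt₀ hx⟩, inv_inv x⟩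

/-- The integral over a half line of a function with the behaviour at infinity of a section of the
line bundle, as a Mellin transform over `(0, 1)`. -/
theorem integral_half_line (hlam : 0 < lam.re) (σ : ℤˣ) (g : SL2) (h : PrincipalSeries lam) :
    IntegrableOn (fun s : ℝ => (s : ℂ) ^ (lam / 2 - 1) *
      h.toFun (g.1 *ᵥ bruhat (signReal σ * s))) (Ioi 0) ∧
    ∫ s in Ioi (0 : ℝ), (s : ℂ) ^ (lam / 2 - 1) * h.toFun (g.1 *ᵥ bruhat (signReal σ * s)) =
      mellinCont (lam / 2 - 1) (slice σ g h.toFun) := by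
  have hμ : -1 < (lam / 2 - 1).re := by
    have : (lam / 2).re = lam.re / 2 := by simp
    rw [Complex.sub_re, this, Complex.one_re]
    linarith
  set μ : ℂ := lam / 2 - 1 with hμdef
  set G : ℝ → ℂ := fun s => (s : ℂ) ^ μ * h.toFun (g.1 *ᵥ bruhat (signReal σ * s)) with hG
  set K₁ : ℝ → ℂ := fun s => h.toFun (g.1 *ᵥ ![signReal σ * s, 1]) with hK₁
  set K₂ : ℝ → ℂ := fun s => h.toFun (g.1 *ᵥ ![1, signReal σ * s]) with hK₂
  have hγ : ∀ i j, ContDiff ℝ ∞ fun w : ℝ => ((fun _ : ℝ => g) w).1 i j :=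
    fun _ _ => contDiff_const
  have hpair : Continuous fun s : ℝ => ((0 : ℝ), s) := by fun_prop
  have cK₁ : Continuous K₁ := (h.contDiffOn.comp_contDiff (contDiff_slice_arg₁ hγ σ)
    fun _ => mulVec_ne_zero _ (vec_ne_zero₁ _)).continuous.comp hpair
  have cK₂ : Continuous K₂ := (h.contDiffOn.comp_contDiff (contDiff_slice_arg₂ hγ σ)
    fun _ => mulVec_ne_zero _ (vec_ne_zero₂ _)).continuous.comp hpair
  have i₁ : IntegrableOn G (Ioc 0 1) := integrableOn_cpow_mul hμ cK₁
  have i₂ : IntegrableOn (fun s : ℝ => (s : ℂ) ^ μ * K₂ s) (Ioc 0 1) :=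
    integrableOn_cpow_mul hμ cK₂
  have hder : ∀ u ∈ Ioo (0 : ℝ) 1, HasDerivWithinAt (fun u : ℝ => u⁻¹) (-(u ^ 2)⁻¹) (Ioo 0 1) u :=
    fun u hu => (hasDerivAt_inv hu.1.ne').hasDerivWithinAt
  have hinj : InjOn (fun u : ℝ => u⁻¹) (Ioo 0 1) := fun x _ y _ hxy => inv_injective hxy
  -- Under `s = u⁻¹` the exponents add up to `-2 - μ + λ = μ`, the same power as on `(0, 1)`,
  -- because `λ = 2 μ + 2`.
  have hpt : ∀ u ∈ Ioo (0 : ℝ) 1, |-(u ^ 2)⁻¹| • G u⁻¹ = (u : ℂ) ^ μ * K₂ u := by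
    intro u hu
    have hu0 := hu.1
    have h1 : g.1 *ᵥ bruhat (signReal σ * u⁻¹) =
        (signReal σ * u⁻¹) • (g.1 *ᵥ ![1, signReal σ * u]) := by
      rw [← Matrix.mulVec_smul]
      congr 1
      ext i
      fin_cases i
      · simp [bruhat]
      · simp only [bruhat, Fin.mk_one, Matrix.cons_val_one, Pi.smul_apply, smul_eq_mul,
          Matrix.cons_val_fin_one]
        have := signReal_mul_self σ
        field_simp
        linarith
    have hσ : |signReal σ * u⁻¹| = u⁻¹ := by
      have : |signReal σ| = 1 := by
        rcases Int.units_eq_one_or σ with rfl | rfl <;> simp [signReal]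
      rw [abs_mul, this, one_mul, abs_of_pos (inv_pos.2 hu0)]
    have hne : signReal σ * u⁻¹ ≠ 0 := mul_ne_zero (signReal_ne_zero σ) (inv_pos.2 hu0).ne'
    simp only [hG, hK₂]
    rw [h1, h.homogeneous hne (mulVec_ne_zero _ (vec_ne_zero₂ _)), hσ, abs_neg,
      abs_of_pos (by positivity), Complex.real_smul, ← mul_assoc, ← mul_assoc]
    congr 1
    have h2 : (((u ^ 2)⁻¹ : ℝ) : ℂ) = Complex.exp ((Real.log u : ℂ) * (-2)) := by
      rw [← ofReal_cpow_eq_exp hu0, show (-2 : ℂ) = -(2 : ℕ) by norm_num, Complex.cpow_neg,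
        Complex.cpow_natCast]
      push_cast
      rfl
    rw [h2, ofReal_cpow_eq_exp (inv_pos.2 hu0), ofReal_cpow_eq_exp (inv_pos.2 hu0),
      ofReal_cpow_eq_exp hu0, Real.log_inv, ← Complex.exp_add, ← Complex.exp_add]
    congr 1
    rw [hμdef]
    push_cast
    ring
  have i₃ : IntegrableOn G (Ioi 1) := by
    rw [← image_inv_Ioo, integrableOn_image_iff_integrableOn_abs_deriv_smul measurableSet_Ioo
      hder hinj, integrableOn_congr_fun hpt measurableSet_Ioo]
    exact i₂.mono_set Ioo_subset_Ioc_self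
  have e₃ : ∫ s in Ioi (1 : ℝ), G s = ∫ s in Ioc (0 : ℝ) 1, (s : ℂ) ^ μ * K₂ s := by
    rw [← image_inv_Ioo, integral_image_eq_integral_abs_deriv_smul measurableSet_Ioo hder hinj,
      setIntegral_congr_fun measurableSet_Ioo hpt, integral_Ioc_eq_integral_Ioo]
  have hunion : Ioc (0 : ℝ) 1 ∪ Ioi 1 = Ioi 0 := Ioc_union_Ioi_eq_Ioi zero_le_one
  refine ⟨hunion ▸ i₁.union i₃, ?_⟩
  rw [← hunion, setIntegral_union (by
    rw [Set.disjoint_left]; exact fun x hx hx' => not_lt.2 hx.2 hx') measurableSet_Ioi i₁ i₃, e₃,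
    mellinCont_of_neg_one_lt_re hμ (contDiff_slice σ g h.contDiffOn),
    intervalIntegral.integral_of_le zero_le_one, ← integral_add i₁ i₂]
  refine setIntegral_congr_fun measurableSet_Ioc fun s _ => ?_
  simp only [slice, hG, hK₂, mul_add]
  rfl

theorem integral_signPow (σ : ℤˣ) (μ : ℂ) (F : ℝ → ℂ)
    (hF : IntegrableOn (fun s : ℝ => (s : ℂ) ^ μ * F (signReal σ * s)) (Ioi 0)) :
    Integrable (fun ζ : ℝ => signPow σ ζ μ * F ζ) ∧
    ∫ ζ : ℝ, signPow σ ζ μ * F ζ =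
      ∫ s in Ioi (0 : ℝ), (s : ℂ) ^ μ * F (signReal σ * s) := by
  have hpt : (fun s : ℝ => signPow σ (signReal σ * s) μ * F (signReal σ * s)) =
      (Ioi (0 : ℝ)).indicator fun s => (s : ℂ) ^ μ * F (signReal σ * s) := by
    ext s
    have h1 : ((σ : ℤ) : ℝ) * (signReal σ * s) = s := by
      rw [← mul_assoc]
      change signReal σ * signReal σ * s = s
      rw [signReal_mul_self, one_mul]
    rw [signPow, h1, indicator]
    simp only [mem_Ioi]
    split_ifs <;> simp
  have hi : Integrable fun s : ℝ => signPow σ (signReal σ * s) μ * F (signReal σ * s) := by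
    rw [hpt]
    exact (integrable_indicator_iff measurableSet_Ioi).2 hF
  have he : ∫ s : ℝ, signPow σ (signReal σ * s) μ * F (signReal σ * s) =
      ∫ s in Ioi (0 : ℝ), (s : ℂ) ^ μ * F (signReal σ * s) := by
    rw [hpt, integral_indicator measurableSet_Ioi]
  rw [← he]
  rcases Int.units_eq_one_or σ with rfl | rfl
  · simp only [signReal, Units.val_one, Int.cast_one, one_mul] at hi ⊢
    exact ⟨hi, trivial⟩
  · simp only [signReal, Units.val_neg, Units.val_one, Int.cast_neg, Int.cast_one, neg_one_mul]
      at hi ⊢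
    refine ⟨by simpa using hi.comp_neg, ?_⟩
    exact (integral_neg_eq_self (fun ζ : ℝ => signPow (-1) ζ μ * F ζ) volume).symm

/-- The Poisson integral is convergent for `Re λ > 0`, and its value at `g E₁₁` is a Mellin
transform. -/
theorem integral_poisson (hlam : 0 < lam.re) (σ : ℤˣ) (g : SL2) (h : PrincipalSeries lam) :
    Integrable (fun ζ : ℝ => signPow σ (poissonBase (act g basePoint) ζ) (lam / 2 - 1) *
      h.toFun (bruhat ζ)) ∧
    ∫ ζ : ℝ, signPow σ (poissonBase (act g basePoint) ζ) (lam / 2 - 1) * h.toFun (bruhat ζ) =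
      mellinCont (lam / 2 - 1) (slice σ g h.toFun) := by
  obtain ⟨hi, he⟩ := integral_half_line hlam σ g h
  obtain ⟨hi', he'⟩ := integral_signPow σ (lam / 2 - 1)
    (fun ζ => h.toFun (g.1 *ᵥ bruhat ζ)) hi
  obtain ⟨hi'', he''⟩ := integral_homogeneous_comp g
    (f := fun v => signPow σ (quadForm (act g basePoint) v) (lam / 2 - 1) * h.toFun v)
    (signPow_quadForm_homogeneous σ (act g basePoint) h)
  have hq : ∀ ζ, quadForm (act g basePoint) (g.1 *ᵥ bruhat ζ) = ζ := fun ζ => by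
    rw [quadForm_act_basePoint]
    simp [bruhat]
  simp only [hq, quadForm_bruhat] at hi'' he''
  exact ⟨hi''.2 hi', he''.trans (he'.trans he)⟩

theorem differentiableOn_mellinCont_slice (σ : ℤˣ) (g : SL2) (φ : PrincipalSeries 0) :
    DifferentiableOn ℂ
      (fun z : ℂ => mellinCont (z / 2 - 1) (slice σ g (compactPicture z φ).toFun)) polesᶜ := by
  intro z hz
  obtain ⟨h1, h2⟩ := contDiffAt_mellinCont_slice (E := ℝ) (γ := fun _ => g)
    (fun _ _ => contDiff_const) σ φ (x := (z, 0)) hz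
  exact (IsCR.hasDerivAt (h1.differentiableAt (by simp))
    h2).differentiableAt.differentiableWithinAt

/-- The continued Mellin transform of the slice along `g` depends only on the point `g E₁₁`. -/
theorem mellinCont_slice_eq_of_act_eq (hlam : lam ∉ poles) (σ : ℤˣ) {g g' : SL2}
    (hg : act g basePoint = act g' basePoint) (h : PrincipalSeries lam) :
    mellinCont (lam / 2 - 1) (slice σ g h.toFun) =
      mellinCont (lam / 2 - 1) (slice σ g' h.toFun) := by
  obtain ⟨φ, rfl⟩ := exists_compactPicture_eq h
  -- For `Re z > 0` both sides are the Poisson integral at the same point of `dS²`; the identity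
  -- theorem carries the equality to `lam`.
  refine eq_of_eq_of_lt_re (differentiableOn_mellinCont_slice σ g φ)
    (differentiableOn_mellinCont_slice σ g' φ) (a := 0) (fun z hz => ?_) hlam
  rw [← (integral_poisson hz σ g _).2, ← (integral_poisson hz σ g' _).2, hg]

end ChangeOfVariables

/-! ### A smooth lift of the coordinates of `dS²` to `SL(2, ℝ)` -/

section Lift

/-- The product of the rotation by `θ / 2` and of a boost, which maps `E₁₁` to `chart (t, θ)`. -/
def lift (p : Fin 2 → ℝ) : SL2 :=
  ⟨!![Real.cosh (p 0 / 2) * Real.cos (p 1 / 2) + Real.sinh (p 0 / 2) * Real.sin (p 1 / 2),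
      -(Real.sinh (p 0 / 2) * Real.cos (p 1 / 2)) - Real.cosh (p 0 / 2) * Real.sin (p 1 / 2);
      Real.cosh (p 0 / 2) * Real.sin (p 1 / 2) - Real.sinh (p 0 / 2) * Real.cos (p 1 / 2),
      Real.cosh (p 0 / 2) * Real.cos (p 1 / 2) - Real.sinh (p 0 / 2) * Real.sin (p 1 / 2)], by
    have h1 := Real.cosh_sq (p 0 / 2)
    have h2 := Real.sin_sq_add_cos_sq (p 1 / 2)
    rw [Matrix.det_fin_two_of]
    linear_combination (Real.sin (p 1 / 2) ^ 2 + Real.cos (p 1 / 2) ^ 2) * h1 + h2⟩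

theorem contDiff_lift (i j : Fin 2) : ContDiff ℝ ∞ fun p => (lift p).1 i j := by
  fin_cases i <;> fin_cases j <;> simp [lift] <;> fun_prop

theorem act_lift_basePoint (p : Fin 2 → ℝ) : act (lift p) basePoint = ⟨chart p, chart_mem p⟩ := by
  obtain ⟨h0, h1, h2⟩ := act_basePoint_coords (lift p)
  have c1 : Real.cosh (p 0) = Real.cosh (p 0 / 2) ^ 2 + Real.sinh (p 0 / 2) ^ 2 := by
    rw [← Real.cosh_two_mul]
    ring_nf
  have c2 : Real.sinh (p 0) = 2 * Real.sinh (p 0 / 2) * Real.cosh (p 0 / 2) := by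
    rw [← Real.sinh_two_mul]
    ring_nf
  have c3 : Real.cos (p 1) = Real.cos (p 1 / 2) ^ 2 - Real.sin (p 1 / 2) ^ 2 := by
    rw [← Real.cos_two_mul']
    ring_nf
  have c4 : Real.sin (p 1) = 2 * Real.sin (p 1 / 2) * Real.cos (p 1 / 2) := by
    rw [← Real.sin_two_mul]
    ring_nf
  have h3 := Real.sin_sq_add_cos_sq (p 1 / 2)
  refine Subtype.ext (funext fun i => ?_)
  fin_cases i
  · refine h0.trans ?_
    simp only [chart, lift, Fin.zero_eta, Matrix.cons_val_zero, Matrix.of_apply, Matrix.cons_val',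
      Matrix.cons_val_one, Matrix.cons_val_fin_one, c1, c3]
    ring
  · refine h1.trans ?_
    simp only [chart, lift, Fin.mk_one, Matrix.cons_val_zero, Matrix.of_apply, Matrix.cons_val',
      Matrix.cons_val_one, Matrix.cons_val_fin_one, c1, c4]
    ring
  · refine h2.trans ?_
    simp only [chart, lift, Fin.reduceFinMk, Matrix.cons_val, Matrix.cons_val_zero,
      Matrix.of_apply, Matrix.cons_val', Matrix.cons_val_one, Matrix.cons_val_fin_one, c2]
    linear_combination 2 * Real.sinh (p 0 / 2) * Real.cosh (p 0 / 2) * h3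

theorem exists_chart_eq (A : deSitter) : ∃ p, (⟨chart p, chart_mem p⟩ : deSitter) = A := by
  obtain ⟨A, hA⟩ := A
  have hA' : A 0 ^ 2 + A 1 ^ 2 - A 2 ^ 2 = 1 := hA
  set t := Real.arsinh (A 2) with ht
  have hs : Real.sinh t = A 2 := Real.sinh_arsinh _
  have hc : 0 < Real.cosh t := Real.cosh_pos t
  have hc2 := Real.cosh_sq t
  -- On `dS²` the modulus of `x + i y` is `cosh t` when `z = sinh t`, so `θ` can be taken to be the
  -- argument.
  set z : ℂ := ⟨A 0, A 1⟩ with hz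
  have hn : ‖z‖ = Real.cosh t := by
    rw [← abs_of_pos hc, ← abs_of_nonneg (norm_nonneg z), ← sq_eq_sq_iff_abs_eq_abs,
      ← Complex.normSq_eq_norm_sq, Complex.normSq_apply, hc2, hs]
    simp only [hz]
    linarith
  refine ⟨![t, Complex.arg z], Subtype.ext (funext fun i => ?_)⟩
  fin_cases i
  · change Real.cosh t * Real.cos (Complex.arg z) = A 0
    rw [← hn]
    exact Complex.norm_mul_cos_arg z
  · change Real.cosh t * Real.sin (Complex.arg z) = A 1
    rw [← hn]
    exact Complex.norm_mul_sin_arg z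
  · simpa [chart] using hs

/-- Coordinates `(t, θ)` of a point of `dS²`. -/
def coords (A : deSitter) : Fin 2 → ℝ := (exists_chart_eq A).choose

theorem chart_coords (A : deSitter) : (⟨chart (coords A), chart_mem _⟩ : deSitter) = A :=
  (exists_chart_eq A).choose_spec

theorem act_lift_coords (A : deSitter) : act (lift (coords A)) basePoint = A :=
  (act_lift_basePoint _).trans (chart_coords A)

/-- The point determines `t` and `θ` modulo `2π`, and the half angle enters `lift` through a cosine
and a sine that are then known up to a common sign. -/
theorem lift_eq_or_eq_neg {p q : Fin 2 → ℝ} (h : chart p = chart q) :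
    (lift p).1 = (lift q).1 ∨ (lift p).1 = -(lift q).1 := by
  have h2 : Real.sinh (p 0) = Real.sinh (q 0) := by simpa [chart] using congrFun h 2
  have ht : p 0 = q 0 := Real.sinh_injective h2
  have hc : Real.cosh (q 0) ≠ 0 := (Real.cosh_pos _).ne'
  have h0 : Real.cos (p 1) = Real.cos (q 1) := by
    simpa [chart, ht, hc] using congrFun h 0
  have h1 : Real.sin (p 1) = Real.sin (q 1) := by
    simpa [chart, ht, hc] using congrFun h 1
  have e1 : p 1 = 2 * (p 1 / 2) := by ring
  have e2 : q 1 = 2 * (q 1 / 2) := by ring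
  rw [e1, e2, Real.cos_two_mul, Real.cos_two_mul] at h0
  rw [e1, e2, Real.sin_two_mul, Real.sin_two_mul] at h1
  have s1 := Real.sin_sq_add_cos_sq (p 1 / 2)
  have s2 := Real.sin_sq_add_cos_sq (q 1 / 2)
  have key : (Real.cos (p 1 / 2) = Real.cos (q 1 / 2) ∧ Real.sin (p 1 / 2) = Real.sin (q 1 / 2)) ∨
      (Real.cos (p 1 / 2) = -Real.cos (q 1 / 2) ∧ Real.sin (p 1 / 2) = -Real.sin (q 1 / 2)) := by
    generalize Real.cos (p 1 / 2) = C at *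
    generalize Real.sin (p 1 / 2) = S at *
    generalize Real.cos (q 1 / 2) = C' at *
    generalize Real.sin (q 1 / 2) = S' at *
    have hC : C ^ 2 = C' ^ 2 := by linarith
    have hS : S ^ 2 = S' ^ 2 := by linarith
    rcases sq_eq_sq_iff_eq_or_eq_neg.1 hC with rfl | rfl
    · by_cases hC0 : C = 0
      · rcases sq_eq_sq_iff_eq_or_eq_neg.1 hS with rfl | rfl
        · exact Or.inl ⟨rfl, rfl⟩
        · exact Or.inr ⟨by simp [hC0], rfl⟩
      · refine Or.inl ⟨rfl, mul_right_cancel₀ hC0 ?_⟩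
        linarith
    · by_cases hC0 : C' = 0
      · rcases sq_eq_sq_iff_eq_or_eq_neg.1 hS with rfl | rfl
        · exact Or.inl ⟨by simp [hC0], rfl⟩
        · exact Or.inr ⟨rfl, rfl⟩
      · refine Or.inr ⟨rfl, mul_right_cancel₀ hC0 ?_⟩
        linarith
  rcases key with ⟨k1, k2⟩ | ⟨k1, k2⟩
  · left
    simp only [lift, ht, k1, k2]
  · right
    ext i j
    fin_cases i <;> fin_cases j <;> simp [lift, ht, k1, k2] <;> ring

variable {lam : ℂ}

theorem slice_lift_eq {p q : Fin 2 → ℝ} (hpq : chart p = chart q) (σ : ℤˣ)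
    (h : PrincipalSeries lam) : slice σ (lift p) h.toFun = slice σ (lift q) h.toFun := by
  ext s
  rcases lift_eq_or_eq_neg hpq with e | e
  · simp only [slice, e]
  · simp only [slice, e, Matrix.neg_mulVec,
      h.toFun_neg (mulVec_ne_zero (lift q) (vec_ne_zero₁ _)),
      h.toFun_neg (mulVec_ne_zero (lift q) (vec_ne_zero₂ _))]

/-- The chosen `coords` need not be continuous. In the chart they may be replaced by the
tautological coordinates `p`, where smoothness can be checked. -/
theorem slice_lift_coords_chart (p : Fin 2 → ℝ) (σ : ℤˣ) (h : PrincipalSeries lam) :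
    slice σ (lift (coords ⟨chart p, chart_mem p⟩)) h.toFun = slice σ (lift p) h.toFun :=
  slice_lift_eq (congrArg Subtype.val (chart_coords ⟨chart p, chart_mem p⟩)) σ h

end Lift

/-! ### The Poisson operators: continuity, meromorphy and equivariance -/

section Operators

variable {lam : ℂ}

theorem mellinReg_add_fun (k : ℕ) : ∀ {ν : ℂ} (_ : -1 - k < ν.re) {K K' : ℝ → ℂ}
    (_ : ContDiff ℝ ∞ K) (_ : ContDiff ℝ ∞ K'),
    mellinReg k ν (fun s => K s + K' s) = mellinReg k ν K + mellinReg k ν K' := by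
  induction k with
  | zero =>
    intro ν hν K K' hK hK'
    have hν' : -1 < ν.re := by simpa using hν
    simp only [mellinReg, mellinLog, smul_add]
    exact intervalIntegral.integral_add (intervalIntegrable_logPow_smul 0 hν' hK.continuous)
      (intervalIntegrable_logPow_smul 0 hν' hK'.continuous)
  | succ k ih =>
    intro ν hν K K' hK hK'
    have hd : deriv (fun s => K s + K' s) = fun s => deriv K s + deriv K' s := funext fun s =>
      deriv_fun_add (hK.differentiable (by simp) s) (hK'.differentiable (by simp) s)
    have hν1 : -1 - (k : ℝ) < (ν + 1).re := by
      push_cast at hν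
      simp
      linarith
    simp only [mellinReg, hd]
    rw [ih hν1 (contDiff_infty_iff_deriv.1 hK).2 (contDiff_infty_iff_deriv.1 hK').2]
    ring

theorem mellinReg_const_mul (k : ℕ) : ∀ {ν : ℂ} (c : ℂ) {K : ℝ → ℂ} (_ : ContDiff ℝ ∞ K),
    mellinReg k ν (fun s => c * K s) = c * mellinReg k ν K := by
  induction k with
  | zero =>
    intro ν c K hK
    simp only [mellinReg, mellinLog, ← intervalIntegral.integral_const_mul, smul_eq_mul]
    congr 1
    ext s
    ring
  | succ k ih =>
    intro ν c K hK
    have hd : deriv (fun s => c * K s) = fun s => c * deriv K s := funext fun s =>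
      deriv_const_mul c (hK.differentiable (by simp) s)
    simp only [mellinReg, hd]
    rw [ih c (contDiff_infty_iff_deriv.1 hK).2]
    ring

theorem neg_one_sub_lt_re {k : ℕ} (hk : -(2 * k : ℝ) < lam.re) :
    -1 - (k : ℝ) < (lam / 2 - 1).re := by
  have : (lam / 2).re = lam.re / 2 := by simp
  rw [Complex.sub_re, this, Complex.one_re]
  linarith

/-- The regularized Poisson transform, as a function on `dS²`. -/
def regFun (σ : ℤˣ) (k : ℕ) (lam : ℂ) (h : Vec → ℂ) (A : deSitter) : ℂ :=
  mellinReg k (lam / 2 - 1) (slice σ (lift (coords A)) h)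

theorem inChart_regFun (σ : ℤˣ) (k : ℕ) (h : PrincipalSeries lam) :
    inChart (regFun σ k lam h.toFun) =
      fun p => mellinReg k (lam / 2 - 1) (slice σ (lift p) h.toFun) := by
  ext p
  rw [inChart, regFun, slice_lift_coords_chart]

theorem contDiff_inChart_regFun (σ : ℤˣ) {k : ℕ} (hk : -(2 * k : ℝ) < lam.re)
    (h : PrincipalSeries lam) : ContDiff ℝ ∞ (inChart (regFun σ k lam h.toFun)) := by
  rw [inChart_regFun, contDiff_iff_contDiffAt]
  intro p
  exact contDiffAt_mellinReg k (contDiff_slice_family contDiff_lift σ h.contDiffOn)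
    (ν := fun _ => lam / 2 - 1) contDiff_const (neg_one_sub_lt_re hk)

theorem PrincipalSeries.toFun_add (h h' : PrincipalSeries lam) :
    (h + h').toFun = fun v => h.toFun v + h'.toFun v := rfl

theorem PrincipalSeries.toFun_smul (c : ℂ) (h : PrincipalSeries lam) :
    (c • h).toFun = fun v => c * h.toFun v := rfl

/-- The regularized Poisson transform as a linear map. -/
def regLinear (σ : ℤˣ) (c : ℂ) (k : ℕ) (lam : ℂ) (hk : -(2 * k : ℝ) < lam.re) :
    PrincipalSeries lam →ₗ[ℂ] SmoothDeSitter where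
  toFun h := ⟨fun A => c * regFun σ k lam h.toFun A,
    (contDiff_inChart_regFun σ hk h).const_smul c⟩
  map_add' h h' := Subtype.ext (funext fun A => by
    change c * regFun σ k lam (h + h').toFun A =
      c * regFun σ k lam h.toFun A + c * regFun σ k lam h'.toFun A
    rw [regFun, regFun, regFun, ← mul_add, ← mellinReg_add_fun k (neg_one_sub_lt_re hk)
      (contDiff_slice σ _ h.contDiffOn) (contDiff_slice σ _ h'.contDiffOn)]
    congr 2
    ext s
    simp only [slice, PrincipalSeries.toFun_add]
    ring)
  map_smul' a h := Subtype.ext (funext fun A => by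
    change c * regFun σ k lam (a • h).toFun A = a * (c * regFun σ k lam h.toFun A)
    rw [regFun, regFun, mul_left_comm, ← mellinReg_const_mul k a
      (contDiff_slice σ _ h.contDiffOn)]
    congr 2
    ext s
    simp only [slice, PrincipalSeries.toFun_smul]
    ring)

theorem inChart_regLinear (σ : ℤˣ) (c : ℂ) {k : ℕ} (hk : -(2 * k : ℝ) < lam.re)
    (h : PrincipalSeries lam) : inChart (regLinear σ c k lam hk h).toFun =
      fun p => c * mellinReg k (lam / 2 - 1) (slice σ (lift p) h.toFun) := by
  ext p
  rw [← congrFun (inChart_regFun σ k h) p]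
  rfl

theorem DerivBound.add {W : Type} [NormedAddCommGroup W] [NormedSpace ℝ W] {m : ℕ} {K : Set W}
    {f g : W → ℂ} {B B' : ℝ} (hf : DerivBound m K f B) (hg : DerivBound m K g B')
    (sf : ContDiff ℝ ∞ f) (sg : ContDiff ℝ ∞ g) :
    DerivBound m K (fun w => f w + g w) (B + B') := by
  intro i hi v hv
  have hle : (i : WithTop ℕ∞) ≤ ∞ := by exact_mod_cast le_top
  have := iteratedFDeriv_add_apply (sf.of_le hle).contDiffAt (sg.of_le hle).contDiffAt (x := v)
  change ‖iteratedFDeriv ℝ i (f + g) v‖ ≤ _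
  rw [this]
  exact (norm_add_le _ _).trans (add_le_add (hf i hi v hv) (hg i hi v hv))

/-- Over a compact set of coordinates and `s ∈ [0, 1]`, the two arguments of the slice sweep compact
sets avoiding the origin. Bounds on derivatives of `h` there, up to order `n + k`, control the order
`n` derivatives of the transform. -/
theorem continuous_regLinear (σ : ℤˣ) (c : ℂ) (k : ℕ) (lam : ℂ) (hk : -(2 * k : ℝ) < lam.re) :
    Continuous (regLinear σ c k lam hk) := by
  have hj' : ∀ f g : SmoothDeSitter, inChart (f - g).toFun = inChart f.toFun - inChart g.toFun :=
    fun _ _ => rfl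
  have hsub : ∀ f g, regLinear σ c k lam hk (f - g) =
      regLinear σ c k lam hk f - regLinear σ c k lam hk g := map_sub (regLinear σ c k lam hk)
  have sj' : ∀ f : SmoothDeSitter, ContDiffOn ℝ ∞ (inChart f.toFun) univ :=
    fun f => ContDiff.contDiffOn f.2
  refine continuous_of_derivBound (X := PrincipalSeries lam) (Y := SmoothDeSitter) (U := {0}ᶜ)
    (U' := univ) (j := PrincipalSeries.toFun) (j' := fun f => inChart f.toFun)
    (T := regLinear σ c k lam hk) isOpen_compl_singleton isOpen_univ (fun _ _ => rfl)
    hj' hsub (fun f => f.contDiffOn) sj' fun n K hK _ => ?_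
  set I : Set ((Fin 2 → ℝ) × ℝ) := K ×ˢ Icc (0 : ℝ) 1 with hI
  have hIc : IsCompact I := hK.prod isCompact_Icc
  have su₁ := contDiff_slice_arg₁ contDiff_lift σ
  have su₂ := contDiff_slice_arg₂ contDiff_lift σ
  obtain ⟨C₁, hC₁, hb₁⟩ := exists_derivBound_comp (U := ({0}ᶜ : Set Vec)) isOpen_compl_singleton
    su₁ (fun y => mulVec_ne_zero _ (vec_ne_zero₁ _)) hIc (n + k)
  obtain ⟨C₂, hC₂, hb₂⟩ := exists_derivBound_comp (U := ({0}ᶜ : Set Vec)) isOpen_compl_singleton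
    su₂ (fun y => mulVec_ne_zero _ (vec_ne_zero₂ _)) hIc (n + k)
  obtain ⟨C₃, hC₃, hb₃⟩ := exists_norm_iteratedFDeriv_mellinReg_le (V := Fin 2 → ℝ) k
    (neg_one_sub_lt_re hk)
  refine ⟨n + k, _ ∪ _, ‖c‖ * (C₃ * (C₁ + C₂)), (hIc.image su₁.continuous).union
    (hIc.image su₂.continuous), ?_, by positivity, fun h B hB hbd p hp => ?_⟩
  · rintro _ (⟨y, _, rfl⟩ | ⟨y, _, rfl⟩)
    · exact mulVec_ne_zero _ (vec_ne_zero₁ _)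
    · exact mulVec_ne_zero _ (vec_ne_zero₂ _)
  · have h₁ := hb₁ h.toFun B h.contDiffOn hB fun i hi v hv => hbd i hi v (Or.inl hv)
    have h₂ := hb₂ h.toFun B h.contDiffOn hB fun i hi v hv => hbd i hi v (Or.inr hv)
    have h₃ := h₁.add h₂
      (h.contDiffOn.comp_contDiff su₁ fun _ => mulVec_ne_zero _ (vec_ne_zero₁ _))
      (h.contDiffOn.comp_contDiff su₂ fun _ => mulVec_ne_zero _ (vec_ne_zero₂ _))
    have h₄ := hb₃ (contDiff_slice_family contDiff_lift σ h.contDiffOn) n p (C₁ * B + C₂ * B)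
      fun i hi y hy => h₃ i hi y ⟨by rw [show y.1 = p from hy.1]; exact hp, hy.2⟩
    rw [inChart_regLinear]
    have hle : (n : WithTop ℕ∞) ≤ ∞ := by exact_mod_cast le_top
    have h₅ : ContDiffAt ℝ n (fun p => mellinReg k (lam / 2 - 1) (slice σ (lift p) h.toFun)) p := by
      rw [← inChart_regFun]
      exact ((contDiff_inChart_regFun σ hk h).of_le hle).contDiffAt
    have h₆ := iteratedFDeriv_const_smul_apply' (a := c) h₅
    simp only [smul_eq_mul] at h₆
    rw [h₆, norm_smul, mul_assoc]
    refine mul_le_mul_of_nonneg_left ?_ (norm_nonneg c)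
    calc _ ≤ C₃ * (C₁ * B + C₂ * B) := h₄
      _ = _ := by ring

/-- The Poisson transform, regularized by `(λ/2) (λ/2 + 1) ⋯ (λ/2 + k - 1)` and multiplied by
`c`, for `Re λ > -2 k`. -/
def regOp (σ : ℤˣ) (c : ℂ) (k : ℕ) (lam : ℂ) : PrincipalSeries lam →L[ℂ] SmoothDeSitter :=
  if hk : -(2 * k : ℝ) < lam.re then
    ⟨regLinear σ c k lam hk, continuous_regLinear σ c k lam hk⟩ else 0

theorem regOp_toFun (σ : ℤˣ) (c : ℂ) {k : ℕ} (hk : -(2 * k : ℝ) < lam.re)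
    (h : PrincipalSeries lam) (A : deSitter) :
    (regOp σ c k lam h).toFun A =
      c * mellinReg k (lam / 2 - 1) (slice σ (lift (coords A)) h.toFun) := by
  rw [regOp, dif_pos hk]
  rfl

theorem inChart_regOp (σ : ℤˣ) (c : ℂ) {k : ℕ} (hk : -(2 * k : ℝ) < lam.re)
    (h : PrincipalSeries lam) : inChart (regOp σ c k lam h).toFun =
      fun p => c * mellinReg k (lam / 2 - 1) (slice σ (lift p) h.toFun) := by
  rw [regOp, dif_pos hk]
  exact inChart_regLinear σ c hk h

/-- `compactPicture` as a continuous linear map. -/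
def compactPictureL (lam : ℂ) : PrincipalSeries 0 →L[ℂ] PrincipalSeries lam where
  toFun := compactPicture lam
  map_add' φ ψ := Subtype.ext (funext fun v => mul_add _ (φ.toFun v) (ψ.toFun v))
  map_smul' c φ := Subtype.ext (funext fun v => mul_left_comm _ c (φ.toFun v))
  cont := by
    have ha : ContDiffOn ℝ ∞
        (fun v : Vec => ((v 0 ^ 2 + v 1 ^ 2 : ℝ) : ℂ) ^ (-lam / 2)) {0}ᶜ := by
      refine ContDiffOn.congr (f := fun v : Vec =>
        Complex.exp ((Real.log (v 0 ^ 2 + v 1 ^ 2) : ℂ) * (-lam / 2))) ?_ fun v hv =>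
          ofReal_cpow_eq_exp (normSq_pos hv) _
      exact ContDiffOn.cexp (ContDiffOn.mul
        (Complex.ofRealCLM.contDiff.comp_contDiffOn contDiff_log_normSq) contDiffOn_const)
    refine continuous_of_derivBound (U := {0}ᶜ) (U' := {0}ᶜ) (j := PrincipalSeries.toFun)
      (j' := PrincipalSeries.toFun) isOpen_compl_singleton isOpen_compl_singleton
      (fun _ _ => rfl) (fun _ _ => rfl)
      (fun f g => Subtype.ext (funext fun v => mul_sub _ (f.toFun v) (g.toFun v)))
      (fun f => f.contDiffOn) (fun f => f.contDiffOn) fun n K hK hKU => ?_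
    obtain ⟨C, hC, hb⟩ := exists_derivBound_mul isOpen_compl_singleton ha hK hKU n
    exact ⟨n, K, C, hK, hKU, hC, fun f B hB hf p hp => hb f.toFun B f.contDiffOn hB hf n le_rfl p hp⟩

/-- A family of functions on `dS²` that is smooth in all variables and satisfies the
Cauchy-Riemann equations in the parameter is holomorphic for the `C^∞` topology. -/
theorem holomorphicFamilyAt_of_smooth {T : ℂ → PrincipalSeries 0 → SmoothDeSitter} {Ω : Set ℂ}
    (hΩ : IsOpen Ω) {s₀ : ℂ} (hs₀ : s₀ ∈ Ω) {U : PrincipalSeries 0 → ℂ × (Fin 2 → ℝ) → ℂ}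
    (hT : ∀ φ, ∀ r ∈ Ω, inChart (T r φ).toFun = fun p => U φ (r, p))
    (hU : ∀ φ, ∀ r ∈ Ω, ∀ p, ContDiffAt ℝ ∞ (U φ) (r, p))
    (cU : ∀ φ, ∀ r ∈ Ω, ∀ p, IsCR (ContinuousLinearMap.inl ℝ ℂ (Fin 2 → ℝ)) (U φ) (r, p)) :
    HolomorphicFamilyAt T s₀ := by
  filter_upwards [hΩ.mem_nhds hs₀] with s hs φ
  have hder : ∀ p, HasDerivAt (fun z => U φ (z, p)) (fderiv ℝ (U φ) (s, p) (1, 0)) s := fun p =>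
    IsCR.hasDerivAt ((hU φ s hs p).differentiableAt (by simp)) (cU φ s hs p)
  -- Two coordinates of one point give the same function of `r` near `s`, so the complex derivatives
  -- agree and the candidate limit is a well-defined function on `dS²`.
  have hwell : ∀ p, fderiv ℝ (U φ) (s, coords ⟨chart p, chart_mem p⟩) (1, 0) =
      fderiv ℝ (U φ) (s, p) (1, 0) := by
    intro p
    refine ((hder (coords ⟨chart p, chart_mem p⟩)).congr_of_eventuallyEq ?_).unique (hder p) |>.symm
      |>.symm
    filter_upwards [hΩ.mem_nhds hs] with r hr
    rw [← congrFun (hT φ r hr) p, ← congrFun (hT φ r hr) (coords ⟨chart p, chart_mem p⟩)]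
    simp only [inChart, chart_coords]
  have hd : inChart (fun A => fderiv ℝ (U φ) (s, coords A) (1, 0)) =
      fun p => fderiv ℝ (U φ) (s, p) (1, 0) := funext hwell
  have hsm : ContDiff ℝ ∞ (inChart fun A => fderiv ℝ (U φ) (s, coords A) (1, 0)) := by
    rw [hd, contDiff_iff_contDiffAt]
    intro p
    have h1 : ContDiffAt ℝ ∞ (fderiv ℝ (U φ)) (s, p) := (hU φ s hs p).fderiv_right (by simp)
    exact (h1.comp (f := fun p : Fin 2 → ℝ => (s, p)) p
      (contDiffAt_const.prodMk contDiffAt_id)).clm_apply contDiffAt_const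
  refine ⟨⟨_, hsm⟩, ?_⟩
  refine (tendsto_smoothTopology_iff univ (fun f : SmoothDeSitter => inChart f.toFun) _ _ _).2
    fun n K hK _ => ?_
  change TendstoUniformlyOn _ (iteratedFDeriv ℝ n
    (inChart fun A => fderiv ℝ (U φ) (s, coords A) (1, 0))) _ _
  rw [hd]
  refine (tendstoUniformlyOn_iteratedFDeriv_diffQuot hΩ hs hK n (hU φ) (cU φ)).congr ?_
  filter_upwards [mem_nhdsWithin_of_mem_nhds (hΩ.mem_nhds hs)] with r hr p _
  have : (fun p => (r - s)⁻¹ • (U φ (r, p) - U φ (s, p))) =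
      inChart ((r - s)⁻¹ • (T r φ - T s φ)).toFun := by
    ext p
    rw [← congrFun (hT φ r hr) p, ← congrFun (hT φ s hs) p]
    rfl
  simp only [this]

/-- Multiples of the regularized Poisson transforms by holomorphic functions are holomorphic. -/
theorem holomorphicFamilyAt_regOp (σ : ℤˣ) (k : ℕ) {c : ℂ → ℂ} {Ω : Set ℂ} (hΩ : IsOpen Ω)
    (hc : DifferentiableOn ℂ c Ω) (hk : ∀ s ∈ Ω, -(2 * k : ℝ) < s.re) {s₀ : ℂ} (hs₀ : s₀ ∈ Ω) :
    HolomorphicFamilyAt (fun s φ => regOp σ (c s) k s (compactPicture s φ)) s₀ := by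
  have hcs : ∀ r ∈ Ω, ∀ p : Fin 2 → ℝ,
      ContDiffAt ℝ ∞ (fun x : ℂ × (Fin 2 → ℝ) => c x.1) (r, p) := by
    intro r hr p
    have h1 : ContDiffAt ℂ ∞ c r := (hc.analyticAt (hΩ.mem_nhds hr)).contDiffAt
    exact (h1.restrict_scalars ℝ).comp (f := fun x : ℂ × (Fin 2 → ℝ) => x.1) (r, p) contDiffAt_fst
  have hR : ∀ (φ : PrincipalSeries 0), ∀ r ∈ Ω, ∀ p : Fin 2 → ℝ, _ := fun φ r hr p =>
    contDiffAt_mellinReg_slice contDiff_lift σ φ k (x := (r, p)) (hk r hr)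
  refine holomorphicFamilyAt_of_smooth hΩ hs₀ (U := fun φ x => c x.1 *
    mellinReg k (x.1 / 2 - 1) (slice σ (lift x.2) (compactPicture x.1 φ).toFun))
    (fun φ r hr => inChart_regOp σ (c r) (hk r hr) _)
    (fun φ r hr p => (hcs r hr p).mul (hR φ r hr p)) fun φ r hr p => ?_
  refine IsCR.mul (isCR_of_differentiableAt ((hcs r hr p).differentiableAt (by simp)) ?_)
    (isCR_mellinReg_slice contDiff_lift σ φ k (x := (r, p)) (hk r hr))
    ((hcs r hr p).differentiableAt (by simp)) ((hR φ r hr p).differentiableAt (by simp))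
  simp only [ContinuousLinearMap.inl_apply, Prod.fst_add]
  refine DifferentiableAt.comp (g := c) (f := fun z : ℂ => r + z) 0 ?_ (by fun_prop)
  simpa using hc.differentiableAt (hΩ.mem_nhds hr)

/-- The Poisson transform with kernel `q_σ ^ (λ/2 - 1)`; its value at the poles is `0`. -/
def poissonOp (σ : ℤˣ) (lam : ℂ) : PrincipalSeries lam →L[ℂ] SmoothDeSitter :=
  open Classical in
  if lam ∈ poles then 0 else
    regOp σ (shiftedFactorial (exists_nat_neg_two_mul_lt lam).choose (lam / 2 - 1))⁻¹
      (exists_nat_neg_two_mul_lt lam).choose lam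

theorem poissonOp_toFun (σ : ℤˣ) (hlam : lam ∉ poles) (h : PrincipalSeries lam) (A : deSitter) :
    (poissonOp σ lam h).toFun A =
      mellinCont (lam / 2 - 1) (slice σ (lift (coords A)) h.toFun) := by
  rw [poissonOp, if_neg hlam, regOp_toFun σ _ (exists_nat_neg_two_mul_lt lam).choose_spec,
    mellinCont_slice_eq (exists_nat_neg_two_mul_lt lam).choose_spec hlam]

theorem poissonOp_eq_regOp (σ : ℤˣ) (hlam : lam ∉ poles) {k : ℕ} (hk : -(2 * k : ℝ) < lam.re) :
    poissonOp σ lam = regOp σ (shiftedFactorial k (lam / 2 - 1))⁻¹ k lam := by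
  ext h
  refine Subtype.ext (funext fun A => ?_)
  change (poissonOp σ lam h).toFun A = (regOp σ _ k lam h).toFun A
  rw [poissonOp_toFun σ hlam, regOp_toFun σ _ hk, mellinCont_slice_eq hk hlam]

theorem poissonOp_toFun_act (σ : ℤˣ) (hlam : lam ∉ poles) (h : PrincipalSeries lam) (g : SL2) :
    (poissonOp σ lam h).toFun (act g basePoint) =
      mellinCont (lam / 2 - 1) (slice σ g h.toFun) := by
  rw [poissonOp_toFun σ hlam]
  exact mellinCont_slice_eq_of_act_eq hlam σ (act_lift_coords _) h

theorem inChart_poissonOp (σ : ℤˣ) (hlam : lam ∉ poles) (h : PrincipalSeries lam)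
    (p : Fin 2 → ℝ) : inChart (poissonOp σ lam h).toFun p =
      mellinCont (lam / 2 - 1) (slice σ (lift p) h.toFun) := by
  rw [inChart, poissonOp_toFun σ hlam, slice_lift_coords_chart]

theorem HolomorphicFamilyAt.congr {T T' : ℂ → PrincipalSeries 0 → SmoothDeSitter} {s₀ : ℂ}
    (hT : HolomorphicFamilyAt T s₀) (h : ∀ᶠ s in 𝓝 s₀, T' s = T s) :
    HolomorphicFamilyAt T' s₀ := by
  filter_upwards [hT, h.eventually_nhds] with s hs he φ
  obtain ⟨d, hd⟩ := hs φ
  refine ⟨d, hd.congr' ?_⟩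
  filter_upwards [mem_nhdsWithin_of_mem_nhds he] with r hr
  rw [hr, he.self_of_nhds]

theorem isOpen_re_gt (a : ℝ) : IsOpen {s : ℂ | a < s.re} :=
  isOpen_lt continuous_const Complex.continuous_re

theorem holomorphicFamilyAt_poissonOp (σ : ℤˣ) (hlam : lam ∉ poles) :
    HolomorphicFamilyAt (fun s φ => poissonOp σ s (compactPicture s φ)) lam := by
  obtain ⟨k, hk⟩ := exists_nat_neg_two_mul_lt lam
  have hΩ : IsOpen ({s : ℂ | -(2 * k : ℝ) < s.re} ∩ polesᶜ) :=
    (isOpen_re_gt _).inter isOpen_compl_poles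
  refine (holomorphicFamilyAt_regOp σ k
    (c := fun s => (shiftedFactorial k (s / 2 - 1))⁻¹) hΩ (fun s hs =>
      (differentiableAt_inv_shiftedFactorial k hs.2).differentiableWithinAt)
    (fun s hs => hs.1) ⟨hk, hlam⟩).congr ?_
  filter_upwards [hΩ.mem_nhds ⟨hk, hlam⟩] with s hs
  funext φ
  rw [poissonOp_eq_regOp σ hs.2 hs.1]

/-- Only finitely many poles lie in a half plane `Re λ > -2 k`. -/
theorem eventually_notMem_poles (lam : ℂ) : ∀ᶠ s in 𝓝[≠] lam, s ∉ poles := by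
  obtain ⟨k, hk⟩ := exists_nat_neg_two_mul_lt lam
  have hfin : ((fun j : ℕ => -2 * (j : ℂ)) '' (Finset.range k : Set ℕ)).Finite :=
    (Finset.finite_toSet _).image _
  have h1 : ∀ᶠ s in 𝓝[≠] lam, s ∉ (fun j : ℕ => -2 * (j : ℂ)) '' (Finset.range k : Set ℕ) := by
    -- The point `lam` is itself removed from the finite set, since it may be a pole.
    have h2 := (hfin.subset (sdiff_subset (t := {lam}))).isClosed.isOpen_compl.mem_nhds
      (x := lam) (by simp)
    filter_upwards [mem_nhdsWithin_of_mem_nhds h2, self_mem_nhdsWithin] with s hs hne hs'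
    exact hs ⟨hs', hne⟩
  filter_upwards [h1, mem_nhdsWithin_of_mem_nhds ((isOpen_re_gt _).mem_nhds hk)] with s hs hre
  rintro ⟨j, rfl⟩
  refine hs ⟨j, ?_, rfl⟩
  have h3 : -(2 * k : ℝ) < (-2 * (j : ℂ)).re := hre
  simp only [Complex.mul_re, Complex.neg_re, Complex.re_ofNat, Complex.natCast_re,
    Complex.neg_im, Complex.im_ofNat, Complex.natCast_im] at h3
  have : (j : ℝ) < k := by linarith
  exact Finset.mem_coe.2 (Finset.mem_range.2 (by exact_mod_cast this))

/-- The zeros of `shiftedFactorial k (λ / 2 - 1)` are simple, so one factor `s - lam` suffices at a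
pole and none elsewhere. -/
theorem meromorphicFamilyAt_poissonOp (σ : ℤˣ) (lam : ℂ) :
    MeromorphicFamilyAt (fun s φ => poissonOp σ s (compactPicture s φ)) lam := by
  obtain ⟨k, hk⟩ := exists_nat_neg_two_mul_lt lam
  by_cases hlam : lam ∈ poles
  · obtain ⟨m, rfl⟩ := hlam
    have hm : m ∈ Finset.range k := by
      simp only [Complex.mul_re, Complex.neg_re, Complex.re_ofNat, Complex.natCast_re,
        Complex.neg_im, Complex.im_ofNat, Complex.natCast_im] at hk
      have : (m : ℝ) < k := by linarith
      exact Finset.mem_range.2 (by exact_mod_cast this)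
    -- The product without its factor `j = m`. The omitted factor is `s / 2 + m = (s + 2 m) / 2`,
    -- which explains the coefficient `2 * (e s)⁻¹` of the extended family.
    set e : ℂ → ℂ := fun s => ∏ j ∈ (Finset.range k).erase m, (s / 2 - 1 + 1 + j) with he
    have hed : Differentiable ℂ e := by
      rw [he]
      fun_prop
    have hfac : ∀ s : ℂ, shiftedFactorial k (s / 2 - 1) = (s - -2 * m) / 2 * e s := by
      intro s
      rw [shiftedFactorial, ← Finset.mul_prod_erase _ _ hm]
      congr 1
      ring
    have hne : e (-2 * m) ≠ 0 := by
      refine Finset.prod_ne_zero_iff.2 fun j hj h => ?_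
      have h1 : (j : ℂ) = m := by linear_combination h
      exact (Finset.mem_erase.1 hj).1 (by exact_mod_cast h1)
    have hΩ : IsOpen ({s : ℂ | -(2 * k : ℝ) < s.re} ∩ {s | e s ≠ 0}) :=
      (isOpen_re_gt _).inter (isOpen_ne_fun hed.continuous continuous_const)
    refine ⟨1, fun s => (regOp σ (2 * (e s)⁻¹) k s).comp (compactPictureL s),
      holomorphicFamilyAt_regOp σ k (c := fun s => 2 * (e s)⁻¹) hΩ (fun s hs =>
        (((hed s).inv hs.2).const_mul 2).differentiableWithinAt) (fun s hs => hs.1) ⟨hk, hne⟩, ?_⟩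
    filter_upwards [eventually_notMem_poles _, mem_nhdsWithin_of_mem_nhds (hΩ.mem_nhds ⟨hk, hne⟩),
      self_mem_nhdsWithin] with s hs hs' hne' φ
    rw [poissonOp_eq_regOp σ hs hs'.1]
    refine Subtype.ext (funext fun A => ?_)
    change (s - -2 * m) ^ 1 * (regOp σ _ k s (compactPicture s φ)).toFun A =
      (regOp σ _ k s (compactPicture s φ)).toFun A
    rw [regOp_toFun σ _ hs'.1, regOp_toFun σ _ hs'.1, hfac]
    have h1 : s - -2 * m ≠ 0 := sub_ne_zero.2 hne'
    have h2 : e s ≠ 0 := hs'.2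
    generalize mellinReg k (s / 2 - 1) _ = R
    generalize s - -2 * (m : ℂ) = x at h1 ⊢
    field_simp
  · refine ⟨0, fun s => (poissonOp σ s).comp (compactPictureL s),
      holomorphicFamilyAt_poissonOp σ hlam, Eventually.of_forall fun s φ => ?_⟩
    rw [pow_zero, one_smul]
    rfl

theorem act_mul (g g' : SL2) (A : deSitter) : act g (act g' A) = act (g * g') A := by
  have hof : ∀ M : Matrix (Fin 2) (Fin 2) ℝ, M 0 0 + M 1 1 = 0 → toMat (ofMat M) = M := by
    intro M hM
    ext i j
    fin_cases i <;> fin_cases j <;> simp [toMat, ofMat] <;> linarith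
  -- The passage through coordinates loses nothing on trace-free matrices, and conjugation preserves
  -- the trace.
  have htr : (g'.1 * toMat A.1 * (g'⁻¹).1) 0 0 + (g'.1 * toMat A.1 * (g'⁻¹).1) 1 1 = 0 := by
    rw [← Matrix.trace_fin_two, Matrix.trace_mul_comm, ← mul_assoc,
      ← Matrix.SpecialLinearGroup.coe_mul, inv_mul_cancel]
    simp [toMat, Matrix.trace_fin_two]
  refine Subtype.ext ?_
  simp only [act]
  rw [hof _ htr, mul_inv_rev, Matrix.SpecialLinearGroup.coe_mul, Matrix.SpecialLinearGroup.coe_mul]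
  simp only [mul_assoc]

/-- The slice of the translated section along `γ` is the slice of `h` along `g⁻¹ γ`. Independence of
the representative of a point does the rest. -/
theorem poissonOp_rho (σ : ℤˣ) (hlam : lam ∉ poles) (g : SL2) (h : PrincipalSeries lam)
    (A : deSitter) :
    (poissonOp σ lam (rho lam g h)).toFun A = (poissonOp σ lam h).toFun (act g⁻¹ A) := by
  rw [← act_lift_coords A, act_mul, poissonOp_toFun_act σ hlam, poissonOp_toFun_act σ hlam]
  congr 1
  ext s
  simp only [slice, Matrix.SpecialLinearGroup.coe_mul, ← Matrix.mulVec_mulVec]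
  rfl

end Operators

/-! ### The Laplacian of `dS²` in the coordinates `(t, θ)` -/

section Laplacian

/-- The partial derivative in the coordinate `i`. -/
def partialDeriv (i : Fin 2) (u : (Fin 2 → ℝ) → ℂ) (p : Fin 2 → ℝ) : ℂ :=
  fderiv ℝ u p (Pi.single i 1)

theorem contDiff_chart : ContDiff ℝ ∞ chart := by
  rw [contDiff_pi]
  intro i
  fin_cases i <;> simp [chart] <;> fun_prop

theorem fderiv_chart_zero (p : Fin 2 → ℝ) : fderiv ℝ chart p (Pi.single 0 1) =
    ![Real.sinh (p 0) * Real.cos (p 1), Real.sinh (p 0) * Real.sin (p 1), Real.cosh (p 0)] := by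
  have hl : HasDerivAt (fun s : ℝ => p + s • (Pi.single 0 1 : Fin 2 → ℝ)) (Pi.single 0 1) 0 := by
    simpa using ((hasDerivAt_id (0 : ℝ)).smul_const (Pi.single 0 1 : Fin 2 → ℝ)).const_add p
  have h1 : HasDerivAt (fun s : ℝ => chart (p + s • (Pi.single 0 1 : Fin 2 → ℝ)))
      (fderiv ℝ chart p (Pi.single 0 1)) 0 := by
    refine HasFDerivAt.comp_hasDerivAt (l := chart) (0 : ℝ) ?_ hl
    simpa using (contDiff_chart.differentiable (by simp) p).hasFDerivAt
  have hs : HasDerivAt (fun s : ℝ => p 0 + s) 1 0 := by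
    simpa using (hasDerivAt_id (0 : ℝ)).const_add (p 0)
  refine h1.unique (hasDerivAt_pi.2 fun i => ?_)
  fin_cases i
  · simpa [chart] using (hs.cosh).mul_const (Real.cos (p 1))
  · simpa [chart] using (hs.cosh).mul_const (Real.sin (p 1))
  · simpa [chart] using hs.sinh

theorem fderiv_chart_one (p : Fin 2 → ℝ) : fderiv ℝ chart p (Pi.single 1 1) =
    ![-(Real.cosh (p 0) * Real.sin (p 1)), Real.cosh (p 0) * Real.cos (p 1), 0] := by
  have hl : HasDerivAt (fun s : ℝ => p + s • (Pi.single 1 1 : Fin 2 → ℝ)) (Pi.single 1 1) 0 := by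
    simpa using ((hasDerivAt_id (0 : ℝ)).smul_const (Pi.single 1 1 : Fin 2 → ℝ)).const_add p
  have h1 : HasDerivAt (fun s : ℝ => chart (p + s • (Pi.single 1 1 : Fin 2 → ℝ)))
      (fderiv ℝ chart p (Pi.single 1 1)) 0 := by
    refine HasFDerivAt.comp_hasDerivAt (l := chart) (0 : ℝ) ?_ hl
    simpa using (contDiff_chart.differentiable (by simp) p).hasFDerivAt
  have hs : HasDerivAt (fun s : ℝ => p 1 + s) 1 0 := by
    simpa using (hasDerivAt_id (0 : ℝ)).const_add (p 1)
  refine h1.unique (hasDerivAt_pi.2 fun i => ?_)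
  fin_cases i
  · simpa [chart] using (hs.cos).const_mul (Real.cosh (p 0))
  · simpa [chart] using (hs.sin).const_mul (Real.cosh (p 0))
  · simpa [chart] using hasDerivAt_const (0 : ℝ) (Real.sinh (p 0))

theorem inducedMetric_eq (p : Fin 2 → ℝ) :
    inducedMetric p = !![-1, 0; 0, Real.cosh (p 0) ^ 2] := by
  have h1 := Real.cosh_sq (p 0)
  have h2 := Real.sin_sq_add_cos_sq (p 1)
  ext i j
  fin_cases i <;> fin_cases j <;>
    simp [inducedMetric, minkowski, fderiv_chart_zero, fderiv_chart_one]
  · linear_combination Real.sinh (p 0) ^ 2 * h2 - h1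
  · ring
  · ring
  · linear_combination Real.cosh (p 0) ^ 2 * h2

theorem sqrt_abs_det_inducedMetric (p : Fin 2 → ℝ) :
    √|(inducedMetric p).det| = Real.cosh (p 0) := by
  rw [inducedMetric_eq, Matrix.det_fin_two_of]
  have : |(-1 : ℝ) * Real.cosh (p 0) ^ 2 - 0 * 0| = Real.cosh (p 0) ^ 2 := by
    rw [show (-1 : ℝ) * Real.cosh (p 0) ^ 2 - 0 * 0 = -Real.cosh (p 0) ^ 2 by ring, abs_neg,
      abs_of_nonneg (sq_nonneg _)]
  rw [this, Real.sqrt_sq (Real.cosh_pos _).le]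

theorem inv_inducedMetric (p : Fin 2 → ℝ) :
    (inducedMetric p)⁻¹ = !![-1, 0; 0, (Real.cosh (p 0) ^ 2)⁻¹] := by
  have hc : Real.cosh (p 0) ^ 2 ≠ 0 := pow_ne_zero 2 (Real.cosh_pos _).ne'
  refine Matrix.inv_eq_right_inv ?_
  rw [inducedMetric_eq]
  ext i j
  fin_cases i <;> fin_cases j <;> simp [Matrix.mul_apply, Fin.sum_univ_two, hc]

theorem contDiff_partialDeriv {u : (Fin 2 → ℝ) → ℂ} (hu : ContDiff ℝ ∞ u) (i : Fin 2) :
    ContDiff ℝ ∞ (partialDeriv i u) := contDiff_fderiv_apply_const hu _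

/-- The Laplacian of `dS²` in the coordinates `(t, θ)`. -/
theorem laplaceBeltrami_inducedMetric {u : (Fin 2 → ℝ) → ℂ} (hu : ContDiff ℝ ∞ u)
    (p : Fin 2 → ℝ) : laplaceBeltrami inducedMetric u p =
      -partialDeriv 0 (partialDeriv 0 u) p -
        (Real.sinh (p 0) / Real.cosh (p 0) : ℝ) * partialDeriv 0 u p +
        ((Real.cosh (p 0) ^ 2)⁻¹ : ℝ) * partialDeriv 1 (partialDeriv 1 u) p := by
  have hc : ∀ q : Fin 2 → ℝ, Real.cosh (q 0) ≠ 0 := fun q => (Real.cosh_pos _).ne'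
  have d0 := ((contDiff_partialDeriv hu 0).differentiable (by simp) p).hasFDerivAt
  have d1 := ((contDiff_partialDeriv hu 1).differentiable (by simp) p).hasFDerivAt
  have hpr : HasFDerivAt (fun q : Fin 2 → ℝ => q 0)
      (ContinuousLinearMap.proj (R := ℝ) (φ := fun _ : Fin 2 => ℝ) 0) p :=
    (ContinuousLinearMap.proj (R := ℝ) (φ := fun _ : Fin 2 => ℝ) 0).hasFDerivAt
  have e0 : HasFDerivAt (fun q : Fin 2 → ℝ => ((-Real.cosh (q 0) : ℝ) : ℂ)) _ p :=
    Complex.ofRealCLM.hasFDerivAt.comp p hpr.cosh.neg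
  have e1 : HasFDerivAt (fun q : Fin 2 → ℝ => (((Real.cosh (q 0))⁻¹ : ℝ) : ℂ)) _ p :=
    Complex.ofRealCLM.hasFDerivAt.comp p
      ((hasDerivAt_inv (hc p)).comp_hasFDerivAt p hpr.cosh)
  have h00 : fderiv ℝ (fun q => ((-Real.cosh (q 0) : ℝ) : ℂ) * partialDeriv 0 u q) p
      (Pi.single 0 1) = -(Real.cosh (p 0) : ℂ) * partialDeriv 0 (partialDeriv 0 u) p -
        (Real.sinh (p 0) : ℂ) * partialDeriv 0 u p := by
    rw [(e0.fun_mul d0).fderiv]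
    simp [partialDeriv]
    ring
  have h11 : fderiv ℝ (fun q => (((Real.cosh (q 0))⁻¹ : ℝ) : ℂ) * partialDeriv 1 u q) p
      (Pi.single 1 1) = ((Real.cosh (p 0) : ℂ))⁻¹ * partialDeriv 1 (partialDeriv 1 u) p := by
    rw [(e1.fun_mul d1).fderiv]
    simp [partialDeriv]
  have hcc : (Real.cosh (p 0) : ℂ) ≠ 0 := by exact_mod_cast hc p
  have hcoef : ∀ q : Fin 2 → ℝ, Real.cosh (q 0) * (Real.cosh (q 0) ^ 2)⁻¹ = (Real.cosh (q 0))⁻¹ :=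
    fun q => by
      have := hc q
      field_simp
  simp only [laplaceBeltrami, sqrt_abs_det_inducedMetric, inv_inducedMetric, Fin.sum_univ_two,
    Matrix.of_apply, Matrix.cons_val', Matrix.cons_val_zero, Matrix.cons_val_one,
    Matrix.cons_val_fin_one, mul_zero, Complex.ofReal_zero, zero_mul, fderiv_fun_const,
    hcoef, mul_neg_one]
  change (Real.cosh (p 0) : ℂ)⁻¹ * (fderiv ℝ (fun q => ((-Real.cosh (q 0) : ℝ) : ℂ) *
    partialDeriv 0 u q) p (Pi.single 0 1) + 0 + (0 + fderiv ℝ (fun q =>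
      (((Real.cosh (q 0))⁻¹ : ℝ) : ℂ) * partialDeriv 1 u q) p (Pi.single 1 1))) = _
  rw [h00, h11]
  push_cast at hcc ⊢
  field_simp
  ring

end Laplacian

/-! ### Calculus of the one-sided powers -/

section PowerKernel

theorem signPow_of_pos {σ : ℤˣ} {t : ℝ} (h : 0 < signReal σ * t) (μ : ℂ) :
    signPow σ t μ = ((signReal σ * t : ℝ) : ℂ) ^ μ := if_pos h

theorem signPow_of_nonpos {σ : ℤˣ} {t : ℝ} (h : signReal σ * t ≤ 0) (μ : ℂ) :
    signPow σ t μ = 0 := if_neg h.not_gt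

theorem continuous_signPow (σ : ℤˣ) {μ : ℂ} (hμ : 0 < μ.re) :
    Continuous fun t => signPow σ t μ := by
  -- Truncating the base at `0` removes the case distinction, as `0 ^ μ = 0` for `Re μ > 0`.
  have h : (fun t => signPow σ t μ) = fun t => ((max (signReal σ * t) 0 : ℝ) : ℂ) ^ μ := by
    ext t
    rcases lt_or_ge 0 (signReal σ * t) with ht | ht
    · rw [max_eq_left ht.le, signPow_of_pos ht]
    · rw [max_eq_right ht, signPow_of_nonpos ht, Complex.ofReal_zero,
        Complex.zero_cpow (fun h => by simp [h] at hμ)]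
  rw [h, continuous_iff_continuousAt]
  intro t
  exact ContinuousAt.comp (g := fun x : ℝ => (x : ℂ) ^ μ) (f := fun t => max (signReal σ * t) 0)
    (Complex.continuousAt_ofReal_cpow_const _ μ (Or.inl hμ)) (by fun_prop)

/-- On the support, `t = σ (σ t)`. The rule raises exponents again after differentiation has lowered
them. -/
theorem signPow_mul_self (σ : ℤˣ) (t : ℝ) (μ : ℂ) :
    (t : ℂ) * signPow σ t μ = signReal σ * signPow σ t (μ + 1) := by
  rcases lt_or_ge 0 (signReal σ * t) with ht | ht
  · rw [signPow_of_pos ht, signPow_of_pos ht, Complex.cpow_add _ _ (by exact_mod_cast ht.ne'), Complex.cpow_one]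
    have h1 : (signReal σ : ℂ) * signReal σ = 1 := by exact_mod_cast signReal_mul_self σ
    push_cast
    linear_combination (-(t : ℂ) * ((signReal σ : ℂ) * t) ^ μ) * h1
  · simp [signPow_of_nonpos ht]

theorem hasDerivAt_signPow (σ : ℤˣ) {μ : ℂ} (hμ : 1 < μ.re) (t : ℝ) :
    HasDerivAt (fun t => signPow σ t μ) (signReal σ * μ * signPow σ t (μ - 1)) t := by
  have hlin : HasDerivAt (fun t : ℝ => signReal σ * t) (signReal σ) t := by
    simpa using (hasDerivAt_id t).const_mul (signReal σ)
  rcases lt_trichotomy (signReal σ * t) 0 with h | h | h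
  · have hev : ∀ᶠ s in 𝓝 t, signReal σ * s < 0 := hlin.continuousAt.eventually (gt_mem_nhds h)
    have h0 := signPow_of_nonpos h.le (μ - 1)
    rw [h0, mul_zero]
    refine (hasDerivAt_const t (0 : ℂ)).congr_of_eventuallyEq (hev.mono fun s hs => ?_)
    exact signPow_of_nonpos hs.le μ
  · have ht : t = 0 := by
      rcases mul_eq_zero.1 h with h' | h'
      · exact absurd h' (signReal_ne_zero σ)
      · exact h'
    subst ht
    have h0 : signPow σ 0 (μ - 1) = 0 := by simp [signPow]
    have h1 : signPow σ 0 μ = 0 := by simp [signPow]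
    rw [h0, mul_zero, hasDerivAt_iff_tendsto_slope]
    -- The slope at `0` is `σ` times the power with exponent `μ - 1`, which tends to `0` because `Re
    -- μ > 1`.
    have hcont : Tendsto (fun s => signReal σ * signPow σ s (μ - 1)) (𝓝[≠] 0) (𝓝 0) := by
      have h2 := (continuous_signPow σ (μ := μ - 1) (by simpa using hμ)).tendsto 0
      rw [h0] at h2
      simpa using (h2.mono_left nhdsWithin_le_nhds).const_mul (signReal σ : ℂ)
    refine hcont.congr' ?_
    filter_upwards [self_mem_nhdsWithin] with s hs
    have hs' : (s : ℂ) ≠ 0 := by exact_mod_cast hs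
    have h3 := signPow_mul_self σ s (μ - 1)
    have h4 : (signReal σ : ℂ) * signReal σ = 1 := by exact_mod_cast signReal_mul_self σ
    rw [sub_add_cancel] at h3
    rw [slope_def_module, h1, sub_zero, sub_zero, Complex.real_smul, Complex.ofReal_inv]
    field_simp
    linear_combination (signReal σ : ℂ) * h3 + signPow σ s μ * h4
  · have hev : ∀ᶠ s in 𝓝 t, 0 < signReal σ * s := hlin.continuousAt.eventually (lt_mem_nhds h)
    have h1 : HasDerivAt (fun x : ℝ => (x : ℂ) ^ μ) (μ * ((signReal σ * t : ℝ) : ℂ) ^ (μ - 1))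
        (signReal σ * t) :=
      hasDerivAt_ofReal_cpow_const h.ne' (fun h => by norm_num [h] at hμ)
    have h2 := h1.scomp t hlin
    rw [signPow_of_pos h]
    refine (h2.congr_deriv ?_).congr_of_eventuallyEq (hev.mono fun s hs => ?_)
    · rw [Complex.real_smul]
      ring
    · exact signPow_of_pos hs μ

theorem contDiff_signPow (σ : ℤˣ) {μ : ℂ} (hμ : 1 < μ.re) :
    ContDiff ℝ 1 fun t => signPow σ t μ := by
  rw [contDiff_one_iff_deriv]
  refine ⟨fun t => (hasDerivAt_signPow σ hμ t).differentiableAt, ?_⟩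
  have : deriv (fun t => signPow σ t μ) = fun t => signReal σ * μ * signPow σ t (μ - 1) :=
    funext fun t => (hasDerivAt_signPow σ hμ t).deriv
  rw [this]
  exact continuous_const.mul (continuous_signPow σ (by simpa using hμ))

end PowerKernel

/-! ### Differentiation of integrals of one-sided powers -/

section PowerIntegral

variable {V : Type} [NormedAddCommGroup V] [NormedSpace ℝ V]

/-- The integral over `(0, 1)` of the power `Q ^ μ` against `a`. -/
def powIntegral (σ : ℤˣ) (Q : V × ℝ → ℝ) (μ : ℂ) (a : V × ℝ → ℂ) (p : V) : ℂ :=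
  mellinLog 0 0 fun s => signPow σ (Q (p, s)) μ * a (p, s)

omit [NormedAddCommGroup V] [NormedSpace ℝ V] in
theorem powIntegral_eq (σ : ℤˣ) (Q : V × ℝ → ℝ) (μ : ℂ) (a : V × ℝ → ℂ) (p : V) :
    powIntegral σ Q μ a p = ∫ s in (0 : ℝ)..1, signPow σ (Q (p, s)) μ * a (p, s) := by
  simp [powIntegral, mellinLog, logPow]

/-- For `Re μ > 1` the kernel is `C¹`, so the theorem on parametric Mellin transforms applies with
the trivial weight `s ^ 0`; the product rule gives the two terms. -/
theorem fderiv_powIntegral [ProperSpace V] (σ : ℤˣ) {Q : V × ℝ → ℝ} (hQ : ContDiff ℝ ∞ Q) {μ : ℂ}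
    (hμ : 1 < μ.re) {a : V × ℝ → ℂ} (ha : ContDiff ℝ ∞ a) (p v : V) :
    fderiv ℝ (powIntegral σ Q μ a) p v =
      powIntegral σ Q (μ - 1) (fun y => signReal σ * μ * fderiv ℝ Q y (v, 0) * a y) p +
        powIntegral σ Q μ (fun y => fderiv ℝ a y (v, 0)) p := by
  have hH : ContDiff ℝ 1 fun y => signPow σ (Q y) μ * a y :=
    ((contDiff_signPow σ hμ).comp (hQ.of_le (by simp))).mul (ha.of_le (by simp))
  have h0 : (-1 : ℝ) < (0 : ℂ).re := by simp
  have h1 := hasFDerivAt_mellinLog_const h0 hH p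
  have hsl : Continuous fun s : ℝ => (p, s) := by fun_prop
  have hint := intervalIntegrable_logPow_smul 0 h0
    ((contDiff_paramDeriv (m := 0) hH (by simp)).continuous.comp hsl)
  have h2 : fderiv ℝ (powIntegral σ Q μ a) p v = ∫ s in (0 : ℝ)..1,
      paramDeriv (fun y => signPow σ (Q y) μ * a y) (p, s) v := by
    have h3 : fderiv ℝ (powIntegral σ Q μ a) p = _ := h1.fderiv
    rw [h3, mellinLog]
    erw [ContinuousLinearMap.intervalIntegral_apply hint]
    simp [logPow]
  have hQd : Continuous fun s : ℝ => fderiv ℝ Q (p, s) (v, 0) :=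
    (contDiff_fderiv_apply_const hQ (v, 0)).continuous.comp hsl
  have had : Continuous fun s : ℝ => fderiv ℝ a (p, s) (v, 0) :=
    (contDiff_fderiv_apply_const ha (v, 0)).continuous.comp hsl
  have hT : ∀ {μ : ℂ}, 0 < μ.re → Continuous fun s : ℝ => signPow σ (Q (p, s)) μ := fun hμ =>
    (continuous_signPow σ hμ).comp (hQ.continuous.comp hsl)
  rw [h2, powIntegral_eq, powIntegral_eq, ← intervalIntegral.integral_add]
  · refine intervalIntegral.integral_congr fun s _ => ?_
    have hq : HasFDerivAt (fun y => signPow σ (Q y) μ) _ (p, s) :=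
      (hasDerivAt_signPow σ hμ (Q (p, s))).hasFDerivAt.comp (p, s)
        (hQ.differentiable (by simp) (p, s)).hasFDerivAt
    have h4 := (hq.fun_mul (ha.differentiable (by simp) (p, s)).hasFDerivAt).fderiv
    simp only [paramDeriv]
    rw [h4]
    simp
    ring
  · refine Continuous.intervalIntegrable ?_ _ _
    exact (hT (by simpa using hμ)).mul ((continuous_const.mul
      (Complex.continuous_ofReal.comp hQd)).mul (ha.continuous.comp hsl))
  · exact ((hT (by linarith)).mul had).intervalIntegrable _ _

end PowerIntegral

/-! ### The half-circle model and the eigenvalue equation for large `Re λ` -/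

section CircleModel

/-- A point of the upper half circle, on the line through `(-cot (π s), 1)`. -/
def circleVec (s : ℝ) : Vec := ![-Real.cos (Real.pi * s), Real.sin (Real.pi * s)]

theorem circleVec_ne_zero (s : ℝ) : circleVec s ≠ 0 := fun h => by
  have h0 : -Real.cos (Real.pi * s) = 0 := congrFun h 0
  have h1 : Real.sin (Real.pi * s) = 0 := congrFun h 1
  have h2 := Real.sin_sq_add_cos_sq (Real.pi * s)
  rw [h1, neg_eq_zero.1 h0] at h2
  norm_num at h2

theorem contDiff_circleVec : ContDiff ℝ ∞ circleVec := by
  rw [contDiff_pi]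
  intro i
  fin_cases i <;> simp [circleVec] <;> fun_prop

/-- Substitute `ζ = -cot (π s)`, whose Jacobian `π / sin² (π s)` is absorbed by homogeneity of
degree `-2`. The domain becomes compact, and the section no longer depends on the point of `dS²`. -/
theorem integral_bruhat_eq_integral_circle {f : Vec → ℂ}
    (hf : ∀ t : ℝ, t ≠ 0 → ∀ v : Vec, v ≠ 0 → f (t • v) = (((t ^ 2)⁻¹ : ℝ) : ℂ) * f v) :
    ∫ ζ : ℝ, f (bruhat ζ) = ∫ s in (0 : ℝ)..1, Real.pi * f (circleVec s) := by
  have hsin : ∀ s ∈ Ioo (0 : ℝ) 1, 0 < Real.sin (Real.pi * s) := fun s hs =>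
    Real.sin_pos_of_pos_of_lt_pi (mul_pos Real.pi_pos hs.1)
      (by nlinarith [Real.pi_pos, hs.2])
  set m : ℝ → ℝ := fun s => -Real.cos (Real.pi * s) / Real.sin (Real.pi * s) with hm
  have hder : ∀ s ∈ Ioo (0 : ℝ) 1,
      HasDerivWithinAt m (Real.pi / Real.sin (Real.pi * s) ^ 2) (Ioo 0 1) s := by
    intro s hs
    have h0 : HasDerivAt (fun s : ℝ => Real.pi * s) Real.pi s := by
      simpa using (hasDerivAt_id s).const_mul Real.pi
    refine ((h0.cos.fun_neg.div h0.sin (hsin s hs).ne').congr_deriv ?_).hasDerivWithinAt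
    congr 1
    linear_combination Real.pi * Real.sin_sq_add_cos_sq (Real.pi * s)
  have hinj : InjOn m (Ioo 0 1) := by
    intro x hx y hy hxy
    simp only [hm] at hxy
    rw [div_eq_div_iff (hsin x hx).ne' (hsin y hy).ne'] at hxy
    have h1 : Real.sin (Real.pi * x - Real.pi * y) = 0 := by
      rw [Real.sin_sub]
      linarith
    rw [Real.sin_eq_zero_iff_of_lt_of_lt (by nlinarith [Real.pi_pos, hx.1, hy.2])
      (by nlinarith [Real.pi_pos, hx.2, hy.1])] at h1
    exact mul_left_cancel₀ Real.pi_ne_zero (sub_eq_zero.1 h1)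
  have himg : m '' Ioo 0 1 = univ := by
    refine eq_univ_of_forall fun ζ => ⟨(Real.arctan ζ + Real.pi / 2) / Real.pi, ⟨?_, ?_⟩, ?_⟩
    · have := Real.neg_pi_div_two_lt_arctan ζ
      exact div_pos (by linarith) Real.pi_pos
    · rw [div_lt_one Real.pi_pos]
      linarith [Real.arctan_lt_pi_div_two ζ]
    · simp only [hm]
      rw [mul_div_cancel₀ _ Real.pi_ne_zero, Real.cos_add_pi_div_two, Real.sin_add_pi_div_two,
        neg_neg, ← Real.tan_eq_sin_div_cos, Real.tan_arctan]
  rw [← setIntegral_univ, ← himg, integral_image_eq_integral_abs_deriv_smul measurableSet_Ioo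
    hder hinj, intervalIntegral.integral_of_le zero_le_one, integral_Ioc_eq_integral_Ioo]
  refine setIntegral_congr_fun measurableSet_Ioo fun s hs => ?_
  have hs0 := hsin s hs
  have h1 : bruhat (m s) = (Real.sin (Real.pi * s))⁻¹ • circleVec s := by
    ext i
    fin_cases i
    · simp [bruhat, circleVec, hm]
      ring
    · simp [bruhat, circleVec, hs0.ne']
  rw [h1, hf _ (inv_pos.2 hs0).ne' _ (circleVec_ne_zero s),
    abs_of_pos (div_pos Real.pi_pos (pow_pos hs0 2)), Complex.real_smul, ← mul_assoc,
    ← Complex.ofReal_mul]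
  congr 2
  field_simp

/-- The quadratic form of `chart (t, θ)` on the circle. -/
def circleForm (y : (Fin 2 → ℝ) × ℝ) : ℝ :=
  (Real.sinh (y.1 0) - Real.cosh (y.1 0) * Real.sin (y.1 1 + 2 * (Real.pi * y.2))) / 2

theorem quadForm_circleVec (p : Fin 2 → ℝ) (s : ℝ) :
    quadForm ⟨chart p, chart_mem p⟩ (circleVec s) = circleForm (p, s) := by
  have h := Real.sin_sq_add_cos_sq (Real.pi * s)
  simp only [quadForm, chart, circleVec, circleForm, Real.sin_add, Real.sin_two_mul,
    Real.cos_two_mul', Matrix.cons_val_zero, Matrix.cons_val_one, Matrix.cons_val]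
  linear_combination Real.sinh (p 0) / 2 * h

theorem contDiff_circleForm : ContDiff ℝ ∞ circleForm := by
  unfold circleForm
  fun_prop

/-- The derivative of `circleForm` in `t`. -/
def circleFormT (y : (Fin 2 → ℝ) × ℝ) : ℝ :=
  (Real.cosh (y.1 0) - Real.sinh (y.1 0) * Real.sin (y.1 1 + 2 * (Real.pi * y.2))) / 2

/-- The derivative of `circleForm` in `θ`. -/
def circleFormTheta (y : (Fin 2 → ℝ) × ℝ) : ℝ :=
  -(Real.cosh (y.1 0) * Real.cos (y.1 1 + 2 * (Real.pi * y.2))) / 2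

theorem contDiff_circleFormT : ContDiff ℝ ∞ circleFormT := by
  unfold circleFormT
  fun_prop

theorem contDiff_circleFormTheta : ContDiff ℝ ∞ circleFormTheta := by
  unfold circleFormTheta
  fun_prop

theorem fderiv_eq_of_hasDerivAt {f : (Fin 2 → ℝ) × ℝ → ℝ} (hf : ContDiff ℝ ∞ f)
    {y v : (Fin 2 → ℝ) × ℝ} {d : ℝ} (h : HasDerivAt (fun s : ℝ => f (y + s • v)) d 0) :
    fderiv ℝ f y v = d := by
  have hl : HasDerivAt (fun s : ℝ => y + s • v) v 0 := by
    simpa using ((hasDerivAt_id (0 : ℝ)).smul_const v).const_add y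
  have h1 : HasDerivAt (fun s : ℝ => f (y + s • v)) (fderiv ℝ f y v) 0 := by
    refine HasFDerivAt.comp_hasDerivAt (l := f) (0 : ℝ) ?_ hl
    simpa using (hf.differentiable (by simp) y).hasFDerivAt
  exact h1.unique h

theorem hasDerivAt_const_add' (a : ℝ) : HasDerivAt (fun s : ℝ => a + s) 1 0 := by
  simpa using (hasDerivAt_id (0 : ℝ)).const_add a

theorem fderiv_circleForm_zero (y : (Fin 2 → ℝ) × ℝ) :
    fderiv ℝ circleForm y (Pi.single 0 1, 0) = circleFormT y := by
  refine fderiv_eq_of_hasDerivAt contDiff_circleForm ?_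
  have hs := hasDerivAt_const_add' (y.1 0)
  simpa [circleForm, circleFormT] using (hs.sinh.sub (hs.cosh.mul_const
    (Real.sin (y.1 1 + 2 * (Real.pi * y.2))))).div_const 2

theorem fderiv_circleFormT_zero (y : (Fin 2 → ℝ) × ℝ) :
    fderiv ℝ circleFormT y (Pi.single 0 1, 0) = circleForm y := by
  refine fderiv_eq_of_hasDerivAt contDiff_circleFormT ?_
  have hs := hasDerivAt_const_add' (y.1 0)
  simpa [circleForm, circleFormT] using (hs.cosh.sub (hs.sinh.mul_const
    (Real.sin (y.1 1 + 2 * (Real.pi * y.2))))).div_const 2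

theorem fderiv_circleForm_one (y : (Fin 2 → ℝ) × ℝ) :
    fderiv ℝ circleForm y (Pi.single 1 1, 0) = circleFormTheta y := by
  refine fderiv_eq_of_hasDerivAt contDiff_circleForm ?_
  have hs := (hasDerivAt_const_add' (y.1 1)).add_const (2 * (Real.pi * y.2))
  simpa [circleForm, circleFormTheta] using ((hs.sin.const_mul (Real.cosh (y.1 0))).const_sub
    (Real.sinh (y.1 0))).div_const 2

theorem fderiv_circleFormTheta_one (y : (Fin 2 → ℝ) × ℝ) :
    fderiv ℝ circleFormTheta y (Pi.single 1 1, 0) =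
      Real.cosh (y.1 0) * Real.sin (y.1 1 + 2 * (Real.pi * y.2)) / 2 := by
  refine fderiv_eq_of_hasDerivAt contDiff_circleFormTheta ?_
  have hs := (hasDerivAt_const_add' (y.1 1)).add_const (2 * (Real.pi * y.2))
  simpa [circleFormTheta] using ((hs.cos.const_mul (Real.cosh (y.1 0))).neg).div_const 2

variable {lam : ℂ}

theorem notMem_poles_of_re_pos (hlam : 0 < lam.re) : lam ∉ poles := by
  rintro ⟨k, rfl⟩
  simp at hlam
  linarith [Nat.cast_nonneg (α := ℝ) k]

/-- The Poisson transform as an integral over a half circle. -/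
theorem inChart_poissonOp_eq_powIntegral (σ : ℤˣ) (hlam : 0 < lam.re) (h : PrincipalSeries lam) :
    inChart (poissonOp σ lam h).toFun = powIntegral σ circleForm (lam / 2 - 1)
      fun y => Real.pi * h.toFun (circleVec y.2) := by
  ext p
  rw [inChart_poissonOp σ (notMem_poles_of_re_pos hlam), ← (integral_poisson hlam σ (lift p) h).2,
    act_lift_basePoint, powIntegral_eq]
  simp only [← quadForm_bruhat]
  rw [integral_bruhat_eq_integral_circle
    (f := fun v => signPow σ (quadForm ⟨chart p, chart_mem p⟩ v) (lam / 2 - 1) * h.toFun v)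
    (signPow_quadForm_homogeneous σ _ h)]
  refine intervalIntegral.integral_congr fun s _ => ?_
  simp only [quadForm_circleVec]
  ring

theorem partialDeriv_powIntegral (σ : ℤˣ) {Q Q' : (Fin 2 → ℝ) × ℝ → ℝ} (hQ : ContDiff ℝ ∞ Q)
    {μ : ℂ} (hμ : 1 < μ.re) {a a' : (Fin 2 → ℝ) × ℝ → ℂ} (ha : ContDiff ℝ ∞ a) (i : Fin 2)
    (hQ' : ∀ y, fderiv ℝ Q y (Pi.single i 1, 0) = Q' y)
    (ha' : ∀ y, fderiv ℝ a y (Pi.single i 1, 0) = a' y) :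
    partialDeriv i (powIntegral σ Q μ a) = fun p =>
      powIntegral σ Q (μ - 1) (fun y => signReal σ * μ * Q' y * a y) p +
        powIntegral σ Q μ a' p := by
  ext p
  rw [partialDeriv, fderiv_powIntegral σ hQ hμ ha]
  simp only [hQ', ha']

/-- Each derivative lowers the exponent by one; `Re μ > 2` keeps it above `1` when the second
derivative is taken. -/
theorem partialDeriv_partialDeriv_powIntegral (σ : ℤˣ) {Q Q' Q'' : (Fin 2 → ℝ) × ℝ → ℝ}
    (hQ : ContDiff ℝ ∞ Q) (sQ' : ContDiff ℝ ∞ Q') {μ : ℂ} (hμ : 2 < μ.re)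
    {a : (Fin 2 → ℝ) × ℝ → ℂ} (ha : ContDiff ℝ ∞ a) (i : Fin 2)
    (hQ' : ∀ y, fderiv ℝ Q y (Pi.single i 1, 0) = Q' y)
    (hQ'' : ∀ y, fderiv ℝ Q' y (Pi.single i 1, 0) = Q'' y)
    (ha' : ∀ y, fderiv ℝ a y (Pi.single i 1, 0) = 0) (p : Fin 2 → ℝ) :
    partialDeriv i (powIntegral σ Q μ a) p =
      powIntegral σ Q (μ - 1) (fun y => signReal σ * μ * Q' y * a y) p ∧
    partialDeriv i (partialDeriv i (powIntegral σ Q μ a)) p =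
      powIntegral σ Q (μ - 1 - 1)
        (fun y => signReal σ * (μ - 1) * Q' y * (signReal σ * μ * Q' y * a y)) p +
      powIntegral σ Q (μ - 1) (fun y => signReal σ * μ * Q'' y * a y) p := by
  have h0 : ∀ p, powIntegral σ Q μ (fun _ => 0) p = 0 := fun p => by simp [powIntegral_eq]
  have h1 : partialDeriv i (powIntegral σ Q μ a) =
      powIntegral σ Q (μ - 1) (fun y => signReal σ * μ * Q' y * a y) := by
    rw [partialDeriv_powIntegral σ hQ (by linarith) ha i hQ' ha']
    simp only [h0, add_zero]
  have sQc : ContDiff ℝ ∞ fun y => (Q' y : ℂ) := Complex.ofRealCLM.contDiff.comp sQ'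
  refine ⟨congrFun h1 p, ?_⟩
  rw [h1, partialDeriv_powIntegral σ hQ (by simp; linarith) ((contDiff_const.mul sQc).mul ha) i hQ'
    (a' := fun y => signReal σ * μ * Q'' y * a y)]
  intro y
  have d1 : HasFDerivAt (fun y => (Q' y : ℂ)) _ y :=
    Complex.ofRealCLM.hasFDerivAt.comp y (sQ'.differentiable (by simp) y).hasFDerivAt
  have d2 := ((d1.const_mul (signReal σ * μ : ℂ)).fun_mul
    (ha.differentiable (by simp) y).hasFDerivAt).fderiv
  rw [d2]
  simp [ha' y, hQ'' y]
  ring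

/-- Reduces the eigenvalue equation to an identity of integrands; the shape is that of the Laplacian
in coordinates applied to power integrals. -/
theorem integral_linear_combination {A B C D E F : ℝ → ℂ} (hA : Continuous A) (hB : Continuous B)
    (hC : Continuous C) (hD : Continuous D) (hE : Continuous E) {k m c : ℂ}
    (h : ∀ s, -(A s + B s) - k * C s + m * (D s + E s) = c * F s) :
    -((∫ s in (0 : ℝ)..1, A s) + ∫ s in (0 : ℝ)..1, B s) - k * (∫ s in (0 : ℝ)..1, C s) +
      m * ((∫ s in (0 : ℝ)..1, D s) + ∫ s in (0 : ℝ)..1, E s) = c * ∫ s in (0 : ℝ)..1, F s := by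
  have i {G : ℝ → ℂ} (hG : Continuous G) : IntervalIntegrable G volume 0 1 :=
    hG.intervalIntegrable 0 1
  rw [← intervalIntegral.integral_const_mul c, ← intervalIntegral.integral_congr fun s _ => h s,
    intervalIntegral.integral_add (i (by fun_prop)) (i (by fun_prop)),
    intervalIntegral.integral_sub (i (by fun_prop)) (i (by fun_prop)),
    intervalIntegral.integral_neg, intervalIntegral.integral_add (i hA) (i hB),
    intervalIntegral.integral_const_mul, intervalIntegral.integral_const_mul,
    intervalIntegral.integral_add (i hD) (i hE)]

/-- The chain rule gives `Δ q^μ = μ (μ - 1) q^(μ-2) |∇q|² + μ q^(μ-1) Δq`. With `|∇q|² = -q²` and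
`Δq = -2q` this is `-(μ (μ - 1) + 2 μ) q^μ`. -/
theorem laplaceBeltrami_powIntegral (σ : ℤˣ) {μ : ℂ} (hμ : 2 < μ.re)
    {a : (Fin 2 → ℝ) × ℝ → ℂ} (ha : ContDiff ℝ ∞ a)
    (ha' : ∀ i y, fderiv ℝ a y (Pi.single i 1, 0) = 0)
    (hs : ContDiff ℝ ∞ (powIntegral σ circleForm μ a)) (p : Fin 2 → ℝ) :
    laplaceBeltrami inducedMetric (powIntegral σ circleForm μ a) p =
      -(μ * (μ + 1)) * powIntegral σ circleForm μ a p := by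
  obtain ⟨ht, htt⟩ := partialDeriv_partialDeriv_powIntegral σ contDiff_circleForm
    contDiff_circleFormT hμ ha 0 fderiv_circleForm_zero fderiv_circleFormT_zero (ha' 0) p
  obtain ⟨-, hθθ⟩ := partialDeriv_partialDeriv_powIntegral σ contDiff_circleForm
    contDiff_circleFormTheta hμ ha 1 fderiv_circleForm_one fderiv_circleFormTheta_one (ha' 1) p
  rw [laplaceBeltrami_inducedMetric hs, ht, htt, hθθ]
  simp only [powIntegral_eq]
  have hsl : Continuous fun s : ℝ => (p, s) := by fun_prop
  have hT : ∀ {μ : ℂ}, 0 < μ.re → Continuous fun s : ℝ => signPow σ (circleForm (p, s)) μ :=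
    fun hμ => (continuous_signPow σ hμ).comp (contDiff_circleForm.continuous.comp hsl)
  have hT1 := hT (μ := μ - 1) (by simp; linarith)
  have hT2 := hT (μ := μ - 1 - 1) (by simp; linarith)
  have ca : Continuous fun s : ℝ => a (p, s) := ha.continuous.comp hsl
  have cQ := contDiff_circleForm.continuous.comp hsl
  have cQt := contDiff_circleFormT.continuous.comp hsl
  have cQθ := contDiff_circleFormTheta.continuous.comp hsl
  simp only [Function.comp_def] at cQ cQt cQθ
  refine integral_linear_combination (by fun_prop) (by fun_prop) (by fun_prop) (by fun_prop)
    (by fun_prop) fun s => ?_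
  have hc : (Real.cosh (p 0) : ℝ) ≠ 0 := (Real.cosh_pos _).ne'
  have hch := Real.cosh_sq (p 0)
  have hsc := Real.sin_sq_add_cos_sq (p 1 + 2 * (Real.pi * s))
  -- The identity `|∇q|² = -q²` for the metric `-dt² + cosh² t dθ²`; `r2` is `Δq = -2q`, where the
  -- second `t`-derivative of `q` is `q` itself.
  have r1 : -circleFormT (p, s) ^ 2 + (Real.cosh (p 0) ^ 2)⁻¹ * circleFormTheta (p, s) ^ 2 =
      -circleForm (p, s) ^ 2 := by
    simp only [circleForm, circleFormT, circleFormTheta]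
    generalize Real.sin (p 1 + 2 * (Real.pi * s)) = sn at hsc ⊢
    generalize Real.cos (p 1 + 2 * (Real.pi * s)) = cs at hsc ⊢
    field_simp
    linear_combination (sn ^ 2 - 1) * hch + hsc
  have r2 : -circleForm (p, s) - Real.sinh (p 0) / Real.cosh (p 0) * circleFormT (p, s) +
      (Real.cosh (p 0) ^ 2)⁻¹ *
        (Real.cosh (p 0) * Real.sin (p 1 + 2 * (Real.pi * s)) / 2) = -2 * circleForm (p, s) := by
    simp only [circleForm, circleFormT]
    generalize Real.sin (p 1 + 2 * (Real.pi * s)) = sn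
    field_simp
    linear_combination -sn * hch
  have c1 := congrArg (fun x : ℝ => (x : ℂ)) r1
  have c2 := congrArg (fun x : ℝ => (x : ℂ)) r2
  have t1 := signPow_mul_self σ (circleForm (p, s)) (μ - 1)
  have t2 := signPow_mul_self σ (circleForm (p, s)) (μ - 1 - 1)
  have hσ : (signReal σ : ℂ) * signReal σ = 1 := by exact_mod_cast signReal_mul_self σ
  rw [sub_add_cancel] at t1 t2
  simp only [Complex.ofReal_add, Complex.ofReal_sub, Complex.ofReal_neg, Complex.ofReal_mul,
    Complex.ofReal_pow, Complex.ofReal_inv, Complex.ofReal_div, Complex.ofReal_ofNat] at c1 c2 ⊢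
  generalize signPow σ (circleForm (p, s)) (μ - 1 - 1) = T2 at *
  generalize signPow σ (circleForm (p, s)) (μ - 1) = T1 at *
  generalize signPow σ (circleForm (p, s)) μ = T0 at *
  generalize (circleForm (p, s) : ℂ) = q at *
  generalize (circleFormT (p, s) : ℂ) = qt at *
  generalize (circleFormTheta (p, s) : ℂ) = qθ at *
  generalize (Real.cosh (p 0) : ℂ) = ch at *
  generalize (Real.sinh (p 0) : ℂ) = sh at *
  generalize (Real.sin (p 1 + 2 * (Real.pi * s)) : ℂ) = sn at *
  generalize (signReal σ : ℂ) = e at *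
  generalize a (p, s) = b at *
  linear_combination (e * e * μ * (μ - 1) * T2 * b) * c1 + (e * μ * T1 * b) * c2 -
    (e * e * μ * (μ - 1) * b * q) * t2 - (e * e * e * μ * (μ - 1) * b + 2 * e * μ * b) * t1 -
    (μ * (μ - 1) * b * T0 * (e * e + 1) + 2 * μ * b * T0) * hσ

/-- The bound `6` is `Re μ > 2` expressed through `λ = 2 μ + 2`. -/
theorem poissonOp_eigen_of_re_gt (σ : ℤˣ) (hlam : 6 < lam.re) (h : PrincipalSeries lam)
    (p : Fin 2 → ℝ) : laplaceBeltrami inducedMetric (inChart (poissonOp σ lam h).toFun) p =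
      -(1 / 4) * lam * (lam - 2) * inChart (poissonOp σ lam h).toFun p := by
  have hs : ContDiff ℝ ∞ (inChart (poissonOp σ lam h).toFun) := (poissonOp σ lam h).2
  have hre : (2 : ℝ) < (lam / 2 - 1).re := by
    have : (lam / 2).re = lam.re / 2 := by simp
    rw [Complex.sub_re, this, Complex.one_re]
    linarith
  have ha₁ : ContDiff ℝ ∞ fun s : ℝ => (Real.pi : ℂ) * h.toFun (circleVec s) :=
    contDiff_const.mul (h.contDiffOn.comp_contDiff contDiff_circleVec circleVec_ne_zero)
  have ha : ContDiff ℝ ∞ fun y : (Fin 2 → ℝ) × ℝ => (Real.pi : ℂ) * h.toFun (circleVec y.2) :=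
    ha₁.comp contDiff_snd
  rw [inChart_poissonOp_eq_powIntegral σ (by linarith)] at hs ⊢
  rw [laplaceBeltrami_powIntegral σ hre ha ?_ hs]
  · ring
  · intro i y
    have h1 : HasFDerivAt (fun y : (Fin 2 → ℝ) × ℝ => (Real.pi : ℂ) * h.toFun (circleVec y.2))
        _ y := HasFDerivAt.comp (g := fun s : ℝ => (Real.pi : ℂ) * h.toFun (circleVec s)) y
      (ha₁.differentiable (by simp) y.2).hasFDerivAt hasFDerivAt_snd
    rw [h1.fderiv]
    simp

end CircleModel

/-! ### Continuation of the eigenvalue equation in `λ` -/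

section Eigenfunctions

/-- Smooth families of functions of `(t, θ)` that are holomorphic in `λ` off the poles. -/
def IsHolFamily (f : ℂ × (Fin 2 → ℝ) → ℂ) : Prop :=
  ∀ x : ℂ × (Fin 2 → ℝ), x.1 ∉ poles →
    ContDiffAt ℝ ∞ f x ∧ IsCR (ContinuousLinearMap.inl ℝ ℂ (Fin 2 → ℝ)) f x

variable {f : ℂ × (Fin 2 → ℝ) → ℂ}

theorem IsHolFamily.partial (hf : IsHolFamily f) (i : Fin 2) :
    IsHolFamily fun x => fderiv ℝ f x (0, Pi.single i 1) := by
  intro x hx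
  obtain ⟨h1, h2⟩ := hf x hx
  refine ⟨(h1.fderiv_right (by simp)).clm_apply contDiffAt_const, ?_⟩
  refine IsCR.fderiv_apply (h1.of_le two_le_infty) ?_ _
  have hev : ∀ᶠ y : ℂ × (Fin 2 → ℝ) in 𝓝 x, y.1 ∈ polesᶜ :=
    continuous_fst.continuousAt.eventually (isOpen_compl_poles.mem_nhds hx)
  exact hev.mono fun y hy => (hf y hy).2

theorem IsHolFamily.differentiableOn (hf : IsHolFamily f) (p : Fin 2 → ℝ) :
    DifferentiableOn ℂ (fun z => f (z, p)) polesᶜ := fun z hz =>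
  (IsCR.hasDerivAt ((hf (z, p) hz).1.differentiableAt (by simp))
    (hf (z, p) hz).2).differentiableAt.differentiableWithinAt

theorem IsHolFamily.partialDeriv (hf : IsHolFamily f) {lam : ℂ} (hlam : lam ∉ poles) (i : Fin 2) :
    partialDeriv i (fun p => f (lam, p)) = fun p => fderiv ℝ f (lam, p) (0, Pi.single i 1) := by
  ext p
  have h1 : HasFDerivAt (fun p : Fin 2 → ℝ => (lam, p))
      (ContinuousLinearMap.inr ℝ ℂ (Fin 2 → ℝ)) p := hasFDerivAt_prodMk_right lam p
  have h2 : HasFDerivAt (fun p => f (lam, p)) _ p := HasFDerivAt.comp (g := f) p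
    ((hf (lam, p) hlam).1.differentiableAt (by simp)).hasFDerivAt h1
  rw [DeSitterPoisson.partialDeriv, h2.fderiv]
  rfl

theorem IsHolFamily.laplaceBeltrami (hf : IsHolFamily f) {lam : ℂ} (hlam : lam ∉ poles)
    (hs : ContDiff ℝ ∞ fun p => f (lam, p)) (p : Fin 2 → ℝ) :
    laplaceBeltrami inducedMetric (fun p => f (lam, p)) p =
      -fderiv ℝ (fun x => fderiv ℝ f x (0, Pi.single 0 1)) (lam, p) (0, Pi.single 0 1) -
        (Real.sinh (p 0) / Real.cosh (p 0) : ℝ) * fderiv ℝ f (lam, p) (0, Pi.single 0 1) +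
        ((Real.cosh (p 0) ^ 2)⁻¹ : ℝ) *
          fderiv ℝ (fun x => fderiv ℝ f x (0, Pi.single 1 1)) (lam, p) (0, Pi.single 1 1) := by
  rw [laplaceBeltrami_inducedMetric hs, hf.partialDeriv hlam, hf.partialDeriv hlam,
    (hf.partial 0).partialDeriv hlam, (hf.partial 1).partialDeriv hlam]

/-- At a fixed `p`, partial derivatives of a holomorphic family are holomorphic in `λ`, hence so is
the Laplacian; the identity theorem applies pointwise. -/
theorem IsHolFamily.laplaceBeltrami_eq_of_lt_re (hf : IsHolFamily f)
    (hs : ∀ z ∉ poles, ContDiff ℝ ∞ fun p => f (z, p)) {c : ℂ → ℂ} (hc : Differentiable ℂ c)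
    {a : ℝ} (p : Fin 2 → ℝ)
    (h : ∀ z : ℂ, a < z.re →
      DeSitterPoisson.laplaceBeltrami inducedMetric (fun p => f (z, p)) p = c z * f (z, p))
    {lam : ℂ} (hlam : lam ∉ poles) :
    DeSitterPoisson.laplaceBeltrami inducedMetric (fun p => f (lam, p)) p =
      c lam * f (lam, p) := by
  have hd : DifferentiableOn ℂ
      (fun z => DeSitterPoisson.laplaceBeltrami inducedMetric (fun p => f (z, p)) p) polesᶜ := by
    refine DifferentiableOn.congr ?_ fun z hz => hf.laplaceBeltrami hz (hs z hz) p
    exact ((((hf.partial 0).partial 0).differentiableOn p).neg.sub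
      (((hf.partial 0).differentiableOn p).const_mul _)).add
      ((((hf.partial 1).partial 1).differentiableOn p).const_mul _)
  exact eq_of_eq_of_lt_re hd (hc.differentiableOn.mul (hf.differentiableOn p)) h hlam

theorem poissonOp_mem_eigenspace (σ : ℤˣ) {lam : ℂ} (hlam : lam ∉ poles)
    (h : PrincipalSeries lam) : poissonOp σ lam h ∈ eigenspace lam := by
  obtain ⟨φ, rfl⟩ := exists_compactPicture_eq h
  intro p
  have hin : ∀ z ∉ poles, inChart (poissonOp σ z (compactPicture z φ)).toFun =
      fun p => mellinCont (z / 2 - 1) (slice σ (lift p) (compactPicture z φ).toFun) :=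
    fun z hz => funext fun p => inChart_poissonOp σ hz _ p
  have hfam : IsHolFamily fun x : ℂ × (Fin 2 → ℝ) =>
      mellinCont (x.1 / 2 - 1) (slice σ (lift x.2) (compactPicture x.1 φ).toFun) :=
    fun x hx => contDiffAt_mellinCont_slice contDiff_lift σ φ hx
  rw [hin lam hlam]
  refine hfam.laplaceBeltrami_eq_of_lt_re (fun z hz => ?_)
    (c := fun z => -(1 / 4) * z * (z - 2)) (by fun_prop) (a := 6) p (fun z hz => ?_) hlam
  · have hs : ContDiff ℝ ∞ (inChart (poissonOp σ z (compactPicture z φ)).toFun) :=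
      (poissonOp σ z (compactPicture z φ)).2
    rwa [hin z hz] at hs
  · have h1 := poissonOp_eigen_of_re_gt σ hz (compactPicture z φ) p
    rwa [hin z (notMem_poles_of_re_pos (by linarith))] at h1

end Eigenfunctions

/-! ### Comparison with the holographic operator, and the conclusion -/

section MainTheorem

/-- The points `g P` and `g w P` are represented by `g (0, 1)` and `-g (1, 0)`, whose determinant is
`1`. All prefactors vanish from the formula, and the product of the two linear forms is
`poissonBase`. -/
theorem iota1_holographic (ε : ℤˣ) (μ : ℂ) (h : Vec → ℂ) (g : SL2) :
    iota1 (holographic ε μ h) g =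
      ∫ ζ : ℝ, signPow (-ε) (poissonBase (act g basePoint) ζ) μ * h (bruhat ζ) := by
  obtain ⟨h0, h1, h2⟩ := act_basePoint_coords g
  have hdet := det_eq_one g
  have e1 : g.1 *ᵥ bruhat 0 = ![g.1 0 1, g.1 1 1] := by rw [mulVec_bruhat]; simp
  have e2 : (g * weyl).1 *ᵥ bruhat 0 = ![-g.1 0 0, -g.1 1 0] := by
    rw [mulVec_bruhat, Matrix.SpecialLinearGroup.coe_mul]
    simp [weyl, Matrix.mul_apply, Fin.sum_univ_two]
  have e3 : det2 ![g.1 0 1, g.1 1 1] ![-g.1 0 0, -g.1 1 0] = 1 := by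
    simp [det2]
    linarith
  rw [iota1, holographic, e1, e2, e3]
  simp only [Complex.ofReal_one, inv_one, one_mul]
  refine integral_congr_ae (Eventually.of_forall fun ζ => ?_)
  simp only [kernelK, e3]
  rw [mul_comm]
  congr 2
  simp only [det2, bruhat, poissonBase, h0, h1, h2, Matrix.cons_val_zero, Matrix.cons_val_one,
    Matrix.cons_val_fin_one]
  ring

/-- The factorization rests on `y² - z² = (1 - x) (1 + x)`. -/
theorem poissonBase_eq_div (A : deSitter) (ζ : ℝ) (hA : A.1 0 ≠ -1) : poissonBase A ζ =
    ((1 + A.1 0) * ζ + (A.1 1 + A.1 2)) * ((1 + A.1 0) - (A.1 1 - A.1 2) * ζ) /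
      (2 * (1 + A.1 0)) := by
  have h1 : 1 + A.1 0 ≠ 0 := fun h => hA (by linarith)
  have h2 : A.1 0 ^ 2 + A.1 1 ^ 2 - A.1 2 ^ 2 = 1 := A.2
  rw [poissonBase, eq_div_iff (mul_ne_zero two_ne_zero h1)]
  linear_combination ζ * h2

end MainTheorem

end DeSitterPoisson

end

theorem mainTheorem4 (ε : ℤˣ) :
    ∃ P : ∀ lam : ℂ, PrincipalSeries lam →L[ℂ] SmoothDeSitter,
      -- in the domain of convergence, `P_λ` is `ι_1^* ∘ H_{λ/2-1}`, with the explicit kernel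
      (∀ lam : ℂ, 0 < lam.re → ∀ h : PrincipalSeries lam,
        (∀ g : SL2, (P lam h).toFun (act g basePoint) =
          iota1 (holographic ε (lam / 2 - 1) h.toFun) g) ∧
        (∀ A : deSitter,
          Integrable (fun ζ : ℝ =>
            signPow (-ε) (poissonBase A ζ) (lam / 2 - 1) * h.toFun (bruhat ζ)) volume ∧
          (P lam h).toFun A =
            ∫ ζ : ℝ, signPow (-ε) (poissonBase A ζ) (lam / 2 - 1) * h.toFun (bruhat ζ))) ∧
      (∀ (A : deSitter) (ζ : ℝ), A.1 0 ≠ -1 → poissonBase A ζ =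
        ((1 + A.1 0) * ζ + (A.1 1 + A.1 2)) * ((1 + A.1 0) - (A.1 1 - A.1 2) * ζ) /
          (2 * (1 + A.1 0))) ∧
      -- the operators depend meromorphically on `λ`
      (∀ lam : ℂ, MeromorphicFamilyAt (fun s φ => P s (compactPicture s φ)) lam) ∧
      (∀ lam : ℂ, lam ∉ poles →
        HolomorphicFamilyAt (fun s φ => P s (compactPicture s φ)) lam) ∧
      -- off the poles they intertwine the actions of `G` and map into the Laplace eigenspace
      (∀ lam : ℂ, lam ∉ poles →
        (∀ h : PrincipalSeries lam, P lam h ∈ eigenspace lam) ∧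
        (∀ (g : SL2) (h : PrincipalSeries lam) (A : deSitter),
          (P lam (rho lam g h)).toFun A = (P lam h).toFun (act g⁻¹ A))) := by
  have key : ∀ lam : ℂ, 0 < lam.re → ∀ (h : PrincipalSeries lam) (g : SL2),
      (poissonOp (-ε) lam h).toFun (act g basePoint) = ∫ ζ : ℝ,
        signPow (-ε) (poissonBase (act g basePoint) ζ) (lam / 2 - 1) * h.toFun (bruhat ζ) := by
    intro lam hlam h g
    rw [poissonOp_toFun_act (-ε) (notMem_poles_of_re_pos hlam), (integral_poisson hlam _ g h).2]
  -- The operator labelled `ε` has the kernel with the opposite sign, hence the argument `-ε`.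
  refine ⟨poissonOp (-ε), fun lam hlam h => ⟨fun g => ?_, fun A => ?_⟩, poissonBase_eq_div,
    meromorphicFamilyAt_poissonOp (-ε), fun lam hlam => holomorphicFamilyAt_poissonOp (-ε) hlam,
    fun lam hlam => ⟨poissonOp_mem_eigenspace (-ε) hlam, poissonOp_rho (-ε) hlam⟩⟩
  · rw [iota1_holographic, key lam hlam]
  -- Every point of `dS²` is `g E₁₁` for some `g`, so the formula on the orbit is the formula
  -- everywhere.
  · rw [← act_lift_coords A]
    exact ⟨(integral_poisson hlam _ _ h).1, key lam hlam h _⟩
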